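/- Let $X$ be a $C^\infty$ manifold of dimension $n$ (Hausdorff, second countable) and let $\mathbb K=\mathbb R$ or $\mathbb C$. Let $\mathcal E_X$ be the sheaf of real-valued smooth functions, $\mathcal E(\mathbb K)$ the sheaf of $\mathbb K$-valued smooth functions, and $\mathcal E(\Lambda^kT^*_X)$ the sheaf of real smooth $k$-forms. Let $\mathcal G$ be a sheaf of $\mathcal E(\mathbb K)$-modules. Write $\mathcal G\otimes\mathcal E(\Lambda^kT^*_X)$ for the tensor product over $\mathcal E_X$; its sections are the $\mathcal E_X$-multilinear alternating maps in $k$ vector fields with values in $\mathcal G$. A connection on $\mathcal G$ is a morphism of sheaves of abelian groups $D:\mathcal G\to\mathcal G\otimes\mathcal E(T^*_X)$ with $D(fg)=f\,Dg+g\otimes df$ for all local sections $f$ of $\mathcal E(\mathbb K)$ and $g$ of $\mathcal G$. With $\nabla_\xi g=(Dg)(\xi)$, it extends to $D:\mathcal G\otimes\mathcal E(\Lambda^kT^*_X)\to\mathcal G\otimes\mathcal E(\Lambda^{k+1}T^*_X)$ by $$(D\omega)(\xi_0,\dots,\xi_k)=\sum_{j}(-1)^j\nabla_{\xi_j}\big(\omega(\xi_0,\dots,\widehat{\xi_j},\dots,\xi_k)\big)+\sum_{j<l}(-1)^{j+l}\omega([\xi_j,\xi_l],\xi_0,\dots,\widehat{\xi_j},\dots,\widehat{\xi_l},\dots,\xi_k).$$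 Suppose that the composite $D^2:\mathcal G\to\mathcal G\otimes\mathcal E(\Lambda^2T^*_X)$ is $0$, and that every point of $X$ has an open neighbourhood $U$ over which there is an exact sequence of sheaves of $\mathcal E(\mathbb K)$-modules $$0\to\mathcal E(\mathbb K)^{p_m}|_U\to\dots\to\mathcal E(\mathbb K)^{p_1}|_U\to\mathcal E(\mathbb K)^{p_0}|_U\to\mathcal G|_U\to0$$ of finite length, with $p_0,\dots,p_m\in\mathbb N$. Let $\operatorname{Ker}D\subset\mathcal G$ be the sheaf of parallel sections. Then: 1. $\operatorname{Ker}D$ generates $\mathcal G$ over $\mathcal E(\mathbb K)$: near each point, every section of $\mathcal G$ is a finite sum $\sum_i f_is_i$ with $f_i$ in $\mathcal E(\mathbb K)$ and $Ds_i=0$. 2. $\mathcal G$ is a locally free sheaf of $\mathcal E(\mathbb K)$-modules of finite rank, and it is the sheaf of smooth sections of a local system: near each point $\mathcal G$ has a finite $\mathcal E(\mathbb K)$-basis $e_1,\dots,e_r$ such that a section $\sum_i a_ie_i$ is parallel if and only if the functions $a_i$ are locally constant. 3. $D\circ D=0$ in all degrees, and $(\mathcal G\otimes\mathcal E(\Lambda^\bullet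 T^*_X),D)$ is an acyclic resolution of $\operatorname{Ker}D$: the sequence of sheaves $0\to\operatorname{Ker}D\to\mathcal G\to\mathcal G\otimes\mathcal E(T^*_X)\to\mathcal G\otimes\mathcal E(\Lambda^2T^*_X)\to\cdots$ is exact, and $H^i(X,\mathcal G\otimes\mathcal E(\Lambda^kT^*_X))=0$ for all $k\ge0$ and $i\ge1$. 4. For every $k\ge0$ there is an isomorphism (de Rham–Weil) $$H^k(X,\operatorname{Ker}D)\;\cong\;H^k\big(\Gamma(X,\mathcal G\otimes\mathcal E(\Lambda^\bullet T^*_X)),D\big),$$ and these isomorphisms are functorial in $(\mathcal G,D)$: they commute with the maps induced by any $\mathcal E(\mathbb K)$-linear morphism $\mathcal G\to\mathcal G'$ that commutes with the connections, where $(\mathcal G,D)$ and $(\mathcal G',D')$ both satisfy the hypotheses. -/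

import Mathlib

open CategoryTheory TopologicalSpace Opposite
open scoped Manifold ContDiff

universe u

set_option linter.unusedSectionVars false
set_option linter.unusedVariables false

noncomputable section
namespace SmoothConn

/-- Sheaves of abelian groups on `X`. -/
abbrev AbSheaf (X : Type u) [TopologicalSpace X] : Type (u + 1) :=
  Sheaf (Opens.grothendieckTopology (TopCat.of X)) AddCommGrpCat.{u}

instance rclikeContMDiffRing (𝕂 : Type) [RCLike 𝕂] : ContMDiffRing 𝓘(ℝ, 𝕂) ∞ 𝕂 :=
  { (inferInstance : LieAddGroup 𝓘(ℝ, 𝕂) ∞ 𝕂) with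
    contMDiff_mul := by
      rw [contMDiff_iff]
      refine ⟨continuous_mul, fun x y => ?_⟩
      simp only [mfld_simps, chartAt_self_eq]
      rw [contDiffOn_univ]
      exact contDiff_mul }

section Basic
variable (n : ℕ) (𝕂 : Type) [RCLike 𝕂] {X : Type u} [TopologicalSpace X]
  [ChartedSpace (EuclideanSpace ℝ (Fin n)) X]

/-- The ring of smooth `𝕂`-valued functions on the open set `U`. -/
abbrev Fn (U : Opens X) : Type u := C^∞⟮𝓡 n, U; 𝓘(ℝ, 𝕂), 𝕂⟯

variable {n 𝕂}

/-- Restriction of functions. -/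
def resFn {U V : Opens X} (h : V ≤ U) : Fn n 𝕂 U →+* Fn n 𝕂 V :=
  ContMDiffMap.restrictRingHom (𝓡 n) 𝓘(ℝ, 𝕂) 𝕂 h

open Classical in
/-- Extension by zero of a function on `U` (used only to differentiate at points of `U`). -/
def extFn {U : Opens X} (f : U → 𝕂) (x : X) : 𝕂 := if h : x ∈ U then f ⟨x, h⟩ else 0

theorem extFn_of_mem {U : Opens X} (f : U → 𝕂) (x : U) : extFn f x = f x := by
  simp [extFn]

theorem contMDiffAt_extFn_iff {U : Opens X} (f : U → 𝕂) (x : U) :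
    ContMDiffAt (𝓡 n) 𝓘(ℝ, 𝕂) ∞ (extFn f) x ↔ ContMDiffAt (𝓡 n) 𝓘(ℝ, 𝕂) ∞ f x := by
  rw [← contMDiffAt_subtype_iff]
  simp only [extFn_of_mem]

theorem Fn.contMDiffAt_ext {U : Opens X} (f : Fn n 𝕂 U) (x : U) :
    ContMDiffAt (𝓡 n) 𝓘(ℝ, 𝕂) ∞ (extFn f) x :=
  (contMDiffAt_extFn_iff _ _).2 (f.contMDiff x)

variable (n 𝕂 X) in
/-- Smoothness, as a local predicate on functions. -/
def smoothPredicate : TopCat.LocalPredicate (X := TopCat.of X) (fun _ => 𝕂) where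
  pred {U} f := ContMDiff (M := U) (𝓡 n) 𝓘(ℝ, 𝕂) ∞ f
  res {U V} i f h := ContMDiff.comp (I' := 𝓡 n) h (contMDiff_inclusion (leOfHom i))
  locality {U} f h := by
    intro x
    obtain ⟨V, hxV, i, hV⟩ := h x
    refine (contMDiffAt_extFn_iff (X := X) f x).1 ?_
    refine ((contMDiffAt_extFn_iff (X := X) _ ⟨x.1, hxV⟩).2 (hV ⟨x.1, hxV⟩)).congr_of_eventuallyEq ?_
    filter_upwards [V.isOpen.mem_nhds hxV] with y hy
    exact (extFn_of_mem (X := X) f ⟨y, leOfHom i hy⟩).trans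
      (extFn_of_mem (X := X) (U := V) (fun z => f ⟨z, leOfHom i z.2⟩) ⟨y, hy⟩).symm

variable (n 𝕂 X) in
/-- The sheaf of rings of smooth `𝕂`-valued functions on `X`. -/
def smoothRing : Sheaf (Opens.grothendieckTopology (TopCat.of X)) RingCat.{u} where
  obj :=
    { obj U := RingCat.of (Fn n 𝕂 (X := X) U.unop)
      map h := RingCat.ofHom (resFn (leOfHom h.unop))
      map_id _ := rfl
      map_comp _ _ := rfl }
  property := by
    rw [CategoryTheory.Presheaf.isSheaf_iff_isSheaf_forget _ _ (CategoryTheory.forget RingCat)]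
    exact (TopCat.subsheafToTypes (smoothPredicate n 𝕂 X)).property

end Basic

section VectorFields
variable (n : ℕ) {𝕂 : Type} [RCLike 𝕂] {X : Type u} [TopologicalSpace X]
  [ChartedSpace (EuclideanSpace ℝ (Fin n)) X]

open Classical in
/-- Extension by zero of a vector field on `U` (used only to differentiate at points of `U`). -/
def extVF {U : Opens X} (ξ : ∀ x : U, TangentSpace (𝓡 n) (x : X)) (x : X) :
    TangentSpace (𝓡 n) x := if h : x ∈ U then ξ ⟨x, h⟩ else 0

theorem extVF_of_mem {U : Opens X} (ξ : ∀ x : U, TangentSpace (𝓡 n) (x : X)) (x : U) :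
    extVF n ξ x = ξ x := by
  simp [extVF]

variable [IsManifold (𝓡 n) ∞ X]

/-- Smooth sections over `U` of the tangent bundle of `X`. -/
def vectorFields (U : Opens X) : Submodule ℝ (∀ x : U, TangentSpace (𝓡 n) (x : X)) where
  carrier := {ξ | ContMDiffOn (𝓡 n) (𝓡 n).tangent ∞
    (fun x => (⟨x, extVF n ξ x⟩ : TangentBundle (𝓡 n) X)) U}
  add_mem' {ξ η} hξ hη := by
    refine (ContMDiffOn.add_section hξ hη).congr fun x hx => ?_
    have := extVF_of_mem n (ξ + η) ⟨x, hx⟩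
    have h1 := extVF_of_mem n ξ ⟨x, hx⟩
    have h2 := extVF_of_mem n η ⟨x, hx⟩
    simp only at this h1 h2
    simp [this, h1, h2]
  zero_mem' := by
    refine (Bundle.contMDiff_zeroSection ℝ (TangentSpace (𝓡 n) : X → Type)).contMDiffOn.congr fun x hx => ?_
    have := extVF_of_mem n (0 : ∀ x : U, TangentSpace (𝓡 n) (x : X)) ⟨x, hx⟩
    simp only at this
    simp [this, Bundle.zeroSection]
  smul_mem' c ξ hξ := by
    refine (ContMDiffOn.const_smul_section (a := c) hξ).congr fun x hx => ?_
    have := extVF_of_mem n (c • ξ) ⟨x, hx⟩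
    have h1 := extVF_of_mem n ξ ⟨x, hx⟩
    simp only at this h1
    simp [this, h1]

/-- The type of smooth vector fields on the open set `U`. -/
abbrev VF (U : Opens X) : Type u := vectorFields n U

variable {n}

theorem VF.contMDiffAt {U : Opens X} (ξ : VF n U) (x : U) :
    ContMDiffAt (𝓡 n) (𝓡 n).tangent ∞
      (fun y => (⟨y, extVF n ξ.1 y⟩ : TangentBundle (𝓡 n) X)) x :=
  ξ.2.contMDiffAt (U.isOpen.mem_nhds x.2)

theorem VF.mem_of_contMDiffAt {U : Opens X} {ξ : ∀ x : U, TangentSpace (𝓡 n) (x : X)}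
    (ζ : ∀ x : X, TangentSpace (𝓡 n) x) (h : ∀ x : U, ζ x = ξ x)
    (hζ : ∀ x : U, ContMDiffAt (𝓡 n) (𝓡 n).tangent ∞
      (fun y => (⟨y, ζ y⟩ : TangentBundle (𝓡 n) X)) x) : ξ ∈ vectorFields n U := by
  intro x hx
  refine ((hζ ⟨x, hx⟩).contMDiffWithinAt (s := U)).congr (fun y hy => ?_) ?_
  · have := extVF_of_mem n ξ ⟨y, hy⟩
    simp only at this
    rw [this, ← h]
  · have := extVF_of_mem n ξ ⟨x, hx⟩
    simp only at this
    rw [this, ← h]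

theorem isManifold_min (n : ℕ) (X : Type u) [TopologicalSpace X]
    [ChartedSpace (EuclideanSpace ℝ (Fin n)) X] [IsManifold (𝓡 n) ∞ X] (k : ℕ) :
    IsManifold (𝓡 n) (minSmoothness ℝ k) X := by
  rw [minSmoothness_of_isRCLikeNormedField]
  exact IsManifold.of_le (n := ∞) (by exact_mod_cast le_top)

instance (U : Opens X) : SMul (Fn n ℝ U) (VF n U) where
  smul f ξ := ⟨fun x => f x • ξ.1 x, by
    refine VF.mem_of_contMDiffAt (fun x => extFn f x • extVF n ξ.1 x) (fun x => ?_) fun x => ?_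
    · rw [extFn_of_mem, extVF_of_mem]
    · exact ContMDiffAt.smul_section (f.contMDiffAt_ext x) (ξ.contMDiffAt x)⟩

theorem VF.smul_apply {U : Opens X} (f : Fn n ℝ U) (ξ : VF n U) (x : U) :
    (f • ξ).1 x = f x • ξ.1 x := rfl

instance (U : Opens X) : Module (Fn n ℝ U) (VF n U) where
  one_smul _ := Subtype.ext (funext fun _ => one_smul ℝ _)
  mul_smul f g _ := Subtype.ext (funext fun x => mul_smul (f x) (g x) _)
  smul_zero f := Subtype.ext (funext fun x => smul_zero (f x))
  smul_add f _ _ := Subtype.ext (funext fun x => smul_add (f x) _ _)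
  add_smul f g _ := Subtype.ext (funext fun x => add_smul (f x) (g x) _)
  zero_smul _ := Subtype.ext (funext fun _ => zero_smul ℝ _)

instance (U : Opens X) : IsScalarTower ℝ (Fn n ℝ U) (VF n U) where
  smul_assoc c f ξ := Subtype.ext (funext fun x => smul_assoc c (f x) (ξ.1 x))

/-- Restriction of vector fields. -/
def resVF {U V : Opens X} (h : V ≤ U) : VF n U →+ VF n V where
  toFun ξ := ⟨fun x => ξ.1 ⟨x, h x.2⟩,
    VF.mem_of_contMDiffAt (extVF n ξ.1) (fun x => extVF_of_mem n ξ.1 ⟨x, h x.2⟩)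
      fun x => ξ.contMDiffAt ⟨x, h x.2⟩⟩
  map_zero' := rfl
  map_add' _ _ := rfl

theorem resVF_smul {U V : Opens X} (h : V ≤ U) (f : Fn n ℝ U) (ξ : VF n U) :
    resVF h (f • ξ) = resFn h f • resVF h ξ := rfl

/-- The derivative `ξ(f) = df(ξ)` of a smooth `𝕂`-valued function along a vector field. -/
def VF.deriv {U : Opens X} (ξ : VF n U) (f : Fn n 𝕂 U) : Fn n 𝕂 U :=
  ⟨fun x => mvfderiv (𝓡 n) (extFn f) (x : X) (ξ.1 x), by
    intro x
    refine (contMDiffAt_extFn_iff _ x).1 ?_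
    have hf : ContMDiffOn (𝓡 n) 𝓘(ℝ, 𝕂) ∞ (extFn f) U := fun y hy =>
      (f.contMDiffAt_ext ⟨y, hy⟩).contMDiffWithinAt
    have ht := hf.contMDiffOn_tangentMapWithin (m := ∞) (by simp) U.isOpen.uniqueMDiffOn
    have hc := ht.comp ξ.2 (fun y hy => hy)
    have hs := (contMDiff_snd_tangentBundle_modelSpace 𝕂 𝓘(ℝ, 𝕂) (n := ∞)).comp_contMDiffOn hc
    refine (hs.contMDiffAt (U.isOpen.mem_nhds x.2)).congr_of_eventuallyEq ?_
    filter_upwards [U.isOpen.mem_nhds x.2] with y hy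
    have h1 := extVF_of_mem n ξ.1 ⟨y, hy⟩
    simp only at h1
    refine (extFn_of_mem _ ⟨y, hy⟩).trans ?_
    change mvfderiv (𝓡 n) (extFn f) y (ξ.1 ⟨y, hy⟩) =
      mfderivWithin (𝓡 n) 𝓘(ℝ, 𝕂) (extFn f) U y (extVF n ξ.1 y)
    rw [mfderivWithin_of_isOpen U.isOpen hy, h1]
    rfl⟩

/-- The Lie bracket of vector fields. -/
def VF.bracket {U : Opens X} (ξ η : VF n U) : VF n U :=
  ⟨fun x => VectorField.mlieBracket (𝓡 n) (extVF n ξ.1) (extVF n η.1) (x : X),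
    VF.mem_of_contMDiffAt _ (fun _ => rfl) fun x => by
      have : IsManifold (𝓡 n) ((⊤ : ℕ∞) + 1) X := inferInstanceAs (IsManifold (𝓡 n) ∞ X)
      have := isManifold_min n X 2
      exact ContMDiffAt.mlieBracket_vectorField (m := ⊤) (n := ⊤)
        (ξ.contMDiffAt x) (η.contMDiffAt x) (by simp)⟩

theorem VF.mdifferentiableAt {U : Opens X} (ξ : VF n U) (x : U) :
    MDifferentiableAt (𝓡 n) (𝓡 n).tangent
      (fun y => (⟨y, extVF n ξ.1 y⟩ : TangentBundle (𝓡 n) X)) x :=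
  (ξ.contMDiffAt x).mdifferentiableAt (by simp)

theorem Fn.mdifferentiableAt_ext {U : Opens X} (f : Fn n 𝕂 U) (x : U) :
    MDifferentiableAt (𝓡 n) 𝓘(ℝ, 𝕂) (extFn f) x :=
  (f.contMDiffAt_ext x).mdifferentiableAt (by simp)

theorem extVF_add {U : Opens X} (ξ η : VF n U) :
    extVF n (ξ + η).1 = extVF n ξ.1 + extVF n η.1 := by
  funext x
  by_cases h : x ∈ U <;> simp [extVF, h]

theorem extVF_smul {U : Opens X} (f : Fn n ℝ U) (ξ : VF n U) :
    extVF n (f • ξ).1 = extFn f • extVF n ξ.1 := by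
  funext x
  by_cases h : x ∈ U
  · simp [extVF, extFn, h, VF.smul_apply]
  · simp [extVF, h]

theorem extVF_const_smul {U : Opens X} (c : ℝ) (ξ : VF n U) :
    extVF n (c • ξ).1 = c • extVF n ξ.1 := by
  funext x
  by_cases h : x ∈ U <;> simp [extVF, h]

theorem VF.bracket_apply {U : Opens X} (ξ η : VF n U) (x : U) :
    (ξ.bracket η).1 x =
      VectorField.mlieBracket (𝓡 n) (extVF n ξ.1) (extVF n η.1) (x : X) := rfl

theorem VF.deriv_apply {U : Opens X} (ξ : VF n U) (f : Fn n 𝕂 U) (x : U) :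
    ξ.deriv f x = mvfderiv (𝓡 n) (extFn f) (x : X) (ξ.1 x) := rfl

theorem VF.bracket_skew {U : Opens X} (ξ η : VF n U) : ξ.bracket η = -η.bracket ξ :=
  Subtype.ext (funext fun _ => VectorField.mlieBracket_swap_apply)

theorem VF.add_bracket {U : Opens X} (ξ ξ' η : VF n U) :
    (ξ + ξ').bracket η = ξ.bracket η + ξ'.bracket η := by
  have := isManifold_min n X 2
  refine Subtype.ext (funext fun x => ?_)
  rw [VF.bracket_apply, extVF_add]
  exact VectorField.mlieBracket_add_left (ξ.mdifferentiableAt x) (ξ'.mdifferentiableAt x)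

theorem VF.smul_bracket {U : Opens X} (f : Fn n ℝ U) (ξ η : VF n U) :
    (f • ξ).bracket η = f • ξ.bracket η - η.deriv f • ξ := by
  have := isManifold_min n X 2
  refine Subtype.ext (funext fun x => ?_)
  rw [VF.bracket_apply, extVF_smul, VectorField.mlieBracket_smul_left
    (f.mdifferentiableAt_ext x) (ξ.mdifferentiableAt x), neg_smul, neg_add_eq_sub,
    extFn_of_mem, extVF_of_mem, extVF_of_mem]
  rfl

theorem VF.const_smul_bracket {U : Opens X} (c : ℝ) (ξ η : VF n U) :
    (c • ξ).bracket η = c • ξ.bracket η := by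
  have := isManifold_min n X 2
  refine Subtype.ext (funext fun x => ?_)
  rw [VF.bracket_apply, extVF_const_smul]
  exact VectorField.mlieBracket_const_smul_left (ξ.mdifferentiableAt x)

/-- The Lie bracket of vector fields as an `ℝ`-bilinear map. -/
def bracketLM (U : Opens X) : VF n U →ₗ[ℝ] VF n U →ₗ[ℝ] VF n U :=
  LinearMap.mk₂ ℝ VF.bracket VF.add_bracket VF.const_smul_bracket
    (fun ξ η η' => by
      rw [VF.bracket_skew, VF.add_bracket, VF.bracket_skew ξ η, VF.bracket_skew ξ η', neg_add])
    (fun c ξ η => by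
      rw [VF.bracket_skew, VF.const_smul_bracket, VF.bracket_skew ξ η, smul_neg])

theorem extVF_resVF {U V : Opens X} (h : V ≤ U) (ξ : VF n U) (x : V) :
    extVF n (resVF h ξ).1 =ᶠ[nhds (x : X)] extVF n ξ.1 := by
  filter_upwards [V.isOpen.mem_nhds x.2] with y hy
  exact (extVF_of_mem n (resVF h ξ).1 ⟨y, hy⟩).trans (extVF_of_mem n ξ.1 ⟨y, h hy⟩).symm

theorem extFn_resFn {U V : Opens X} (h : V ≤ U) (f : Fn n 𝕂 U) (x : V) :
    extFn (resFn h f) =ᶠ[nhds (x : X)] extFn f := by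
  filter_upwards [V.isOpen.mem_nhds x.2] with y hy
  exact (extFn_of_mem (resFn h f) ⟨y, hy⟩).trans (extFn_of_mem f ⟨y, h hy⟩).symm

theorem resVF_bracket {U V : Opens X} (h : V ≤ U) (ξ η : VF n U) :
    resVF h (ξ.bracket η) = (resVF h ξ).bracket (resVF h η) :=
  Subtype.ext (funext fun x =>
    ((extVF_resVF h ξ x).mlieBracket_vectorField_eq (extVF_resVF h η x)).symm)

theorem VF.deriv_const {U : Opens X} (ξ : VF n U) (c : ℝ) :
    ξ.deriv (algebraMap ℝ (Fn n 𝕂 U) c) = 0 := by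
  refine ContMDiffMap.ext fun x => ?_
  have h : extFn (algebraMap ℝ (Fn n 𝕂 U) c) =ᶠ[nhds (x : X)]
      fun _ => (algebraMap ℝ 𝕂 c) := by
    filter_upwards [U.isOpen.mem_nhds x.2] with y hy
    exact extFn_of_mem (algebraMap ℝ (Fn n 𝕂 U) c) ⟨y, hy⟩
  rw [VF.deriv_apply, mvfderiv, h.mfderiv_eq, mfderiv_const]
  rfl

/-- Real-valued smooth functions as `𝕂`-valued ones. -/
def ofRealFn (𝕂 : Type) [RCLike 𝕂] (U : Opens X) : Fn n ℝ U →+* Fn n 𝕂 U where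
  toFun f := ⟨fun x => (f x : 𝕂), (RCLike.ofRealCLM (K := 𝕂)).contDiff.contMDiff.comp f.contMDiff⟩
  map_one' := ContMDiffMap.ext fun _ => RCLike.ofReal_one
  map_zero' := ContMDiffMap.ext fun _ => RCLike.ofReal_zero
  map_mul' f g := ContMDiffMap.ext fun x => RCLike.ofReal_mul (f x) (g x)
  map_add' f g := ContMDiffMap.ext fun x => RCLike.ofReal_add (f x) (g x)

theorem VF.deriv_ofReal {U : Opens X} (ξ : VF n U) (f : Fn n ℝ U) :
    ξ.deriv (ofRealFn 𝕂 U f) = ofRealFn 𝕂 U (ξ.deriv f) := by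
  refine ContMDiffMap.ext fun x => ?_
  have h : extFn (ofRealFn 𝕂 U f) = (RCLike.ofRealCLM (K := 𝕂)) ∘ extFn f := by
    funext y
    by_cases hy : y ∈ U
    · simp only [extFn, hy, dite_true, Function.comp_apply]
      rfl
    · simp [extFn, hy]
  change mvfderiv (𝓡 n) (extFn (ofRealFn 𝕂 U f)) (x : X) (ξ.1 x) =
    ((mvfderiv (𝓡 n) (extFn f) (x : X) (ξ.1 x) : ℝ) : 𝕂)
  rw [h, mvfderiv, mfderiv_comp (I' := 𝓘(ℝ, ℝ)) (x : X)
    (RCLike.ofRealCLM (K := 𝕂)).differentiableAt.mdifferentiableAt (f.mdifferentiableAt_ext x),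
    mfderiv_eq_fderiv, ContinuousLinearMap.fderiv]
  rfl

theorem resFn_deriv {U V : Opens X} (h : V ≤ U) (ξ : VF n U) (f : Fn n 𝕂 U) :
    resFn h (ξ.deriv f) = (resVF h ξ).deriv (resFn h f) := by
  refine ContMDiffMap.ext fun x => ?_
  rw [VF.deriv_apply, mvfderiv, (extFn_resFn h f x).mfderiv_eq]
  rw [(extFn_resFn h f x).eq_of_nhds]
  rfl

end VectorFields

section Koszul
variable {A L M : Type*} [CommRing A] [Algebra ℝ A]
  [AddCommGroup L] [Module ℝ L] [Module A L] [IsScalarTower ℝ A L]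
  [AddCommGroup M] [Module ℝ M] [Module A M] [IsScalarTower ℝ A M]

/-- The sum over `a < b` in the Koszul formula, up to sign. With `a = i` and `b = j + 1`, its
term is `-(-1)^(a+b) θ([ξ_a, ξ_b], ξ_0, …, omit ξ_a, …, omit ξ_b, …, ξ_k)`. -/
def bracketSum (br : L →ₗ[ℝ] L →ₗ[ℝ] L) :
    {k : ℕ} → (L [⋀^Fin k]→ₗ[A] M) → (Fin (k + 1) → L) → M
  | 0, _, _ => 0
  | k + 1, θ, ξ => ∑ i : Fin (k + 1), ∑ j ≥ i, (-1 : ℤ) ^ (i + j : ℕ) •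
      θ (Matrix.vecCons (br (ξ i.castSucc) (ξ j.succ))
        (j.removeNth (i.castSucc.removeNth ξ)))

/-- The Koszul formula
`(Dθ)(ξ_0, …, ξ_k) = ∑ i, (-1)^i ∇_{ξ_i} (θ(ξ_0, …, omit ξ_i, …, ξ_k))
  + ∑ a < b, (-1)^(a+b) θ([ξ_a, ξ_b], ξ_0, …, omit ξ_a, …, omit ξ_b, …, ξ_k)`. -/
def koszulSum (br : L →ₗ[ℝ] L →ₗ[ℝ] L) (nab : L →ₗ[ℝ] M →ₗ[ℝ] M) {k : ℕ}
    (θ : L [⋀^Fin k]→ₗ[A] M) (ξ : Fin (k + 1) → L) : M :=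
  (∑ i : Fin (k + 1), (-1 : ℤ) ^ (i : ℕ) • nab (ξ i) (θ (i.removeNth ξ))) - bracketSum br θ ξ

/-- An alternating `A`-multilinear map, seen as an alternating `ℝ`-multilinear map. -/
def altToReal {k : ℕ} (θ : L [⋀^Fin k]→ₗ[A] M) : L [⋀^Fin k]→ₗ[ℝ] M where
  toMultilinearMap := θ.toMultilinearMap.restrictScalars ℝ
  map_eq_zero_of_eq' := θ.map_eq_zero_of_eq

theorem altToReal_apply {k : ℕ} (θ : L [⋀^Fin k]→ₗ[A] M) (v : Fin k → L) :
    altToReal θ v = θ v := rfl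

/-- `x, y ↦ θ([x, y], …)`. -/
def contractLie (br : L →ₗ[ℝ] L →ₗ[ℝ] L) {k : ℕ} (θ : L [⋀^Fin (k + 1)]→ₗ[A] M) :
    L →ₗ[ℝ] L →ₗ[ℝ] L [⋀^Fin k]→ₗ[ℝ] M :=
  br.compr₂ (AlternatingMap.curryLeft (altToReal θ))

/-- `x ↦ ∇_x ∘ θ`. -/
def covLie (nab : L →ₗ[ℝ] M →ₗ[ℝ] M) {k : ℕ} (θ : L [⋀^Fin k]→ₗ[A] M) :
    L →ₗ[ℝ] L [⋀^Fin k]→ₗ[ℝ] M where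
  toFun ξ := (nab ξ).compAlternatingMap (altToReal θ)
  map_add' ξ η := by ext v; simp [altToReal_apply]
  map_smul' c ξ := by ext v; simp [altToReal_apply]

theorem bracketSum_exists (br : L →ₗ[ℝ] L →ₗ[ℝ] L) (hbr : ∀ x y, br x y = -br y x) {k : ℕ}
    (θ : L [⋀^Fin k]→ₗ[A] M) :
    ∃ β : L [⋀^Fin (k + 1)]→ₗ[ℝ] M, ∀ ξ, bracketSum br θ ξ = β ξ := by
  cases k with
  | zero => exact ⟨0, fun ξ => rfl⟩
  | succ k =>
    refine ⟨(2⁻¹ : ℝ) • AlternatingMap.alternatizeUncurryFin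
      (AlternatingMap.alternatizeUncurryFinLM ∘ₗ contractLie br θ), fun ξ => ?_⟩
    rw [AlternatingMap.smul_apply,
      AlternatingMap.alternatizeUncurryFin_alternatizeUncurryFinLM_comp_apply, bracketSum]
    simp only [Finset.smul_sum]
    refine Finset.sum_congr rfl fun i _ => Finset.sum_congr rfl fun j _ => ?_
    rw [smul_comm]
    congr 1
    simp only [contractLie, LinearMap.compr₂_apply, AlternatingMap.curryLeft_apply_apply]
    rw [hbr (ξ j.succ), altToReal_apply, altToReal_apply]
    have : θ (Matrix.vecCons (-br (ξ i.castSucc) (ξ j.succ))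
        (j.removeNth (i.castSucc.removeNth ξ))) =
        - θ (Matrix.vecCons (br (ξ i.castSucc) (ξ j.succ))
        (j.removeNth (i.castSucc.removeNth ξ))) := by
      simpa using (θ.map_vecCons_smul (j.removeNth (i.castSucc.removeNth ξ)) (-1) (br (ξ i.castSucc) (ξ j.succ)))
    rw [this, sub_neg_eq_add, ← two_smul ℝ, smul_smul]
    norm_num

theorem koszulSum_exists (br : L →ₗ[ℝ] L →ₗ[ℝ] L) (hbr : ∀ x y, br x y = -br y x)
    (nab : L →ₗ[ℝ] M →ₗ[ℝ] M) {k : ℕ} (θ : L [⋀^Fin k]→ₗ[A] M) :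
    ∃ β : L [⋀^Fin (k + 1)]→ₗ[ℝ] M, ∀ ξ, koszulSum br nab θ ξ = β ξ := by
  obtain ⟨β, hβ⟩ := bracketSum_exists br hbr θ
  refine ⟨AlternatingMap.alternatizeUncurryFin (covLie nab θ) - β, fun ξ => ?_⟩
  rw [koszulSum, AlternatingMap.sub_apply, ← hβ, AlternatingMap.alternatizeUncurryFin_apply]
  rfl

theorem koszulSum_smul_zero (br : L →ₗ[ℝ] L →ₗ[ℝ] L)
    (nab : L →ₗ[ℝ] M →ₗ[ℝ] M) (act : L → A → A)
    (hbr' : ∀ (f : A) x y, br (f • x) y = f • br x y - act y f • x)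
    (hl : ∀ (f : A) x m, nab (f • x) m = f • nab x m)
    (hr : ∀ (f : A) x m, nab x (f • m) = f • nab x m + act x f • m)
    {k : ℕ} (θ : L [⋀^Fin k]→ₗ[A] M) (f : A) (x : L) (v : Fin k → L) :
    koszulSum br nab θ (Matrix.vecCons (f • x) v) =
      f • koszulSum br nab θ (Matrix.vecCons x v) := by
  have hrem : ∀ {m : ℕ} (i : Fin (m + 1)) (y : L) (w : Fin (m + 1) → L),
      i.succ.removeNth (Matrix.vecCons y w : Fin (m + 2) → L) =
        Matrix.vecCons y (i.removeNth w) := by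
    intro m i y w
    funext t
    refine Fin.cases ?_ (fun t => ?_) t
    · simp [Fin.removeNth]
    · simp [Fin.removeNth]
  have hrem0 : ∀ {m : ℕ} (y : L) (w : Fin m → L),
      Fin.removeNth 0 (Matrix.vecCons y w : Fin (m + 1) → L) = w := by
    intro m y w; funext t; simp [Fin.removeNth]
  cases k with
  | zero => simp [koszulSum, bracketSum, hl, hrem0]
  | succ k =>
    have hθ : ∀ (b : L) (j : Fin (k + 1)) (w : Fin k → L), j ≠ 0 →
        θ (Matrix.vecCons b (j.removeNth (Matrix.vecCons (f • x) w))) =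
          f • θ (Matrix.vecCons b (j.removeNth (Matrix.vecCons x w))) := by
      intro b j w hj
      cases k with
      | zero => exact absurd (Fin.fin_one_eq_zero j) hj
      | succ m =>
        obtain ⟨j', rfl⟩ := Fin.exists_succ_eq.2 hj
        rw [hrem, hrem]
        have hu : ∀ y : L, (Matrix.vecCons b (Matrix.vecCons y (j'.removeNth w)) :
            Fin (m + 2) → L) = Function.update
              (Matrix.vecCons b (Matrix.vecCons 0 (j'.removeNth w))) 1 y := by
          intro y
          funext t
          refine Fin.cases ?_ (fun t => Fin.cases ?_ (fun t => ?_) t) t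
          · simp
          · simp
          · have h1 : t.succ.succ ≠ (1 : Fin (m + 2)) := by
              rw [← Fin.succ_zero_eq_one]
              exact fun h => Fin.succ_ne_zero t (Fin.succ_injective _ h)
            rw [Function.update_of_ne h1]
            simp
        rw [hu (f • x), θ.map_update_smul, ← hu x]
    have key : ∀ (y : L), koszulSum br nab θ (Matrix.vecCons y v) =
        nab y (θ v) + (∑ i : Fin (k + 1), (-1 : ℤ) ^ (i + 1 : ℕ) •
            nab (v i) (θ (Matrix.vecCons y (i.removeNth v))))
        - ((∑ j : Fin (k + 1), (-1 : ℤ) ^ (j : ℕ) •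
            θ (Matrix.vecCons (br y (v j)) (j.removeNth v))) +
          ∑ i : Fin k, ∑ j ≥ i.succ, (-1 : ℤ) ^ (i + 1 + j : ℕ) •
            θ (Matrix.vecCons (br (v i.castSucc) (v j))
            (j.removeNth (Matrix.vecCons y (i.castSucc.removeNth v))))) := by
      intro y
      have t1 : (∑ i : Fin (k + 1 + 1), (-1 : ℤ) ^ (i : ℕ) •
          nab ((Matrix.vecCons y v : Fin (k + 2) → L) i)
            (θ (i.removeNth (Matrix.vecCons y v : Fin (k + 2) → L)))) =
          nab y (θ v) + ∑ i : Fin (k + 1), (-1 : ℤ) ^ (i + 1 : ℕ) •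
            nab (v i) (θ (Matrix.vecCons y (i.removeNth v))) := by
        rw [Fin.sum_univ_succ, hrem0]
        simp only [hrem, Fin.val_zero, pow_zero, one_smul, Matrix.cons_val_zero,
          Matrix.cons_val_succ, Fin.val_succ]
      have t2 : bracketSum br θ (Matrix.vecCons y v) =
          (∑ j : Fin (k + 1), (-1 : ℤ) ^ (j : ℕ) •
            θ (Matrix.vecCons (br y (v j)) (j.removeNth v))) +
          ∑ i : Fin k, ∑ j ≥ i.succ, (-1 : ℤ) ^ (i + 1 + j : ℕ) •
            θ (Matrix.vecCons (br (v i.castSucc) (v j))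
            (j.removeNth (Matrix.vecCons y (i.castSucc.removeNth v)))) := by
        rw [bracketSum, Fin.sum_univ_succ]
        congr 1
        · have : Finset.Ici (0 : Fin (k + 1)) = Finset.univ := by ext; simp
          rw [this]
          simp only [Fin.castSucc_zero, hrem0, Fin.val_zero, zero_add, Matrix.cons_val_zero,
            Matrix.cons_val_succ]
        · refine Finset.sum_congr rfl fun i _ => Finset.sum_congr rfl fun j _ => ?_
          cases k with
          | zero => exact i.elim0
          | succ k =>
            rw [← Fin.succ_castSucc, hrem, Matrix.cons_val_succ, Matrix.cons_val_succ,
              Fin.val_succ]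
      rw [koszulSum, t1, t2]
    have e1 : ∀ i : Fin (k + 1), nab (v i) (θ (Matrix.vecCons (f • x) (i.removeNth v))) =
        f • nab (v i) (θ (Matrix.vecCons x (i.removeNth v))) +
          act (v i) f • θ (Matrix.vecCons x (i.removeNth v)) := fun i => by
      rw [θ.map_vecCons_smul, hr]
    have e2 : ∀ j : Fin (k + 1), θ (Matrix.vecCons (br (f • x) (v j)) (j.removeNth v)) =
        f • θ (Matrix.vecCons (br x (v j)) (j.removeNth v)) -
          act (v j) f • θ (Matrix.vecCons x (j.removeNth v)) := fun j => by
      rw [hbr', sub_eq_add_neg, θ.map_vecCons_add, θ.map_vecCons_smul, ← neg_smul,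
        θ.map_vecCons_smul, neg_smul, ← sub_eq_add_neg]
    have e3 : (∑ i : Fin k, ∑ j ≥ i.succ, (-1 : ℤ) ^ (i + 1 + j : ℕ) •
            θ (Matrix.vecCons (br (v i.castSucc) (v j))
            (j.removeNth (Matrix.vecCons (f • x) (i.castSucc.removeNth v))))) =
        f • ∑ i : Fin k, ∑ j ≥ i.succ, (-1 : ℤ) ^ (i + 1 + j : ℕ) •
            θ (Matrix.vecCons (br (v i.castSucc) (v j))
            (j.removeNth (Matrix.vecCons x (i.castSucc.removeNth v)))) := by
      simp only [Finset.smul_sum]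
      refine Finset.sum_congr rfl fun i _ => Finset.sum_congr rfl fun j hj => ?_
      rw [hθ _ _ _ (ne_of_gt (lt_of_lt_of_le (Fin.succ_pos i) (Finset.mem_Ici.1 hj))),
        smul_comm]
    rw [key, key, e3, hl]
    simp only [e1, e2, smul_add, smul_sub, Finset.sum_add_distrib, Finset.sum_sub_distrib,
      Finset.smul_sum, smul_comm f, pow_succ, mul_neg, mul_one, neg_smul, Finset.sum_neg_distrib,
      smul_neg]
    abel

/-- The Koszul formula as an alternating `A`-multilinear map. -/
def koszul (br : L →ₗ[ℝ] L →ₗ[ℝ] L) (nab : L →ₗ[ℝ] M →ₗ[ℝ] M) (act : L → A → A)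
    (hbr : ∀ x y, br x y = -br y x)
    (hbr' : ∀ (f : A) x y, br (f • x) y = f • br x y - act y f • x)
    (hl : ∀ (f : A) x m, nab (f • x) m = f • nab x m)
    (hr : ∀ (f : A) x m, nab x (f • m) = f • nab x m + act x f • m)
    {k : ℕ} (θ : L [⋀^Fin k]→ₗ[A] M) : L [⋀^Fin (k + 1)]→ₗ[A] M where
  toFun := koszulSum br nab θ
  map_update_add' ξ i x y := by
    rename_i dec
    obtain rfl : dec = instDecidableEqFin (k + 1) := Subsingleton.elim _ _
    obtain ⟨β, hβ⟩ := koszulSum_exists br hbr nab θ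
    rw [hβ, hβ, hβ, β.map_update_add]
  map_update_smul' ξ i f x := by
    rename_i dec
    obtain rfl : dec = instDecidableEqFin (k + 1) := Subsingleton.elim _ _
    obtain ⟨β, hβ⟩ := koszulSum_exists br hbr nab θ
    have h : ∀ y, koszulSum br nab θ (Function.update ξ i y) =
        (-1 : ℤ) ^ (i : ℕ) • koszulSum br nab θ (Matrix.vecCons y (i.removeNth ξ)) := by
      intro y
      rw [hβ, hβ, ← Fin.insertNth_removeNth, β.map_insertNth]
    rw [h, h, koszulSum_smul_zero br nab act hbr' hl hr θ, smul_comm]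
  map_eq_zero_of_eq' ξ i j h hij := by
    obtain ⟨β, hβ⟩ := koszulSum_exists br hbr nab θ
    rw [hβ]
    exact β.map_eq_zero_of_eq ξ h hij

end Koszul

section Sections
variable {n : ℕ} {𝕂 : Type} [RCLike 𝕂] {X : Type u} [TopologicalSpace X]
  [ChartedSpace (EuclideanSpace ℝ (Fin n)) X] (G : SheafOfModules.{u} (smoothRing n 𝕂 X))

/-- The underlying sheaf of abelian groups of a sheaf of modules. -/
def toAb : AbSheaf X := ⟨G.val.presheaf, G.isSheaf⟩

/-- The sections over `U` of a sheaf of modules over the smooth functions. -/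
def Sec (U : Opens X) : Type u := G.val.obj (op U)

instance (U : Opens X) : AddCommGroup (Sec G U) :=
  inferInstanceAs (AddCommGroup (G.val.obj (op U)))

instance (U : Opens X) : Module (Fn n 𝕂 U) (Sec G U) :=
  inferInstanceAs (Module ((smoothRing n 𝕂 X).obj.obj (op U)) (G.val.obj (op U)))

variable {U V W : Opens X}

/-- Restriction of sections. -/
def res (h : V ≤ U) : Sec G U →+ Sec G V :=
  (G.val.presheaf.map (homOfLE h).op).hom

theorem res_smul (h : V ≤ U) (f : Fn n 𝕂 U) (g : Sec G U) :
    res G h (f • g) = resFn h f • res G h g := G.val.map_smul (homOfLE h).op f g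

theorem res_self (h : U ≤ U) (g : Sec G U) : res G h g = g :=
  ConcreteCategory.congr_hom ((toAb G).obj.map_id (op U)) g

theorem res_res (h : V ≤ U) (h' : W ≤ V) (g : Sec G U) :
    res G h' (res G h g) = res G (h'.trans h) g :=
  (ConcreteCategory.congr_hom
    ((toAb G).obj.map_comp (homOfLE h).op (homOfLE h').op) g).symm

theorem sec_ext {s t : Sec G V} {ι : Type u} (W : ι → Opens X) (hW : ∀ i, W i ≤ V)
    (hc : V ≤ iSup W) (h : ∀ i, res G (hW i) s = res G (hW i) t) : s = t :=
  TopCat.Sheaf.eq_of_locally_eq' (X := TopCat.of X) (toAb G) W V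
    (fun i => homOfLE (hW i)) hc s t h

theorem sec_glue {ι : Type u} (W : ι → Opens X) (hW : ∀ i, W i ≤ V) (hc : V ≤ iSup W)
    (s : ∀ i, Sec G (W i))
    (hs : ∀ i j, res G (inf_le_left : W i ⊓ W j ≤ W i) (s i) =
      res G (inf_le_right : W i ⊓ W j ≤ W j) (s j)) :
    ∃ t : Sec G V, ∀ i, res G (hW i) t = s i :=
  let s' : ∀ i, ToType ((toAb G).obj.obj (op (W i))) := s
  have hs' : TopCat.Presheaf.IsCompatible (toAb G).obj W s' := hs
  (TopCat.Sheaf.existsUnique_gluing' (X := TopCat.of X) (toAb G) W V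
    (fun i => homOfLE (hW i)) hc s' hs').exists

instance (U : Opens X) : Module (Fn n ℝ U) (Sec G U) := Module.compHom _ (ofRealFn 𝕂 U)

instance (U : Opens X) : Module ℝ (Sec G U) := Module.compHom _ (algebraMap ℝ (Fn n 𝕂 U))

theorem realFn_smul (f : Fn n ℝ U) (g : Sec G U) : f • g = ofRealFn 𝕂 U f • g := rfl

theorem real_smul (c : ℝ) (g : Sec G U) : c • g = algebraMap ℝ (Fn n 𝕂 U) c • g := rfl

theorem ofRealFn_smul (c : ℝ) (f : Fn n ℝ U) :
    ofRealFn 𝕂 U (c • f) = algebraMap ℝ (Fn n 𝕂 U) c * ofRealFn 𝕂 U f :=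
  ContMDiffMap.ext fun x => RCLike.ofReal_mul c (f x)

instance (U : Opens X) : IsScalarTower ℝ (Fn n ℝ U) (Sec G U) where
  smul_assoc c f g := by
    rw [realFn_smul, realFn_smul, real_smul, ofRealFn_smul, mul_smul]

theorem resFn_ofReal (h : V ≤ U) (f : Fn n ℝ U) :
    resFn h (ofRealFn 𝕂 U f) = ofRealFn 𝕂 V (resFn h f) := rfl

theorem res_realFn_smul (h : V ≤ U) (f : Fn n ℝ U) (g : Sec G U) :
    res G h (f • g) = resFn h f • res G h g := by
  rw [realFn_smul, res_smul, resFn_ofReal, realFn_smul]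

end Sections

section Forms
variable {n : ℕ} {𝕂 : Type} [RCLike 𝕂] {X : Type u} [TopologicalSpace X]
  [ChartedSpace (EuclideanSpace ℝ (Fin n)) X] [IsManifold (𝓡 n) ∞ X]
  (G : SheafOfModules.{u} (smoothRing n 𝕂 X)) (k : ℕ)

/-- The sections over `U` of the sheaf `G ⊗ E(Λ^k T*)` of `G`-valued `k`-forms. The bundle `T` is
locally free of finite rank, so this is the sheaf of alternating `k`-linear maps over the real smooth
functions, from the sheaf of vector fields to `G`; a section over `U` is a family of such maps,
one for each open `V ⊆ U`, that commutes with restriction. -/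
def forms (U : Opens X) :
    AddSubgroup (∀ V : Set.Iic U, VF n V.1 [⋀^Fin k]→ₗ[Fn n ℝ V.1] Sec G V.1) where
  carrier := {θ | ∀ (V W : Set.Iic U) (h : W.1 ≤ V.1) (ξ : Fin k → VF n V.1),
    res G h (θ V ξ) = θ W (fun i => resVF h (ξ i))}
  add_mem' {θ η} hθ hη V W h ξ := by simp [hθ V W h, hη V W h]
  zero_mem' V W h ξ := by simp
  neg_mem' {θ} hθ V W h ξ := by simp [hθ V W h]

/-- The type of `G`-valued `k`-forms on `U`. -/
abbrev Form (U : Opens X) : Type u := forms G k U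

variable {G k} {U V W : Opens X}

/-- The value of a form on vector fields defined on a smaller open set. -/
def Form.eval (θ : Form G k U) (h : V ≤ U) : VF n V [⋀^Fin k]→ₗ[Fn n ℝ V] Sec G V := θ.1 ⟨V, h⟩

theorem Form.res_eval (θ : Form G k U) (h : V ≤ U) (h' : W ≤ V) (ξ : Fin k → VF n V) :
    res G h' (θ.eval h ξ) = θ.eval (h'.trans h) (fun i => resVF h' (ξ i)) :=
  θ.2 ⟨V, h⟩ ⟨W, h'.trans h⟩ h' ξ

theorem Form.ext {θ η : Form G k U}
    (h : ∀ (V : Opens X) (hV : V ≤ U) (ξ : Fin k → VF n V), θ.eval hV ξ = η.eval hV ξ) : θ = η :=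
  Subtype.ext (funext fun V => AlternatingMap.ext (h V.1 V.2))

/-- A form from its values. -/
def Form.mk (θ : ∀ V : Opens X, V ≤ U → VF n V [⋀^Fin k]→ₗ[Fn n ℝ V] Sec G V)
    (hθ : ∀ (V W : Opens X) (hV : V ≤ U) (hW : W ≤ U) (h : W ≤ V) (ξ : Fin k → VF n V),
      res G h (θ V hV ξ) = θ W hW (fun i => resVF h (ξ i))) : Form G k U :=
  ⟨fun V => θ V.1 V.2, fun V W h ξ => hθ V.1 W.1 V.2 W.2 h ξ⟩

variable (G k) in
/-- Restriction of forms. -/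
def resForm (h : V ≤ U) : Form G k U →+ Form G k V where
  toFun θ := ⟨fun W => θ.1 ⟨W.1, W.2.trans h⟩, fun W W' h' ξ =>
    θ.2 ⟨W.1, W.2.trans h⟩ ⟨W'.1, W'.2.trans h⟩ h' ξ⟩
  map_zero' := rfl
  map_add' _ _ := rfl

theorem resForm_eval (h : V ≤ U) (θ : Form G k U) (h' : W ≤ V) :
    (resForm G k h θ).eval h' = θ.eval (h'.trans h) := rfl

variable (G k)

theorem form_glue {ι : Type u} (U : ι → Opens X) (sf : ∀ i, Form G k (U i))
    (hsf : ∀ i j, resForm G k (inf_le_left : U i ⊓ U j ≤ U i) (sf i) =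
      resForm G k (inf_le_right : U i ⊓ U j ≤ U j) (sf j)) :
    ∃! τ : Form G k (iSup U), ∀ i, resForm G k (le_iSup U i) τ = sf i := by
  have compat : ∀ (i j : ι) (W : Opens X) (hi : W ≤ U i) (hj : W ≤ U j) (ξ : Fin k → VF n W),
      Form.eval (sf i) hi ξ = Form.eval (sf j) hj ξ := by
    intro i j W hi hj ξ
    have := congrArg (fun θ : Form G k (U i ⊓ U j) => θ.eval (le_inf hi hj) ξ) (hsf i j)
    exact this
  have cover : ∀ V : Opens X, V ≤ iSup U → V ≤ ⨆ i, V ⊓ U i := by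
    intro V hV
    rw [← inf_iSup_eq]
    exact le_inf le_rfl hV
  have glue : ∀ (V : Opens X) (hV : V ≤ iSup U) (ξ : Fin k → VF n V), ∃ t : Sec G V,
      ∀ i, res G (inf_le_left : V ⊓ U i ≤ V) t =
        Form.eval (sf i) (inf_le_right : V ⊓ U i ≤ U i)
          (fun a => resVF inf_le_left (ξ a)) := by
    intro V hV ξ
    refine sec_glue G (fun i => V ⊓ U i) (fun i => inf_le_left) (cover V hV) _ fun i j => ?_
    rw [Form.res_eval, Form.res_eval]
    exact compat i j _ _ _ _
  choose t ht using glue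
  have ext : ∀ (V : Opens X) (_ : V ≤ iSup U) (s s' : Sec G V),
      (∀ i, res G (inf_le_left : V ⊓ U i ≤ V) s = res G inf_le_left s') → s = s' :=
    fun V hV s s' h => sec_ext G (fun i => V ⊓ U i) (fun i => inf_le_left) (cover V hV) h
  let τ : Form G k (iSup U) := Form.mk
    (fun V hV =>
      { toFun := t V hV
        map_update_add' := fun {dec} ξ a x y => by
          obtain rfl : dec = instDecidableEqFin k := Subsingleton.elim _ _
          refine ext V hV _ _ fun i => ?_
          simp only [map_add, ht]
          have hu : ∀ z : VF n V, (fun b => resVF (inf_le_left : V ⊓ U i ≤ V)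
              (Function.update ξ a z b)) = Function.update
                (fun b => resVF (inf_le_left : V ⊓ U i ≤ V) (ξ b)) a (resVF inf_le_left z) := by
            intro z
            funext b
            exact Function.apply_update (fun _ => resVF (inf_le_left : V ⊓ U i ≤ V)) ξ a z b
          rw [hu, hu, hu, map_add, AlternatingMap.map_update_add]
        map_update_smul' := fun {dec} ξ a f x => by
          obtain rfl : dec = instDecidableEqFin k := Subsingleton.elim _ _
          refine ext V hV _ _ fun i => ?_
          simp only [res_realFn_smul, ht]
          have hu : ∀ z : VF n V, (fun b => resVF (inf_le_left : V ⊓ U i ≤ V)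
              (Function.update ξ a z b)) = Function.update
                (fun b => resVF (inf_le_left : V ⊓ U i ≤ V) (ξ b)) a (resVF inf_le_left z) := by
            intro z
            funext b
            exact Function.apply_update (fun _ => resVF (inf_le_left : V ⊓ U i ≤ V)) ξ a z b
          rw [hu, hu, resVF_smul, AlternatingMap.map_update_smul]
        map_eq_zero_of_eq' := fun ξ a b h hab => by
          refine ext V hV _ _ fun i => ?_
          rw [ht, map_zero]
          exact AlternatingMap.map_eq_zero_of_eq _ _ (by rw [h]) hab })
    (fun V W hV hW h ξ => by
      refine ext W hW _ _ fun i => ?_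
      change _ = res G _ (t W hW _)
      rw [ht]
      have e := congrArg (res G (inf_le_inf_right (U i) h : W ⊓ U i ≤ V ⊓ U i)) (ht V hV ξ i)
      rw [res_res, Form.res_eval] at e
      rw [res_res]
      exact e)
  refine ⟨τ, fun i => ?_, fun τ' hτ' => ?_⟩
  · refine Form.ext fun V hV ξ => ?_
    have hV' : V ≤ iSup U := hV.trans (le_iSup U i)
    refine ext V hV' _ _ fun j => ?_
    refine (ht V hV' ξ j).trans ?_
    rw [Form.res_eval]
    exact compat j i _ _ _ _
  · refine Form.ext fun V hV ξ => ?_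
    refine ext V hV _ _ fun i => ?_
    refine Eq.trans ?_ (ht V hV ξ i).symm
    have e := congrArg (fun θ : Form G k (U i) => θ.eval (inf_le_right : V ⊓ U i ≤ U i)
      (fun a => resVF inf_le_left (ξ a))) (hτ' i)
    rw [← e]
    exact Form.res_eval (U := iSup U) τ' hV inf_le_left ξ

/-- The presheaf of `G`-valued `k`-forms. -/
def formPresheaf : TopCat.Presheaf AddCommGrpCat.{u} (TopCat.of X) where
  obj U := AddCommGrpCat.of (Form G k (X := X) U.unop)
  map h := AddCommGrpCat.ofHom (resForm G k (leOfHom h.unop))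
  map_id _ := rfl
  map_comp _ _ := rfl

theorem formPresheaf_isSheaf : (formPresheaf G k).IsSheaf := by
  rw [TopCat.Presheaf.isSheaf_iff_isSheafUniqueGluing]
  intro ι U sf hsf
  exact form_glue (X := X) G k U sf hsf

/-- The sheaf `G ⊗ E(Λ^k T*)` of `G`-valued `k`-forms. -/
def formSheaf : AbSheaf X :=
  ⟨formPresheaf G k, formPresheaf_isSheaf G k⟩

end Forms

section Connections
variable {n : ℕ} {𝕂 : Type} [RCLike 𝕂] {X : Type u} [TopologicalSpace X]
  [ChartedSpace (EuclideanSpace ℝ (Fin n)) X] [IsManifold (𝓡 n) ∞ X]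
  {G : SheafOfModules.{u} (smoothRing n 𝕂 X)}

/-- The value of a 1-form on a vector field. -/
def evalOne {U : Opens X} (θ : Form G 1 U) (ξ : VF n U) : Sec G U :=
  θ.eval le_rfl (fun _ => ξ)

variable (G) in
/-- A connection on `G`: a morphism of sheaves of abelian groups `D : G ⟶ G ⊗ E(T*)` such that
`D(f g) = f Dg + g ⊗ df`. -/
structure Connection where
  D : toAb G ⟶ formSheaf G 1
  leibniz : ∀ (U : Opens X) (f : Fn n 𝕂 U) (g : Sec G U) (ξ : VF n U),
    evalOne ((D.hom.app (op U)).hom (f • g)) ξ =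
      f • evalOne ((D.hom.app (op U)).hom g) ξ + ξ.deriv f • g

namespace Connection
variable (D : Connection G) {U V : Opens X}

/-- `D` on sections over `U`. -/
def diff (U : Opens X) : Sec G U →+ Form G 1 U := (D.D.hom.app (op U)).hom

theorem diff_res (h : V ≤ U) (g : Sec G U) :
    D.diff V (res G h g) = resForm G 1 h (D.diff U g) :=
  ConcreteCategory.congr_hom (D.D.hom.naturality (homOfLE h).op) g

/-- The covariant derivative `∇_ξ g = (Dg)(ξ)`. -/
def nabla (ξ : VF n U) (g : Sec G U) : Sec G U := evalOne (D.diff U g) ξ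

theorem nabla_smul (f : Fn n 𝕂 U) (g : Sec G U) (ξ : VF n U) :
    D.nabla ξ (f • g) = f • D.nabla ξ g + ξ.deriv f • g := D.leibniz U f g ξ

theorem nabla_add (ξ : VF n U) (g g' : Sec G U) :
    D.nabla ξ (g + g') = D.nabla ξ g + D.nabla ξ g' := by
  simp only [nabla, map_add]
  rfl

theorem nabla_realFn_smul (f : Fn n ℝ U) (ξ : VF n U) (g : Sec G U) :
    D.nabla ξ (f • g) = f • D.nabla ξ g + ξ.deriv f • g := by
  rw [realFn_smul, nabla_smul, VF.deriv_ofReal]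
  rfl

theorem nabla_real_smul (c : ℝ) (ξ : VF n U) (g : Sec G U) :
    D.nabla ξ (c • g) = c • D.nabla ξ g := by
  rw [real_smul, nabla_smul, VF.deriv_const, zero_smul, add_zero]
  rfl

theorem evalOne_add (θ : Form G 1 U) (ξ η : VF n U) :
    evalOne θ (ξ + η) = evalOne θ ξ + evalOne θ η := by
  have h : ∀ ζ : VF n U, (fun _ : Fin 1 => ζ) = Function.update (fun _ => ξ) 0 ζ := by
    intro ζ; funext i; rw [Subsingleton.elim i 0, Function.update_self]
  simp only [evalOne]
  rw [h (ξ + η), AlternatingMap.map_update_add, ← h, ← h]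

theorem evalOne_smul (θ : Form G 1 U) (f : Fn n ℝ U) (ξ : VF n U) :
    evalOne θ (f • ξ) = f • evalOne θ ξ := by
  have h : ∀ ζ : VF n U, (fun _ : Fin 1 => ζ) = Function.update (fun _ => ξ) 0 ζ := by
    intro ζ; funext i; rw [Subsingleton.elim i 0, Function.update_self]
  simp only [evalOne]
  rw [h (f • ξ), AlternatingMap.map_update_smul, ← h]

/-- The covariant derivative as an `ℝ`-bilinear map. -/
def nablaLM (U : Opens X) : VF n U →ₗ[ℝ] Sec G U →ₗ[ℝ] Sec G U :=
  LinearMap.mk₂ ℝ D.nabla (fun ξ η g => evalOne_add _ ξ η)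
    (fun c ξ g => by
      rw [← algebraMap_smul (Fn n ℝ U) c ξ, nabla, evalOne_smul, algebraMap_smul]
      rfl)
    D.nabla_add D.nabla_real_smul

theorem res_nabla (h : V ≤ U) (ξ : VF n U) (g : Sec G U) :
    res G h (D.nabla ξ g) = D.nabla (resVF h ξ) (res G h g) := by
  rw [nabla, nabla, diff_res, evalOne, Form.res_eval]
  rfl

/-- The Koszul formula for the covariant derivative on the open set `U`. -/
def koszulAt (U : Opens X) {k : ℕ} (θ : VF n U [⋀^Fin k]→ₗ[Fn n ℝ U] Sec G U) :
    VF n U [⋀^Fin (k + 1)]→ₗ[Fn n ℝ U] Sec G U :=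
  koszul (bracketLM U) (D.nablaLM U) VF.deriv VF.bracket_skew VF.smul_bracket
    (fun f ξ g => evalOne_smul (D.diff U g) f ξ) D.nabla_realFn_smul θ

theorem res_koszulAt (h : V ≤ U) {k : ℕ} (θ : VF n U [⋀^Fin k]→ₗ[Fn n ℝ U] Sec G U)
    (η : VF n V [⋀^Fin k]→ₗ[Fn n ℝ V] Sec G V)
    (hη : ∀ ξ, res G h (θ ξ) = η (fun i => resVF h (ξ i))) (ξ : Fin (k + 1) → VF n U) :
    res G h (D.koszulAt U θ ξ) = D.koszulAt V η (fun i => resVF h (ξ i)) := by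
  change res G h (koszulSum _ _ θ ξ) = koszulSum _ _ η _
  rw [koszulSum, koszulSum, map_sub, map_sum]
  congr 1
  · refine Finset.sum_congr rfl fun i _ => ?_
    rw [map_zsmul]
    congr 1
    refine (D.res_nabla h _ _).trans ?_
    rw [hη]
    rfl
  · cases k with
    | zero => exact map_zero _
    | succ k =>
      rw [bracketSum, bracketSum, map_sum]
      refine Finset.sum_congr rfl fun i _ => ?_
      rw [map_sum]
      refine Finset.sum_congr rfl fun j _ => ?_
      rw [map_zsmul, hη]
      congr 2
      funext t
      refine Fin.cases ?_ (fun t => ?_) t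
      · exact resVF_bracket h _ _
      · rfl

/-- The extension of the connection to `G`-valued `k`-forms over `U`. -/
def dForm (k : ℕ) (U : Opens X) : Form G k U →+ Form G (k + 1) U where
  toFun θ := Form.mk (fun V hV => D.koszulAt V (θ.eval hV))
    (fun _ _ _ _ h ξ => D.res_koszulAt h _ _ (Form.res_eval θ _ h) ξ)
  map_zero' := Form.ext fun V hV ξ => by
    change koszulSum _ _ 0 ξ = 0
    rw [koszulSum]
    cases k with
    | zero => simp [bracketSum]
    | succ k => simp [bracketSum]
  map_add' θ η := Form.ext fun V hV ξ => by
    change koszulSum _ _ (θ.eval hV + η.eval hV) ξ =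
      koszulSum _ _ (θ.eval hV) ξ + koszulSum _ _ (η.eval hV) ξ
    simp only [koszulSum]
    cases k with
    | zero => simp [bracketSum, Finset.sum_add_distrib]
    | succ k => simp [bracketSum, Finset.sum_add_distrib, smul_add]; abel

theorem dForm_res (k : ℕ) (h : V ≤ U) (θ : Form G k U) :
    D.dForm k V (resForm G k h θ) = resForm G (k + 1) h (D.dForm k U θ) := rfl

/-- The extension `D : G ⊗ E(Λ^k T*) ⟶ G ⊗ E(Λ^(k+1) T*)` of the connection, by the Koszul formula. -/
def d (k : ℕ) : formSheaf G k ⟶ formSheaf G (k + 1) where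
  hom :=
    { app U := AddCommGrpCat.ofHom (D.dForm k (X := X) U.unop)
      naturality _ _ _ := rfl }

/-- The connection is flat: `D² = 0`. -/
def IsFlat : Prop := D.D ≫ D.d 1 = 0

/-- The sheaf `Ker D` of parallel sections. -/
def parallel : AbSheaf X := Limits.kernel D.D

end Connection
end Connections

section FormZero
variable {n : ℕ} {𝕂 : Type} [RCLike 𝕂] {X : Type u} [TopologicalSpace X]
  [ChartedSpace (EuclideanSpace ℝ (Fin n)) X] [IsManifold (𝓡 n) ∞ X]
  (G : SheafOfModules.{u} (smoothRing n 𝕂 X))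

/-- A `G`-valued 0-form is a section of `G`. -/
def zeroForm (U : Opens X) : Sec G U ≃+ Form G 0 U where
  toFun g := Form.mk
    (fun V h => AlternatingMap.constOfIsEmpty (Fn n ℝ V) (VF n V) (Fin 0) (res G h g))
    (fun _ _ hV _ h _ => res_res G hV h g)
  invFun θ := θ.eval le_rfl (fun i => i.elim0)
  left_inv g := res_self G le_rfl g
  right_inv θ := Form.ext fun V hV ξ => by
    refine (Form.res_eval θ le_rfl hV _).trans ?_
    congr 1
    exact funext fun i => i.elim0
  map_add' g g' := Form.ext fun V hV ξ => map_add (res G hV) g g'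

/-- The canonical isomorphism between `G` and the sheaf of `G`-valued 0-forms. -/
def zeroFormIso : toAb G ≅ formSheaf G 0 :=
  (fullyFaithfulSheafToPresheaf _ _).preimageIso
    (NatIso.ofComponents (F := (toAb G).obj) (G := (formSheaf G 0).obj)
      (fun U => (zeroForm G (X := X) U.unop).toAddCommGrpIso)
      (fun {U V} h => by
        ext g
        refine Form.ext (X := X) fun W hW ξ => ?_
        exact res_res G (leOfHom h.unop) hW g))

end FormZero
section Morphisms
variable {n : ℕ} {𝕂 : Type} [RCLike 𝕂] {X : Type u} [TopologicalSpace X]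
  [ChartedSpace (EuclideanSpace ℝ (Fin n)) X]
  {G G' : SheafOfModules.{u} (smoothRing n 𝕂 X)}

/-- A morphism of sheaves of modules, on sections over `U`. -/
def secMap (f : G ⟶ G') (U : Opens X) : Sec G U →ₗ[Fn n 𝕂 U] Sec G' U :=
  (f.val.app (op U)).hom

theorem res_secMap (f : G ⟶ G') {U V : Opens X} (h : V ≤ U) (g : Sec G U) :
    res G' h (secMap f U g) = secMap f V (res G h g) :=
  (PresheafOfModules.naturality_apply f.val (homOfLE h).op g).symm

/-- The same map, linear over the real smooth functions. -/
def secMapReal (f : G ⟶ G') (U : Opens X) : Sec G U →ₗ[Fn n ℝ U] Sec G' U where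
  toFun := secMap f U
  map_add' := map_add _
  map_smul' a g := (secMap f U).map_smul (ofRealFn 𝕂 U a) g

/-- The underlying morphism of sheaves of abelian groups. -/
def toAbMap (f : G ⟶ G') : toAb G ⟶ toAb G' where
  hom :=
    { app U := AddCommGrpCat.ofHom (secMap f U.unop).toAddMonoidHom
      naturality U V h := by
        ext g
        exact (res_secMap f (leOfHom h.unop) g).symm }

variable [IsManifold (𝓡 n) ∞ X]

/-- The action of a morphism of sheaves of modules on forms over `U`. -/
def mapForm (f : G ⟶ G') (k : ℕ) (U : Opens X) : Form G k U →+ Form G' k U where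
  toFun θ := Form.mk (fun V hV => (secMapReal f V).compAlternatingMap (θ.eval hV))
    (fun V W hV hW h ξ => (res_secMap f h _).trans
      (congrArg (secMap f W) (Form.res_eval θ hV h ξ)))
  map_zero' := Form.ext fun V _ _ => map_zero (secMap f V)
  map_add' _ _ := Form.ext fun V _ _ => map_add (secMap f V) _ _

/-- The morphism `f ⊗ id : G ⊗ E(Λ^k T*) ⟶ G' ⊗ E(Λ^k T*)`. -/
def formMap (f : G ⟶ G') (k : ℕ) : formSheaf G k ⟶ formSheaf G' k where
  hom :=
    { app U := AddCommGrpCat.ofHom (mapForm f k (X := X) U.unop)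
      naturality _ _ _ := rfl }

namespace Connection

/-- The morphism `f` commutes with the connections. -/
def IsHorizontal (D : Connection G) (D' : Connection G') (f : G ⟶ G') : Prop :=
  D.D ≫ formMap f 1 = toAbMap f ≫ D'.D

variable {D : Connection G} {D' : Connection G'} {f : G ⟶ G'}

theorem IsHorizontal.secMap_nabla (hf : D.IsHorizontal D' f) {U : Opens X} (ξ : VF n U)
    (g : Sec G U) : secMap f U (D.nabla ξ g) = D'.nabla ξ (secMap f U g) := by
  have h := congrArg (fun α : toAb G ⟶ formSheaf G' 1 =>
    evalOne (U := U) ((α.hom.app (op U)).hom g) ξ) hf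
  exact h

theorem IsHorizontal.mapForm_dForm (hf : D.IsHorizontal D' f) (k : ℕ) (U : Opens X)
    (θ : Form G k U) : mapForm f (k + 1) U (D.dForm k U θ) = D'.dForm k U (mapForm f k U θ) := by
  refine Form.ext fun V hV ξ => ?_
  change secMap f V (koszulSum _ _ (θ.eval hV) ξ) =
    koszulSum _ _ ((secMapReal f V).compAlternatingMap (θ.eval hV)) ξ
  rw [koszulSum, koszulSum, map_sub, map_sum]
  congr 1
  · refine Finset.sum_congr rfl fun i _ => ?_
    rw [map_zsmul]
    congr 1
    exact hf.secMap_nabla _ _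
  · cases k with
    | zero => exact map_zero _
    | succ k =>
      rw [bracketSum, bracketSum, map_sum]
      refine Finset.sum_congr rfl fun i _ => ?_
      rw [map_sum]
      refine Finset.sum_congr rfl fun j _ => ?_
      rw [map_zsmul]
      rfl

/-- The morphism `Ker D ⟶ Ker D'` induced by a horizontal morphism. -/
def IsHorizontal.parallelMap (hf : D.IsHorizontal D' f) : D.parallel ⟶ D'.parallel :=
  Limits.kernel.map D.D D'.D (toAbMap f) (formMap f 1) hf

variable (D) in
/-- The image of `D` in the global `G`-valued `k`-forms. -/
def coboundaries : ∀ k : ℕ, AddSubgroup (Form G k (⊤ : Opens X))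
  | 0 => ⊥
  | k + 1 => (D.dForm k ⊤).range

variable (D) in
/-- The cohomology `H^k(Γ(X, G ⊗ E(Λ^• T*)), D)`. -/
def Cohomology (k : ℕ) : Type u :=
  (D.dForm k ⊤).ker ⧸ (D.coboundaries k).addSubgroupOf (D.dForm k ⊤).ker

instance (k : ℕ) : AddCommGroup (D.Cohomology k) :=
  inferInstanceAs (AddCommGroup ((D.dForm k ⊤).ker ⧸ _))

theorem IsHorizontal.mapForm_mem_ker (hf : D.IsHorizontal D' f) (k : ℕ)
    (θ : (D.dForm k ⊤).ker) : mapForm f k ⊤ θ.1 ∈ (D'.dForm k ⊤).ker := by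
  have := θ.2
  rw [AddMonoidHom.mem_ker] at this ⊢
  rw [← hf.mapForm_dForm, this, map_zero]

theorem IsHorizontal.mapForm_mem_coboundaries (hf : D.IsHorizontal D' f) (k : ℕ)
    {θ : Form G k (⊤ : Opens X)} (h : θ ∈ D.coboundaries k) :
    mapForm f k ⊤ θ ∈ D'.coboundaries k := by
  cases k with
  | zero =>
    obtain rfl : θ = 0 := h
    exact map_zero _
  | succ k =>
    obtain ⟨η, rfl⟩ := h
    exact ⟨mapForm f k ⊤ η, (hf.mapForm_dForm k ⊤ η).symm⟩

/-- The map on cohomology induced by a horizontal morphism. -/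
def IsHorizontal.cohomologyMap (hf : D.IsHorizontal D' f) (k : ℕ) :
    D.Cohomology k →+ D'.Cohomology k :=
  QuotientAddGroup.map _ _
    (((mapForm f k ⊤).comp (D.dForm k ⊤).ker.subtype).codRestrict _ (hf.mapForm_mem_ker k))
    (fun _ h => hf.mapForm_mem_coboundaries k h)

end Connection
end Morphisms

section Local
variable {n : ℕ} {𝕂 : Type} [RCLike 𝕂] {X : Type u} [TopologicalSpace X]
  [ChartedSpace (EuclideanSpace ℝ (Fin n)) X] (G : SheafOfModules.{u} (smoothRing n 𝕂 X))

variable {G} in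
/-- The linear combination `∑ i, a_i e_i`, over a smaller open set. -/
def comb {U V : Opens X} (h : V ≤ U) {r : ℕ} (e : Fin r → Sec G U) (a : Fin r → Fn n 𝕂 V) :
    Sec G V := ∑ i, a i • res G h (e i)

/-- Restriction of a vector of functions. -/
def resVec {U V : Opens X} (h : V ≤ U) {r : ℕ} (a : Fin r → Fn n 𝕂 U) : Fin r → Fn n 𝕂 V :=
  fun i => resFn h (a i)

/-- The product of a matrix of functions with a vector of functions on a smaller open set. -/
def actOn {U V : Opens X} (h : V ≤ U) {r q : ℕ} (A : Matrix (Fin r) (Fin q) (Fn n 𝕂 U))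
    (b : Fin q → Fn n 𝕂 V) : Fin r → Fn n 𝕂 V := fun i => ∑ j, resFn h (A i j) * b j

/-- A resolution `0 → E^(p_m) → ⋯ → E^(p_1) → E^(p_0) → G|_U → 0` of finite length by free modules
of finite rank over `U`. Its maps are given by matrices of smooth functions, the augmentation by
`p_0` sections of `G`, and exactness is that of a sequence of sheaves: a section of a kernel is,
near each point, in the image. -/
structure FreeResolution (U : Opens X) where
  length : ℕ
  rank : ℕ → ℕ
  rank_eq_zero : ∀ s, length < s → rank s = 0
  aug : Fin (rank 0) → Sec G U
  map : ∀ s, Matrix (Fin (rank s)) (Fin (rank (s + 1))) (Fn n 𝕂 U)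
  aug_surjective : ∀ (V : Opens X) (hV : V ≤ U) (g : Sec G V), ∀ x ∈ V,
    ∃ (W : Opens X) (hW : W ≤ V) (a : Fin (rank 0) → Fn n 𝕂 W), x ∈ W ∧
      comb (hW.trans hV) aug a = res G hW g
  exact_aug : ∀ (V : Opens X) (hV : V ≤ U) (a : Fin (rank 0) → Fn n 𝕂 V),
    comb hV aug a = 0 ↔ ∀ x ∈ V, ∃ (W : Opens X) (hW : W ≤ V) (b : Fin (rank 1) → Fn n 𝕂 W),
      x ∈ W ∧ actOn (hW.trans hV) (map 0) b = resVec hW a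
  exact_map : ∀ (s : ℕ) (V : Opens X) (hV : V ≤ U) (a : Fin (rank (s + 1)) → Fn n 𝕂 V),
    actOn hV (map s) a = 0 ↔
      ∀ x ∈ V, ∃ (W : Opens X) (hW : W ≤ V) (b : Fin (rank (s + 2)) → Fn n 𝕂 W),
        x ∈ W ∧ actOn (hW.trans hV) (map (s + 1)) b = resVec hW a

/-- The sheaf `G` has, near each point, a finite resolution by free modules of finite rank. -/
def HasLocalFreeResolutions : Prop :=
  ∀ x : X, ∃ U : Opens X, x ∈ U ∧ Nonempty (FreeResolution G U)

variable {G} in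
/-- The sections `e_1, …, e_r` are a basis of `G|_U`. -/
def IsFrame {U : Opens X} {r : ℕ} (e : Fin r → Sec G U) : Prop :=
  ∀ (V : Opens X) (hV : V ≤ U) (g : Sec G V), ∃! a : Fin r → Fn n 𝕂 V, comb hV e a = g

/-- The sheaf `G` is locally free of finite rank. -/
def IsLocallyFree : Prop :=
  ∀ x : X, ∃ (U : Opens X) (r : ℕ) (e : Fin r → Sec G U), x ∈ U ∧ IsFrame e

variable [IsManifold (𝓡 n) ∞ X]
variable {G}
/-- The sheaves `G ⊗ E(Λ^k T*)` are acyclic. -/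
def FormsAcyclic (G : SheafOfModules.{u} (smoothRing n 𝕂 X)) : Prop :=
  ∀ k i : ℕ, Subsingleton (Sheaf.H.{u} (formSheaf G k) (i + 1))

namespace Connection
variable (D : Connection G)

/-- The sheaf `Ker D` generates `G` over the smooth functions. -/
def ParallelGenerates : Prop :=
  ∀ (U : Opens X) (g : Sec G U), ∀ x ∈ U, ∃ (V : Opens X) (hV : V ≤ U) (r : ℕ)
    (s : Fin r → Sec G V) (a : Fin r → Fn n 𝕂 V),
    x ∈ V ∧ (∀ i, D.diff V (s i) = 0) ∧ comb le_rfl s a = res G hV g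

/-- `(G, D)` is the sheaf of smooth sections of a local system: near each point `G` has a finite
basis such that a combination `∑ i, a_i e_i` is parallel exactly if the functions `a_i` are locally
constant. So `Ker D` is locally isomorphic to a constant sheaf `𝕂^r` and `G = Ker D ⊗_𝕂 E(𝕂)`. -/
def IsLocalSystem : Prop :=
  ∀ x : X, ∃ (U : Opens X) (r : ℕ) (e : Fin r → Sec G U), x ∈ U ∧ IsFrame e ∧
    ∀ (V : Opens X) (hV : V ≤ U) (a : Fin r → Fn n 𝕂 V),
      D.diff V (comb hV e a) = 0 ↔ ∀ i, IsLocallyConstant (a i)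

/-- The sequence of sheaves `0 → Ker D → G ⊗ E(Λ^0 T*) → G ⊗ E(Λ^1 T*) → ⋯` is an exact complex. -/
def IsResolution : Prop :=
  (∃ w : (Limits.kernel.ι D.D ≫ (zeroFormIso G).hom) ≫ D.d 0 = 0,
    Mono (Limits.kernel.ι D.D ≫ (zeroFormIso G).hom) ∧ (ShortComplex.mk _ _ w).Exact) ∧
  ∀ k : ℕ, ∃ w : D.d k ≫ D.d (k + 1) = 0, (ShortComplex.mk _ _ w).Exact

end Connection
end Local

end SmoothConn
end

open SmoothConn

/-!
The sheaf `G` is locally free already because it is finitely presented and carries a connection `D`.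
Let `e_i` generate `G` near a point, and let the rows of the matrix `A` generate the relations.
Covariant differentiation turns relations into relations, so `dA = b A - A c` with smooth matrices
`b` and `c`. If `A` vanishes at the point, it therefore vanishes on the rays through that point, by
uniqueness for linear differential equations, and the `e_i` form a frame. Otherwise a coefficient of
`A` is a unit near the point, and one generator can be eliminated
(`IsPresentation.exists_frame`, `Connection.isLocallyFree`).

If `D` is flat, its matrix in a frame satisfies the integrability condition of the linear system
`dS = -Γ S`, which is solved by transport along rays (`exists_parallel_of_flat`): the transport is
the solution of a Volterra equation in the Banach algebra of continuous functions on `[0, 1]`, and it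
depends smoothly on the end point because inversion in a Banach algebra is smooth. The result is a
frame of parallel sections (`IsFlat.exists_parallel_frame`). A combination `∑ i, a_i e_i` of such a
frame is parallel if and only if `d a_i = 0`, which is the statement on local systems.

In a parallel frame and a chart, a `G`-valued form is a vector of differential forms on an open set
of `ℝ^n`, and `D` is the exterior derivative (`Represents.dForm`). So `D ∘ D = 0` in all degrees, and
the complex of forms is locally exact by the Poincaré lemma (`exists_extDeriv_eq`).

The sheaves of forms are soft, since forms can be cut off by smooth functions. If `F` is soft on a
second countable regular space and `0 → F → I → Q → 0` is exact with `I` injective, then sections of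
`Q` lift to `I` over every open set: local lifts near countably many closed sets are patched one
after the other (`IsSoft.surjective`). Injective sheaves are flasque, hence so is `Q`, and flasque
sheaves are acyclic by dimension shifting; so `F` is acyclic (`IsSoft.subsingleton_H`).

The de Rham–Weil isomorphism is built from the short exact sequences
`0 → Ker d_k → F_k → Ker d_(k+1) → 0` of the resolution. The product of their extension classes is a
class in `Ext^k(Ker d_k, Ker D)` (`resClass`), and composition with it maps closed global forms onto
`H^k(X, Ker D)` with the exact forms as kernel. Since extension classes are natural, so is the
isomorphism (`IsHorizontal.map_cohomologyEquiv`).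
-/

/-! ### Smooth dependence on parameters -/

section Curry
variable {E F : Type} [NormedAddCommGroup E] [NormedSpace ℝ E]
  [NormedAddCommGroup F] [NormedSpace ℝ F]

namespace SmoothConn

/-- The unit interval, the parameter space of the rays. -/
abbrev UI : Type := Set.Icc (0 : ℝ) 1

/-- A continuous function of two variables as a family of continuous functions on `[0, 1]`. -/
def curryUI (f : E × ℝ → F) (hf : Continuous f) (x : E) : C(UI, F) :=
  ⟨fun t => f (x, t), by fun_prop⟩

@[simp] theorem curryUI_apply (f : E × ℝ → F) (hf : Continuous f) (x : E) (t : UI) :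
    curryUI f hf x t = f (x, t) := rfl

theorem continuous_curryUI (f : E × ℝ → F) (hf : Continuous f) : Continuous (curryUI f hf) :=
  ContinuousMap.continuous_of_continuous_uncurry _ (by
    change Continuous fun p : E × UI => f (p.1, p.2)
    fun_prop)

variable {W : Type} [NormedAddCommGroup W] [NormedSpace ℝ W]

/-- A family of linear maps, seen as a linear map into families. The linear maps are given through
a bilinear map `b`, so that the topology of their space is the one of the norm. -/
noncomputable def flipUIAt (b : W →L[ℝ] E →L[ℝ] F) (φ : C(UI, W)) : E →L[ℝ] C(UI, F) :=
  LinearMap.mkContinuous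
    { toFun := fun v => (⟨fun t => b (φ t) v, by fun_prop⟩ : C(UI, F))
      map_add' := fun v w => by ext t; simp
      map_smul' := fun c v => by ext t; simp } (‖b‖ * ‖φ‖) (fun v => by
    rw [ContinuousMap.norm_le _ (by positivity)]
    intro t
    refine (b.le_opNorm₂ (φ t) v).trans ?_
    gcongr
    exact φ.norm_coe_le_norm t)

@[simp] theorem flipUIAt_apply (b : W →L[ℝ] E →L[ℝ] F) (φ : C(UI, W)) (v : E) (t : UI) :
    flipUIAt b φ v t = b (φ t) v := rfl

theorem isBoundedLinearMap_flipUIAt (b : W →L[ℝ] E →L[ℝ] F) :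
    IsBoundedLinearMap ℝ (flipUIAt b) := by
  refine ⟨⟨fun φ ψ => by ext v t; simp, fun c φ => by ext v t; simp⟩, ‖b‖ + 1, by positivity,
    fun φ => ?_⟩
  refine (ContinuousLinearMap.opNorm_le_bound (flipUIAt b φ) (M := ‖b‖ * ‖φ‖)
    (by positivity) fun v => ?_).trans (by nlinarith [norm_nonneg φ])
  rw [ContinuousMap.norm_le _ (by positivity)]
  intro t
  refine (b.le_opNorm₂ (φ t) v).trans ?_
  gcongr
  exact φ.norm_coe_le_norm t

theorem contDiff_flipUIAt (b : W →L[ℝ] E →L[ℝ] F) {m : WithTop ℕ∞} : ContDiff ℝ m (flipUIAt b) :=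
  (isBoundedLinearMap_flipUIAt b).contDiff

/-- The derivative of a function of two variables in the first variable. -/
noncomputable def fderivFst (f : E × ℝ → F) (p : E × ℝ) : E →L[ℝ] F :=
  (fderiv ℝ f p).comp (ContinuousLinearMap.inl ℝ E ℝ)

theorem contDiff_fderivFst {f : E × ℝ → F} (hf : ContDiff ℝ ∞ f) : ContDiff ℝ ∞ (fderivFst f) :=
  (hf.fderiv_right (m := ∞) (by simp)).clm_comp contDiff_const

theorem hasFDerivAt_fst {f : E × ℝ → F} (hf : ContDiff ℝ ∞ f) (x : E) (t : ℝ) :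
    HasFDerivAt (fun y => f (y, t)) (fderivFst f (x, t)) x :=
  ((hf.differentiable (by simp) (x, t)).hasFDerivAt).comp x (hasFDerivAt_prodMk_left x t)

theorem hasFDerivAt_curryUI {f : E × ℝ → F} (hf : ContDiff ℝ ∞ f) (x : E) :
    HasFDerivAt (curryUI f hf.continuous)
      (flipUIAt (.id ℝ (E →L[ℝ] F)) (curryUI (fderivFst f) (contDiff_fderivFst hf).continuous x)) x := by
  rw [hasFDerivAt_iff_isLittleO_nhds_zero, Asymptotics.isLittleO_iff]
  intro c hc
  have hcont := (continuous_curryUI (fderivFst f) (contDiff_fderivFst hf).continuous).continuousAt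
    (x := x)
  obtain ⟨δ, hδ, hball⟩ := Metric.continuousAt_iff.1 hcont c hc
  filter_upwards [Metric.ball_mem_nhds (0 : E) hδ] with h hh
  rw [ContinuousMap.norm_le _ (by positivity)]
  intro t
  have := (convex_ball x δ).norm_image_sub_le_of_norm_hasFDerivWithin_le'
    (f := fun y => f (y, (t : ℝ))) (f' := fun y => fderivFst f (y, t))
    (φ := fderivFst f (x, t)) (C := c) (x := x) (y := x + h)
    (fun y _ => (hasFDerivAt_fst hf y t).hasFDerivWithinAt)
    (fun y hy => by
      have h1 := hball hy
      rw [dist_eq_norm] at h1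
      refine le_trans ?_ h1.le
      exact (curryUI (fderivFst f) (contDiff_fderivFst hf).continuous y -
        curryUI (fderivFst f) (contDiff_fderivFst hf).continuous x).norm_coe_le_norm t)
    (Metric.mem_ball_self hδ) (by simpa using hh)
  simpa using this

theorem contDiff_curryUI_nat (m : ℕ) : ∀ {F : Type} [NormedAddCommGroup F] [NormedSpace ℝ F]
    {f : E × ℝ → F} (hf : ContDiff ℝ ∞ f), ContDiff ℝ m (curryUI f hf.continuous) := by
  induction m with
  | zero =>
    intro F _ _ f hf
    exact contDiff_zero.2 (continuous_curryUI f hf.continuous)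
  | succ m ih =>
    intro F _ _ f hf
    have := ih (contDiff_fderivFst hf)
    refine (contDiff_succ_iff_hasFDerivAt (n := m)).2 ⟨_, ?_, hasFDerivAt_curryUI hf⟩
    exact (contDiff_flipUIAt (.id ℝ (E →L[ℝ] F))).comp this

/-- A smooth function on `E × [0, 1]` is a smooth function on `E` with values in the Banach space
of continuous functions on `[0, 1]`. -/
theorem contDiff_curryUI {f : E × ℝ → F} (hf : ContDiff ℝ ∞ f) :
    ContDiff ℝ ∞ (curryUI f hf.continuous) :=
  contDiff_infty.2 fun m => contDiff_curryUI_nat m hf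

end SmoothConn
end Curry

/-! ### Flat matrix-valued connection forms are trivial -/

section Frobenius
variable {E F : Type} [NormedAddCommGroup E] [NormedSpace ℝ E]
  [NormedAddCommGroup F] [NormedSpace ℝ F]

namespace SmoothConn

/-- The Volterra equation `φ + V (m φ) = b` has a solution that depends smoothly on the parameter
of `m`, near a point where `m` vanishes. -/
theorem exists_smooth_solution {R : Type} [NormedRing R] [NormedAlgebra ℝ R] [CompleteSpace R]
    (V : R →L[ℝ] R) {m : E → R} (hm : ContDiff ℝ ∞ m) (h0 : m 0 = 0) (b : R) :
    ∃ (N : Set E) (φ : E → R), IsOpen N ∧ (0 : E) ∈ N ∧ ContDiffOn ℝ ∞ φ N ∧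
      ∀ y ∈ N, φ y + V (m y * φ y) = b := by
  let T : E → (R →L[ℝ] R) := fun y => 1 + V.comp (ContinuousLinearMap.mul ℝ R (m y))
  have hT : ContDiff ℝ ∞ T :=
    contDiff_const.add (contDiff_const.clm_comp ((ContinuousLinearMap.mul ℝ R).contDiff.comp hm))
  -- `T 0 = 1` is invertible, and inversion in a Banach algebra is smooth on the open set of units
  refine ⟨{y | IsUnit (T y)}, fun y => Ring.inverse (T y) b,
    Units.isOpen.preimage hT.continuous, ?_, ?_, ?_⟩
  · simp [T, h0]
  · rintro y ⟨w, hw⟩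
    have h1 := contDiffAt_ringInverse ℝ (n := ∞) w
    rw [hw] at h1
    exact ((h1.comp y hT.contDiffAt).clm_apply contDiffAt_const).contDiffWithinAt
  · intro y hy
    have := congrArg (fun S : R →L[ℝ] R => S b) (Ring.mul_inverse_cancel (T y) hy)
    simpa [T] using this

/-- The extension of a function on `[0, 1]` to `ℝ` that is constant outside. -/
noncomputable def extUI (φ : C(UI, F)) : ℝ → F := Set.IccExtend zero_le_one φ

theorem continuous_extUI (φ : C(UI, F)) : Continuous (extUI φ) := φ.continuous.Icc_extend'

theorem extUI_of_mem (φ : C(UI, F)) {t : ℝ} (ht : t ∈ Set.Icc (0 : ℝ) 1) :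
    extUI φ t = φ ⟨t, ht⟩ := Set.IccExtend_of_mem _ _ ht

theorem norm_extUI_le (φ : C(UI, F)) (t : ℝ) : ‖extUI φ t‖ ≤ ‖φ‖ := φ.norm_coe_le_norm _

/-- The primitive of a continuous function on `[0, 1]` that vanishes at `0`. -/
noncomputable def primUI [CompleteSpace F] : C(UI, F) →L[ℝ] C(UI, F) :=
  LinearMap.mkContinuous
    { toFun := fun φ => (⟨fun t => ∫ s in (0 : ℝ)..t, extUI φ s,
        (intervalIntegral.continuous_primitive
          (fun a b => (continuous_extUI φ).intervalIntegrable a b) 0).comp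
            continuous_subtype_val⟩ : C(UI, F))
      map_add' := fun φ ψ => by
        ext t
        exact intervalIntegral.integral_add ((continuous_extUI φ).intervalIntegrable _ _)
          ((continuous_extUI ψ).intervalIntegrable _ _)
      map_smul' := fun c φ => by
        ext t
        exact intervalIntegral.integral_smul c _ } 1 (fun φ => by
    rw [ContinuousMap.norm_le _ (by positivity)]
    intro t
    refine (intervalIntegral.norm_integral_le_of_norm_le_const
      (C := ‖φ‖) fun s _ => norm_extUI_le φ s).trans ?_
    rw [one_mul, sub_zero, abs_of_nonneg t.2.1]
    exact mul_le_of_le_one_right (norm_nonneg _) t.2.2)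

theorem primUI_apply [CompleteSpace F] (φ : C(UI, F)) (t : UI) :
    primUI φ t = ∫ s in (0 : ℝ)..t, extUI φ s := rfl

theorem hasDerivAt_primUI [CompleteSpace F] (φ : C(UI, F)) (t : ℝ) :
    HasDerivAt (fun t => ∫ s in (0 : ℝ)..t, extUI φ s) (extUI φ t) t :=
  intervalIntegral.integral_hasDerivAt_right ((continuous_extUI φ).intervalIntegrable _ _)
    (continuous_extUI φ).stronglyMeasurable.stronglyMeasurableAtFilter
    (continuous_extUI φ).continuousAt

variable {A : Type} [NormedRing A] [NormedAlgebra ℝ A] [CompleteSpace A]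

theorem fderivFst_ray {Γ : E → E →L[ℝ] A} (hΓ : ContDiff ℝ ∞ Γ) (y v : E) (t : ℝ) :
    fderivFst (fun p : E × ℝ => Γ (p.2 • p.1) p.1) (y, t) v =
      t • fderiv ℝ Γ (t • y) v y + Γ (t • y) v := by
  have hf : ContDiff ℝ ∞ (fun p : E × ℝ => Γ (p.2 • p.1) p.1) :=
    (hΓ.comp (contDiff_snd.smul contDiff_fst)).clm_apply contDiff_fst
  have h1 : HasFDerivAt (fun z : E => Γ (t • z) z) _ y := hasFDerivAt_fst hf y t
  have h2 : HasFDerivAt (fun z : E => t • z) (t • ContinuousLinearMap.id ℝ E) y :=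
    (hasFDerivAt_id y).const_smul t
  have h3 := (((hΓ.differentiable (by simp) (t • y)).hasFDerivAt).comp y h2).clm_apply
    (hasFDerivAt_id y)
  have := congrArg (fun L : E →L[ℝ] A => L v) (h1.unique h3)
  simp only [Function.comp_apply] at this
  rw [this]
  simp [add_comm]

set_option maxHeartbeats 800000 in
/-- **Frobenius' theorem for linear systems.** The equation `dS = -Γ S` is solvable near the origin
with `S(0) = 1` if `Γ` satisfies the integrability condition `dΓ + Γ ∧ Γ = 0`. The solution is the
parallel transport along the rays. -/
theorem exists_parallel_of_flat {Γ : E → E →L[ℝ] A} (hΓ : ContDiff ℝ ∞ Γ) {ρ : ℝ} (hρ : 0 < ρ)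
    (hflat : ∀ y ∈ Metric.ball (0 : E) ρ, ∀ v w : E,
      fderiv ℝ Γ y v w - fderiv ℝ Γ y w v + (Γ y v * Γ y w - Γ y w * Γ y v) = 0) :
    ∃ (N : Set E) (S : E → A), IsOpen N ∧ (0 : E) ∈ N ∧ ContDiffOn ℝ ∞ S N ∧ S 0 = 1 ∧
      ∀ y ∈ N, ∀ v, fderiv ℝ S y v = -(Γ y v * S y) := by
  -- along the ray through `y` the equation is `φ' = -Γ (t y) (y) φ`, an integral equation for `φ`
  let f : E × ℝ → A := fun p => Γ (p.2 • p.1) p.1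
  have hf : ContDiff ℝ ∞ f :=
    (hΓ.comp (contDiff_snd.smul contDiff_fst)).clm_apply contDiff_fst
  let m : E → C(UI, A) := curryUI f hf.continuous
  have hm : ContDiff ℝ ∞ m := contDiff_curryUI hf
  have h0 : m 0 = 0 := by ext t; simp [m, f]
  obtain ⟨N, φ, hN, h0N, hφ, heq⟩ := exists_smooth_solution (primUI (F := A)) hm h0 1
  let one : UI := ⟨1, by simp⟩
  let S : E → A := fun y => φ y one
  have hev : ∀ g : C(UI, A), (ContinuousMap.evalCLM ℝ one : C(UI, A) →L[ℝ] A) g = g one :=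
    fun g => rfl
  have hS : ∀ y ∈ N, HasFDerivAt S ((ContinuousMap.evalCLM ℝ one : C(UI, A) →L[ℝ] A).comp
      (fderiv ℝ φ y)) y := fun y hy =>
    (ContinuousMap.evalCLM ℝ one : C(UI, A) →L[ℝ] A).hasFDerivAt.comp y
      ((hφ.differentiableOn (by simp)).differentiableAt (hN.mem_nhds hy)).hasFDerivAt
  refine ⟨N ∩ Metric.ball 0 ρ, S, hN.inter Metric.isOpen_ball, ⟨h0N, Metric.mem_ball_self hρ⟩,
    ?_, ?_, ?_⟩
  · exact ((ContinuousMap.evalCLM ℝ one : C(UI, A) →L[ℝ] A).contDiff.comp_contDiffOn hφ).mono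
      Set.inter_subset_left
  · have := heq 0 h0N
    rw [h0, zero_mul, map_zero, add_zero] at this
    exact congrArg (fun g : C(UI, A) => g one) this
  · rintro y ⟨hyN, hyB⟩ v
    have hφy := ((hφ.differentiableOn (by simp)).differentiableAt (hN.mem_nhds hyN)).hasFDerivAt
    have hmy := hasFDerivAt_curryUI hf y
    -- the equation for the derivative of `φ` in the direction `v`
    set φ' : C(UI, A) := fderiv ℝ φ y v with hφ'
    set m' : C(UI, A) := flipUIAt (.id ℝ (E →L[ℝ] A))
      (curryUI (fderivFst f) (contDiff_fderivFst hf).continuous y) v with hm'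
    have hlin : φ' + primUI (m y * φ' + m' * φ y) = 0 := by
      have h1 : HasFDerivAt (fun y => φ y + primUI (m y * φ y)) _ y :=
        hφy.add ((primUI (F := A)).hasFDerivAt.comp (f := fun z => m z * φ z) y (hmy.mul' hφy))
      have h2 : HasFDerivAt (fun y => φ y + primUI (m y * φ y)) (0 : E →L[ℝ] C(UI, A)) y :=
        (hasFDerivAt_const (1 : C(UI, A)) y).congr_of_eventuallyEq (by
          filter_upwards [hN.mem_nhds hyN] with z hz using heq z hz)
      have := congrArg (fun L : E →L[ℝ] C(UI, A) => L v) (h1.unique h2)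
      simpa using this
    -- `P = φ y` and `Q = φ'` on `[0, 1]`, as differentiable functions on `ℝ`
    let P : ℝ → A := fun t => 1 - ∫ s in (0 : ℝ)..t, extUI (m y * φ y) s
    let Q : ℝ → A := fun t => - ∫ s in (0 : ℝ)..t, extUI (m y * φ' + m' * φ y) s
    have hP : ∀ t, HasDerivAt P (-extUI (m y * φ y) t) t := fun t =>
      (hasDerivAt_primUI _ t).const_sub 1
    have hQ : ∀ t, HasDerivAt Q (-extUI (m y * φ' + m' * φ y) t) t := fun t =>
      (hasDerivAt_primUI _ t).neg
    have hPe : ∀ t (ht : t ∈ Set.Icc (0 : ℝ) 1), P t = φ y ⟨t, ht⟩ := fun t ht => by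
      have := congrArg (fun g : C(UI, A) => g ⟨t, ht⟩) (heq y hyN)
      simp only [ContinuousMap.add_apply, primUI_apply, ContinuousMap.one_apply] at this
      simp only [P, ← this, add_sub_cancel_right]
    have hQe : ∀ t (ht : t ∈ Set.Icc (0 : ℝ) 1), Q t = φ' ⟨t, ht⟩ := fun t ht => by
      have := congrArg (fun g : C(UI, A) => g ⟨t, ht⟩) hlin
      simp only [ContinuousMap.add_apply, primUI_apply, ContinuousMap.zero_apply] at this
      simp only [Q]
      exact (eq_neg_of_add_eq_zero_left this).symm
    have hray : ∀ t : ℝ, HasDerivAt (fun t : ℝ => t • y) y t := fun t => by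
      simpa using (hasDerivAt_id t).smul_const y
    have hΓt : ∀ t : ℝ, HasDerivAt (fun t : ℝ => Γ (t • y) v) (fderiv ℝ Γ (t • y) y v) t :=
      fun t => by
        have h1 := ((hΓ.differentiable (by simp) (t • y)).hasFDerivAt).comp_hasDerivAt t (hray t)
        simpa using h1.clm_apply (hasDerivAt_const t v)
    -- `ψ t` is `t (dS + Γ S)(v)` at the point `t y`; by flatness it solves the linear equation
    -- `ψ' = -Γ (t y) (y) ψ` with `ψ 0 = 0`
    let ψ : ℝ → A := fun t => Q t + (t • Γ (t • y) v) * P t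
    have hψ : ∀ t, HasDerivAt ψ (-extUI (m y * φ' + m' * φ y) t +
        (((1 : ℝ) • Γ (t • y) v + t • fderiv ℝ Γ (t • y) y v) * P t +
          (t • Γ (t • y) v) * -extUI (m y * φ y) t)) t := fun t => by
      have h3 : HasDerivAt (fun t : ℝ => t • Γ (t • y) v)
          ((1 : ℝ) • Γ (t • y) v + t • fderiv ℝ Γ (t • y) y v) t := by
        rw [add_comm]
        exact (hasDerivAt_id' t).fun_smul (hΓt t)
      exact (hQ t).fun_add (h3.fun_mul (hP t))
    have hm't : ∀ t (ht : t ∈ Set.Icc (0 : ℝ) 1), m' ⟨t, ht⟩ =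
        t • fderiv ℝ Γ (t • y) v y + Γ (t • y) v := fun t ht => fderivFst_ray hΓ y v t
    have key : ∀ t ∈ Set.Icc (0 : ℝ) 1, (-extUI (m y * φ' + m' * φ y) t +
        (((1 : ℝ) • Γ (t • y) v + t • fderiv ℝ Γ (t • y) y v) * P t +
          (t • Γ (t • y) v) * -extUI (m y * φ y) t)) = -(Γ (t • y) y * ψ t) := by
      intro t ht
      have hmem : t • y ∈ Metric.ball (0 : E) ρ := by
        rw [mem_ball_zero_iff] at hyB ⊢
        rw [norm_smul, Real.norm_of_nonneg ht.1]
        exact (mul_le_of_le_one_left (norm_nonneg _) ht.2).trans_lt hyB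
      have hfl := hflat _ hmem y v
      have hmt : m y ⟨t, ht⟩ = Γ (t • y) y := rfl
      simp only [ψ]
      rw [extUI_of_mem _ ht, extUI_of_mem _ ht, hPe t ht, hQe t ht]
      simp only [ContinuousMap.add_apply, ContinuousMap.mul_apply, hm't t ht, hmt]
      have hD : fderiv ℝ Γ (t • y) y v = fderiv ℝ Γ (t • y) v y
          - (Γ (t • y) y * Γ (t • y) v - Γ (t • y) v * Γ (t • y) y) := by
        rw [← sub_eq_zero, ← hfl]; abel
      rw [hD]
      simp only [one_smul, smul_sub, add_mul, sub_mul, mul_add, smul_mul_assoc, mul_smul_comm,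
        mul_neg, mul_assoc]
      abel
    have hz := eq_zero_of_abs_deriv_le_mul_abs_self_of_eq_zero_right (f := ψ) (a := 0) (b := 1)
      (K := ‖m y‖) (fun t _ => (hψ t).continuousAt.continuousWithinAt)
      (fun t _ => (hψ t).hasDerivWithinAt) (by simp [ψ, Q])
      (fun t ht => by
        have ht' : t ∈ Set.Icc (0 : ℝ) 1 := ⟨ht.1, ht.2.le⟩
        rw [key t ht', norm_neg]
        refine (norm_mul_le _ _).trans ?_
        gcongr
        exact (m y).norm_coe_le_norm ⟨t, ht'⟩) 1 (by simp)
    rw [(hS y hyN).fderiv]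
    have h1 : (1 : ℝ) ∈ Set.Icc (0 : ℝ) 1 := by simp
    simp only [ψ, hQe 1 h1, hPe 1 h1, one_smul] at hz
    exact eq_neg_of_add_eq_zero_left hz

end SmoothConn
end Frobenius

/-! ### The Poincaré lemma and uniqueness along rays -/

section Poincare
variable {E F : Type} [NormedAddCommGroup E] [NormedSpace ℝ E]
  [NormedAddCommGroup F] [NormedSpace ℝ F]

namespace SmoothConn

/-- A function that vanishes at the centre of a ball, and whose derivative is bounded by a multiple
of its norm, vanishes on the ball. -/
theorem eq_zero_of_norm_fderiv_le {a : E → F} {ρ K : ℝ}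
    (ha : ∀ y ∈ Metric.ball (0 : E) ρ, DifferentiableAt ℝ a y) (h0 : a 0 = 0)
    (hK : ∀ y ∈ Metric.ball (0 : E) ρ, ∀ v, ‖fderiv ℝ a y v‖ ≤ K * ‖v‖ * ‖a y‖) :
    ∀ y ∈ Metric.ball (0 : E) ρ, a y = 0 := by
  intro y hy
  have hmem : ∀ t ∈ Set.Icc (0 : ℝ) 1, t • y ∈ Metric.ball (0 : E) ρ := by
    intro t ht
    rw [mem_ball_zero_iff] at hy ⊢
    rw [norm_smul, Real.norm_of_nonneg ht.1]
    exact (mul_le_of_le_one_left (norm_nonneg _) ht.2).trans_lt hy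
  have hd : ∀ t ∈ Set.Icc (0 : ℝ) 1,
      HasDerivAt (fun t : ℝ => a (t • y)) (fderiv ℝ a (t • y) y) t := fun t ht =>
    (ha _ (hmem t ht)).hasFDerivAt.comp_hasDerivAt t
      (by simpa using (hasDerivAt_id t).smul_const y)
  have := eq_zero_of_abs_deriv_le_mul_abs_self_of_eq_zero_right (f := fun t : ℝ => a (t • y))
    (a := 0) (b := 1) (K := K * ‖y‖) (fun t ht => (hd t ht).continuousAt.continuousWithinAt)
    (fun t ht => (hd t ⟨ht.1, ht.2.le⟩).hasDerivWithinAt) (by simpa using h0)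
    (fun t ht => hK _ (hmem t ⟨ht.1, ht.2.le⟩) y) 1 (by simp)
  simpa using this

/-- The integral over `[0, 1]`. -/
noncomputable def integralUI [CompleteSpace F] : C(UI, F) →L[ℝ] F :=
  (ContinuousMap.evalCLM ℝ (⟨1, by simp⟩ : UI)).comp primUI

theorem integralUI_apply [CompleteSpace F] (φ : C(UI, F)) :
    integralUI φ = ∫ s in (0 : ℝ)..1, extUI φ s := rfl

theorem integralUI_clm [CompleteSpace F] {W : Type} [NormedAddCommGroup W] [NormedSpace ℝ W]
    [CompleteSpace W] (L : W →L[ℝ] F) (φ : C(UI, W)) :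
    L (integralUI φ) = ∫ s in (0 : ℝ)..1, L (extUI φ s) := by
  rw [integralUI_apply]
  exact (L.intervalIntegral_comp_comm ((continuous_extUI φ).intervalIntegrable _ _)).symm

/-- The sign computation behind Cartan's formula: the first of the vectors to be alternated is
separated from the others. -/
theorem alternatizeUncurryFin_curryLeft_flip {k : ℕ} (L : E →L[ℝ] E [⋀^Fin (k + 1)]→L[ℝ] F)
    (y : E) (L' : E →L[ℝ] E [⋀^Fin k]→L[ℝ] F) (hL' : ∀ v, L' v = (L v).curryLeft y) :
    ContinuousAlternatingMap.alternatizeUncurryFin L' =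
      L y - (ContinuousAlternatingMap.alternatizeUncurryFin L).curryLeft y := by
  ext w
  rw [ContinuousAlternatingMap.sub_apply, ContinuousAlternatingMap.curryLeft_apply_apply,
    ContinuousAlternatingMap.alternatizeUncurryFin_apply,
    ContinuousAlternatingMap.alternatizeUncurryFin_apply, Fin.sum_univ_succ (n := k + 1)]
  have h0 : Fin.removeNth 0 (Matrix.vecCons y w : Fin (k + 2) → E) = w := by
    funext t; simp [Fin.removeNth]
  have hs : ∀ i : Fin (k + 1), i.succ.removeNth (Matrix.vecCons y w : Fin (k + 2) → E) =
      Matrix.vecCons y (i.removeNth w) := by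
    intro i
    funext t
    refine Fin.cases ?_ (fun t => ?_) t <;> simp [Fin.removeNth]
  simp only [hL', h0, hs, ContinuousAlternatingMap.curryLeft_apply_apply, Fin.val_zero, pow_zero,
    one_smul, Matrix.cons_val_zero, Matrix.cons_val_succ, Fin.val_succ, pow_succ, mul_neg, mul_one,
    neg_smul, Finset.sum_neg_distrib]
  abel

theorem hasFDerivAt_integralUI [CompleteSpace F] {f : E × ℝ → F} (hf : ContDiff ℝ ∞ f) (y : E) :
    HasFDerivAt (fun y => integralUI (curryUI f hf.continuous y))
      (integralUI (curryUI (fderivFst f) (contDiff_fderivFst hf).continuous y)) y := by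
  have h := (integralUI (F := F)).hasFDerivAt.comp y (hasFDerivAt_curryUI hf y)
  refine h.congr_fderiv ?_
  ext v
  have := integralUI_clm (ContinuousLinearMap.apply ℝ F v)
    (curryUI (fderivFst f) (contDiff_fderivFst hf).continuous y)
  exact this.symm

theorem contDiff_integralUI [CompleteSpace F] {f : E × ℝ → F} (hf : ContDiff ℝ ∞ f) :
    ContDiff ℝ ∞ (fun y => integralUI (curryUI f hf.continuous y)) :=
  (integralUI (F := F)).contDiff.comp (contDiff_curryUI hf)

/-- The integrand `t ^ k α(t y)(y, …)` of the homotopy operator. -/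
noncomputable def homotopyIntegrand {k : ℕ} (α : E → E [⋀^Fin (k + 1)]→L[ℝ] F) (p : E × ℝ) :
    E [⋀^Fin k]→L[ℝ] F := p.2 ^ k • (α (p.2 • p.1)).curryLeft p.1

section Ray
variable {P Q : Type} [NormedAddCommGroup P] [NormedSpace ℝ P]
  [NormedAddCommGroup Q] [NormedSpace ℝ Q]

theorem contDiff_rayIntegrand (J : P →L[ℝ] E →L[ℝ] Q) {α : E → P} (hα : ContDiff ℝ ∞ α) (k : ℕ) :
    ContDiff ℝ ∞ (fun p : E × ℝ => p.2 ^ k • J (α (p.2 • p.1)) p.1) :=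
  (contDiff_snd.pow k).smul ((J.contDiff.comp
    (hα.comp (contDiff_snd.smul contDiff_fst))).clm_apply contDiff_fst)

theorem fderivFst_rayIntegrand (J : P →L[ℝ] E →L[ℝ] Q) {α : E → P} (hα : ContDiff ℝ ∞ α) (k : ℕ)
    (y : E) (t : ℝ) (v : E) :
    fderivFst (fun p : E × ℝ => p.2 ^ k • J (α (p.2 • p.1)) p.1) (y, t) v =
      t ^ k • (t • J (fderiv ℝ α (t • y) v) y + J (α (t • y)) v) := by
  have h1 := hasFDerivAt_fst (contDiff_rayIntegrand J hα k) y t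
  have h2 : HasFDerivAt (fun z : E => t • z) (t • ContinuousLinearMap.id ℝ E) y :=
    (hasFDerivAt_id y).const_smul t
  have h3 := ((hα.differentiable (by simp) (t • y)).hasFDerivAt).comp y h2
  have h4 := (J.hasFDerivAt.comp y h3).clm_apply (hasFDerivAt_id y)
  rw [h1.unique (h4.const_smul (t ^ k))]
  simp [add_comm]

end Ray

theorem contDiff_homotopyIntegrand {k : ℕ} {α : E → E [⋀^Fin (k + 1)]→L[ℝ] F}
    (hα : ContDiff ℝ ∞ α) : ContDiff ℝ ∞ (homotopyIntegrand α) :=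
  contDiff_rayIntegrand (P := E [⋀^Fin (k + 1)]→L[ℝ] F) (Q := E [⋀^Fin k]→L[ℝ] F)
    (ContinuousAlternatingMap.curryLeftLI (𝕜 := ℝ) (E := E) (F := F)
      (n := k)).toContinuousLinearMap hα k

/-- For a closed form `α`, the exterior derivative of the integrand of the homotopy operator is the
derivative of `t ^ (k + 1) α(t y)` in `t`. -/
theorem alternatize_fderivFst_homotopyIntegrand {k : ℕ} {α : E → E [⋀^Fin (k + 1)]→L[ℝ] F}
    (hα : ContDiff ℝ ∞ α) (y : E) (t : ℝ) (hd : extDeriv α (t • y) = 0) :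
    ContinuousAlternatingMap.alternatizeUncurryFin (fderivFst (homotopyIntegrand α) (y, t)) =
      ((k + 1 : ℕ) * t ^ k) • α (t • y) + t ^ (k + 1) • fderiv ℝ α (t • y) y := by
  set L := fderiv ℝ α (t • y) with hL
  let L' : E →L[ℝ] E [⋀^Fin k]→L[ℝ] F :=
    ((ContinuousAlternatingMap.curryLeftLI (𝕜 := ℝ) (E := E) (F := F)
      (n := k)).toContinuousLinearMap.comp L).flip y
  have h6 : fderivFst (homotopyIntegrand α) (y, t) =
      t ^ k • (t • L' + (α (t • y)).curryLeft) := by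
    ext v : 1
    exact fderivFst_rayIntegrand (P := E [⋀^Fin (k + 1)]→L[ℝ] F) (Q := E [⋀^Fin k]→L[ℝ] F)
      (ContinuousAlternatingMap.curryLeftLI (𝕜 := ℝ) (E := E) (F := F)
        (n := k)).toContinuousLinearMap hα k y t v
  rw [h6]
  have h7 := alternatizeUncurryFin_curryLeft_flip L y L' (fun v => rfl)
  have h8 : ContinuousAlternatingMap.alternatizeUncurryFin L = 0 := hd
  rw [h8, ContinuousAlternatingMap.curryLeft_zero, zero_apply, sub_zero] at h7
  rw [ContinuousAlternatingMap.alternatizeUncurryFin_smul,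
    ContinuousAlternatingMap.alternatizeUncurryFin_add,
    ContinuousAlternatingMap.alternatizeUncurryFin_smul, h7,
    ContinuousAlternatingMap.alternatizeUncurryFin_curryLeft, smul_add, smul_smul, ← pow_succ]
  refine (add_comm _ _).trans (congrArg (· + _) ?_)
  rw [← Nat.cast_smul_eq_nsmul ℝ, smul_smul, mul_comm]

/-- The **Poincaré lemma** on a ball: a closed form is exact. -/
theorem exists_extDeriv_eq [CompleteSpace F] {k : ℕ} {α : E → E [⋀^Fin (k + 1)]→L[ℝ] F}
    (hα : ContDiff ℝ ∞ α) {ρ : ℝ} (hd : ∀ y ∈ Metric.ball (0 : E) ρ, extDeriv α y = 0) :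
    ∃ η : E → E [⋀^Fin k]→L[ℝ] F, ContDiff ℝ ∞ η ∧
      ∀ y ∈ Metric.ball (0 : E) ρ, extDeriv η y = α y := by
  have hf := contDiff_homotopyIntegrand hα
  refine ⟨_, contDiff_integralUI hf, fun y hy => ?_⟩
  rw [extDeriv, (hasFDerivAt_integralUI hf y).fderiv]
  -- alternation commutes with the integral over the ray, whose integrand is then a derivative
  have h1 := integralUI_clm (ContinuousAlternatingMap.alternatizeUncurryFinCLM ℝ E F (n := k))
    (curryUI (fderivFst (homotopyIntegrand α)) (contDiff_fderivFst hf).continuous y)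
  refine h1.trans ?_
  have hd' : ∀ t : ℝ, HasDerivAt (fun t : ℝ => t ^ (k + 1) • α (t • y))
      (((k + 1 : ℕ) * t ^ k) • α (t • y) + t ^ (k + 1) • fderiv ℝ α (t • y) y) t := fun t => by
    have h2 := (hα.differentiable (by simp) (t • y)).hasFDerivAt.comp_hasDerivAt t
      (show HasDerivAt (fun t : ℝ => t • y) y t by simpa using (hasDerivAt_id t).smul_const y)
    have h4 := (hasDerivAt_pow (k + 1) t).fun_smul h2
    refine h4.congr_deriv ?_
    simp [add_comm]
  have h3 : ∀ t ∈ Set.uIcc (0 : ℝ) 1, ContinuousAlternatingMap.alternatizeUncurryFinCLM ℝ E F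
      (extUI (curryUI (fderivFst (homotopyIntegrand α)) (contDiff_fderivFst hf).continuous y) t) =
      (((k + 1 : ℕ) * t ^ k) • α (t • y) + t ^ (k + 1) • fderiv ℝ α (t • y) y) := by
    intro t ht
    rw [Set.uIcc_of_le zero_le_one] at ht
    rw [extUI_of_mem _ ht]
    refine alternatize_fderivFst_homotopyIntegrand hα y t (hd _ ?_)
    rw [mem_ball_zero_iff] at hy ⊢
    rw [norm_smul, Real.norm_of_nonneg ht.1]
    exact (mul_le_of_le_one_left (norm_nonneg _) ht.2).trans_lt hy
  rw [intervalIntegral.integral_congr h3, intervalIntegral.integral_eq_sub_of_hasDerivAt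
    (fun t _ => hd' t)]
  · simp
  · have hα' := hα.continuous
    have hdα : Continuous (fderiv ℝ α) := hα.continuous_fderiv (by simp)
    refine Continuous.intervalIntegrable ?_ _ _
    fun_prop

end SmoothConn
end Poincare

noncomputable section
namespace SmoothConn

/-! ### Centred charts and coordinate vector fields -/

section Chart
variable {n : ℕ} {𝕂 : Type} [RCLike 𝕂] {X : Type u} [TopologicalSpace X]
  [ChartedSpace (EuclideanSpace ℝ (Fin n)) X] [IsManifold (𝓡 n) ∞ X] (x₀ : X)

/-- The chart at `x₀`, translated so that it maps `x₀` to the origin. -/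
def cen (x : X) : EuclideanSpace ℝ (Fin n) := extChartAt (𝓡 n) x₀ x - extChartAt (𝓡 n) x₀ x₀

/-- The inverse of the chart `cen x₀`. -/
def cenInv (y : EuclideanSpace ℝ (Fin n)) : X :=
  (extChartAt (𝓡 n) x₀).symm (y + extChartAt (𝓡 n) x₀ x₀)

variable (n) in
/-- The domain of the chart `cen x₀`. -/
def cenDom : Opens X := ⟨(extChartAt (𝓡 n) x₀).source, isOpen_extChartAt_source x₀⟩

/-- The image of the open set `V` in the chart `cen x₀`. -/
def cenImg (V : Opens X) : Set (EuclideanSpace ℝ (Fin n)) :=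
  {y | y + extChartAt (𝓡 n) x₀ x₀ ∈ (extChartAt (𝓡 n) x₀).target ∧ cenInv x₀ y ∈ V}

variable {x₀} {V : Opens X}

theorem mem_cenDom_self : x₀ ∈ cenDom n x₀ := mem_extChartAt_source x₀

@[simp] theorem cen_self : cen (n := n) x₀ x₀ = 0 := sub_self _

theorem cenInv_cen {x : X} (hx : x ∈ cenDom n x₀) : cenInv x₀ (cen (n := n) x₀ x) = x := by
  rw [cenInv, cen, sub_add_cancel]
  exact (extChartAt (𝓡 n) x₀).left_inv hx

theorem cen_cenInv {y : EuclideanSpace ℝ (Fin n)} (hy : y ∈ cenImg x₀ V) :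
    cen x₀ (cenInv x₀ y) = y := by
  rw [cenInv, cen, (extChartAt (𝓡 n) x₀).right_inv hy.1, add_sub_cancel_right]

theorem cen_mem_cenImg {x : X} (hx : x ∈ cenDom n x₀) (hV : x ∈ V) :
    cen (n := n) x₀ x ∈ cenImg x₀ V := by
  refine ⟨?_, by rwa [cenInv_cen hx]⟩
  rw [cen, sub_add_cancel]
  exact (extChartAt (𝓡 n) x₀).map_source hx

theorem cenImg_mono {W : Opens X} (h : W ≤ V) : cenImg (n := n) x₀ W ⊆ cenImg x₀ V :=
  fun _ hy => ⟨hy.1, h hy.2⟩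

theorem isOpen_cenImg : IsOpen (cenImg (n := n) x₀ V) := by
  have h := (continuousOn_extChartAt_symm (I := 𝓡 n) x₀).isOpen_inter_preimage
    (isOpen_extChartAt_target x₀) V.isOpen
  exact h.preimage (f := fun y => y + extChartAt (𝓡 n) x₀ x₀) (by fun_prop)

theorem contMDiffAt_cen {x : X} (hx : x ∈ cenDom n x₀) :
    ContMDiffAt (𝓡 n) 𝓘(ℝ, EuclideanSpace ℝ (Fin n)) ∞ (cen (n := n) x₀) x := by
  have h1 : ContMDiffAt (𝓡 n) 𝓘(ℝ, EuclideanSpace ℝ (Fin n)) ∞ (extChartAt (𝓡 n) x₀) x :=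
    contMDiffAt_extChartAt' (by simpa [cenDom] using hx)
  exact h1.sub contMDiffAt_const

theorem contMDiffAt_cenInv {y : EuclideanSpace ℝ (Fin n)} (hy : y ∈ cenImg x₀ V) :
    ContMDiffAt 𝓘(ℝ, EuclideanSpace ℝ (Fin n)) (𝓡 n) ∞ (cenInv x₀) y := by
  have h1 := (contMDiffOn_extChartAt_symm (I := 𝓡 n) (n := ∞) x₀).contMDiffAt
    ((isOpen_extChartAt_target x₀).mem_nhds hy.1)
  have h2 : ContMDiffAt 𝓘(ℝ, EuclideanSpace ℝ (Fin n)) 𝓘(ℝ, EuclideanSpace ℝ (Fin n)) ∞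
      (fun y => y + extChartAt (𝓡 n) x₀ x₀) y :=
    (contDiff_id.add contDiff_const).contMDiff.contMDiffAt
  exact h1.comp y h2

theorem isInvertible_mfderiv_cen {x : X} (hx : x ∈ cenDom n x₀) :
    (mfderiv (𝓡 n) 𝓘(ℝ, EuclideanSpace ℝ (Fin n)) (cen (n := n) x₀) x).IsInvertible := by
  have h1 := isInvertible_mfderiv_extChartAt (I := 𝓡 n) (x := x₀) (y := x) hx
  have h2 : MDifferentiableAt (𝓡 n) 𝓘(ℝ, EuclideanSpace ℝ (Fin n)) (extChartAt (𝓡 n) x₀) x :=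
    (contMDiffAt_extChartAt' (n := 1) (by simpa [cenDom] using hx)).mdifferentiableAt (by simp)
  have h3 : mfderiv (𝓡 n) 𝓘(ℝ, EuclideanSpace ℝ (Fin n)) (cen (n := n) x₀) x =
      mfderiv (𝓡 n) 𝓘(ℝ, EuclideanSpace ℝ (Fin n)) (extChartAt (𝓡 n) x₀) x := by
    have h4 : HasFDerivAt (fun y => y - extChartAt (𝓡 n) x₀ x₀)
        (ContinuousLinearMap.id ℝ (EuclideanSpace ℝ (Fin n))) (extChartAt (𝓡 n) x₀ x) :=
      (hasFDerivAt_id _).sub_const _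
    have := (h4.hasMFDerivAt.comp x h2.hasMFDerivAt).mfderiv
    exact this
  rw [h3]
  exact h1

variable (x₀) in
/-- A function on `V` in the chart `cen x₀`. -/
def loc (f : V → 𝕂) (y : EuclideanSpace ℝ (Fin n)) : 𝕂 := extFn f (cenInv x₀ y)

theorem loc_cen (f : V → 𝕂) (x : V) (hx : (x : X) ∈ cenDom n x₀) :
    loc x₀ f (cen (n := n) x₀ x) = f x := by
  rw [loc, cenInv_cen hx, extFn_of_mem]

theorem loc_of_mem (f : V → 𝕂) {y : EuclideanSpace ℝ (Fin n)} (hy : y ∈ cenImg x₀ V) :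
    loc x₀ f y = f ⟨cenInv x₀ y, hy.2⟩ := extFn_of_mem f ⟨cenInv x₀ y, hy.2⟩

theorem contDiffOn_loc (f : Fn n 𝕂 V) : ContDiffOn ℝ ∞ (loc (n := n) x₀ f) (cenImg x₀ V) := by
  intro y hy
  have h := (f.contMDiffAt_ext ⟨cenInv x₀ y, hy.2⟩).comp y (contMDiffAt_cenInv hy)
  exact h.contDiffAt.contDiffWithinAt

theorem differentiableAt_loc (f : Fn n 𝕂 V) {y : EuclideanSpace ℝ (Fin n)}
    (hy : y ∈ cenImg x₀ V) : DifferentiableAt ℝ (loc x₀ f) y :=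
  ((contDiffOn_loc f).contDiffAt (isOpen_cenImg.mem_nhds hy)).differentiableAt (by simp)

/-- The function on `V` with a given expression in the chart `cen x₀`. -/
def ofLoc (h : V ≤ cenDom n x₀) (g : EuclideanSpace ℝ (Fin n) → 𝕂)
    (hg : ContDiffOn ℝ ∞ g (cenImg x₀ V)) : Fn n 𝕂 V :=
  ⟨fun x => g (cen x₀ (x : X)), fun x => by
    refine (contMDiffAt_subtype_iff (f := fun x : X => g (cen x₀ x))).2 ?_
    exact ((hg.contDiffAt (isOpen_cenImg.mem_nhds (cen_mem_cenImg (h x.2) x.2))).contMDiffAt).comp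
      (x : X) (contMDiffAt_cen (h x.2))⟩

theorem ofLoc_apply (h : V ≤ cenDom n x₀) (g : EuclideanSpace ℝ (Fin n) → 𝕂)
    (hg : ContDiffOn ℝ ∞ g (cenImg x₀ V)) (x : V) : ofLoc h g hg x = g (cen x₀ (x : X)) := rfl

theorem loc_ofLoc (h : V ≤ cenDom n x₀) (g : EuclideanSpace ℝ (Fin n) → 𝕂)
    (hg : ContDiffOn ℝ ∞ g (cenImg x₀ V)) {y : EuclideanSpace ℝ (Fin n)} (hy : y ∈ cenImg x₀ V) :
    loc x₀ (ofLoc h g hg) y = g y := by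
  rw [loc_of_mem _ hy, ofLoc_apply, cen_cenInv hy]

variable (x₀) in
/-- A vector field on `V` in the chart `cen x₀`, as a function on `V`. -/
def hatVF (ξ : VF n V) (x : V) : EuclideanSpace ℝ (Fin n) :=
  mfderiv (𝓡 n) 𝓘(ℝ, EuclideanSpace ℝ (Fin n)) (cen (n := n) x₀) (x : X) (ξ.1 x)

theorem hatVF_ext (h : V ≤ cenDom n x₀) {ξ η : VF n V} (hξ : ∀ x, hatVF x₀ ξ x = hatVF x₀ η x) :
    ξ = η := by
  refine Subtype.ext (funext fun x => ?_)
  exact (isInvertible_mfderiv_cen (h x.2)).injective (hξ x)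

theorem hatVF_smul (f : Fn n ℝ V) (ξ : VF n V) (x : V) :
    hatVF x₀ (f • ξ) x = f x • hatVF x₀ ξ x := by
  rw [hatVF, VF.smul_apply, map_smul]; rfl

theorem hatVF_add (ξ η : VF n V) (x : V) :
    hatVF x₀ (ξ + η) x = hatVF x₀ ξ x + hatVF x₀ η x := map_add _ _ _

theorem hatVF_sum {ι : Type*} (s : Finset ι) (ξ : ι → VF n V) (x : V) :
    hatVF x₀ (∑ i ∈ s, ξ i) x = ∑ i ∈ s, hatVF x₀ (ξ i) x := by
  classical
  induction s using Finset.induction_on with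
  | empty => simp only [Finset.sum_empty]; exact map_zero _
  | insert i s hi ih => rw [Finset.sum_insert hi, Finset.sum_insert hi, hatVF_add, ih]

/-- The derivative of a function along a vector field, in the chart `cen x₀`. -/
theorem deriv_eq_fderiv_loc (h : V ≤ cenDom n x₀) (ξ : VF n V) (f : Fn n 𝕂 V) (x : V) :
    ξ.deriv f x = fderiv ℝ (loc x₀ f) (cen x₀ (x : X)) (hatVF x₀ ξ x) := by
  have hx := h x.2
  have hy := cen_mem_cenImg hx x.2
  have h1 : extFn f =ᶠ[nhds (x : X)] loc x₀ f ∘ cen (n := n) x₀ := by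
    filter_upwards [(cenDom n x₀).isOpen.mem_nhds hx] with z hz
    rw [Function.comp_apply, loc, cenInv_cen hz]
  rw [VF.deriv_apply, mvfderiv, h1.mfderiv_eq,
    mfderiv_comp (I' := 𝓘(ℝ, EuclideanSpace ℝ (Fin n))) (x : X)
      (differentiableAt_loc f hy).mdifferentiableAt
      ((contMDiffAt_cen hx).mdifferentiableAt (by simp)), mfderiv_eq_fderiv]
  rfl

/-- The vector field on `V` that is constant in the chart `cen x₀`. -/
def coordVF (h : V ≤ cenDom n x₀) (v : EuclideanSpace ℝ (Fin n)) : VF n V :=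
  ⟨fun x => VectorField.mpullback (𝓡 n) 𝓘(ℝ, EuclideanSpace ℝ (Fin n)) (cen (n := n) x₀) (fun _ => v) (x : X),
    VF.mem_of_contMDiffAt _ (fun _ => rfl) fun x => by
      have : IsManifold (𝓡 n) ((⊤ : ℕ∞) + 1) X := inferInstanceAs (IsManifold (𝓡 n) ∞ X)
      refine ContMDiffAt.mpullback_vectorField_preimage (n := ∞) ?_ (contMDiffAt_cen (h x.2))
        (isInvertible_mfderiv_cen (h x.2)) (by simp)
      exact contMDiffAt_vectorSpace_iff_contDiffAt.2 contDiffAt_const⟩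

theorem hatVF_coordVF (h : V ≤ cenDom n x₀) (v : EuclideanSpace ℝ (Fin n)) (x : V) :
    hatVF x₀ (coordVF h v) x = v := by
  have := (isInvertible_mfderiv_cen (h x.2)).self_apply_inverse (y := v)
  exact this

theorem resVF_coordVF {W : Opens X} (h : V ≤ cenDom n x₀) (hW : W ≤ V)
    (v : EuclideanSpace ℝ (Fin n)) : resVF hW (coordVF h v) = coordVF (hW.trans h) v := rfl

/-- Coordinate vector fields commute. -/
theorem bracket_coordVF (h : V ≤ cenDom n x₀) (v w : EuclideanSpace ℝ (Fin n)) :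
    (coordVF h v).bracket (coordVF h w) = 0 := by
  have := isManifold_min n X 3
  refine Subtype.ext (funext fun x => ?_)
  have h1 : ∀ v : EuclideanSpace ℝ (Fin n), extVF n (coordVF h v).1 =ᶠ[nhds (x : X)]
      VectorField.mpullback (𝓡 n) 𝓘(ℝ, EuclideanSpace ℝ (Fin n)) (cen (n := n) x₀) (fun _ => v) := by
    intro v
    filter_upwards [V.isOpen.mem_nhds x.2] with y hy using extVF_of_mem n _ ⟨y, hy⟩
  rw [VF.bracket_apply, (h1 v).mlieBracket_vectorField_eq (h1 w)]
  have h2 : ∀ v : EuclideanSpace ℝ (Fin n), MDifferentiableAt 𝓘(ℝ, EuclideanSpace ℝ (Fin n))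
      𝓘(ℝ, EuclideanSpace ℝ (Fin n)).tangent
      (fun y => (⟨y, v⟩ : TangentBundle 𝓘(ℝ, EuclideanSpace ℝ (Fin n)) (EuclideanSpace ℝ (Fin n))))
      (cen (n := n) x₀ (x : X)) := fun v =>
    (contMDiffAt_vectorSpace_iff_contDiffAt (n := 1).2 contDiffAt_const).mdifferentiableAt (by simp)
  have h3 : VectorField.mlieBracket 𝓘(ℝ, EuclideanSpace ℝ (Fin n))
      (fun _ => v : ∀ y : EuclideanSpace ℝ (Fin n), TangentSpace 𝓘(ℝ, EuclideanSpace ℝ (Fin n)) y)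
      (fun _ => w) = 0 := by
    have h4 : ∀ V W : ∀ y : EuclideanSpace ℝ (Fin n),
        TangentSpace 𝓘(ℝ, EuclideanSpace ℝ (Fin n)) y,
        VectorField.mlieBracket 𝓘(ℝ, EuclideanSpace ℝ (Fin n)) V W =
          VectorField.lieBracket ℝ V W := fun V W => by
      rw [← VectorField.mlieBracketWithin_univ, VectorField.mlieBracketWithin_eq_lieBracketWithin]
      exact VectorField.lieBracketWithin_univ
    refine (h4 _ _).trans (funext fun y => ?_)
    simp [VectorField.lieBracket]
    rfl
  refine (VectorField.mpullback_mlieBracket (n := ∞) (h2 v) (h2 w)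
    (contMDiffAt_cen (h x.2)) ?_).symm.trans ?_
  · rw [minSmoothness_of_isRCLikeNormedField]
    exact WithTop.coe_le_coe.2 (le_top : (2 : ℕ∞) ≤ ⊤)
  · exact (congrArg (mfderiv (𝓡 n) 𝓘(ℝ, EuclideanSpace ℝ (Fin n)) (cen (n := n) x₀) x).inverse
      (congrFun h3 (cen x₀ (x : X)))).trans (map_zero _)

/-- The coordinate functions of the chart `cen x₀`. -/
def coordFn (h : V ≤ cenDom n x₀) (a : Fin n) : Fn n ℝ V :=
  ofLoc h (fun y => y a) (contDiff_piLp_apply 2).contDiffOn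

theorem deriv_coordFn (h : V ≤ cenDom n x₀) (ξ : VF n V) (a : Fin n) (x : V) :
    ξ.deriv (coordFn h a) x = hatVF x₀ ξ x a := by
  rw [deriv_eq_fderiv_loc h]
  have h1 : loc x₀ (coordFn h a) =ᶠ[nhds (cen x₀ (x : X))]
      (EuclideanSpace.proj a : EuclideanSpace ℝ (Fin n) →L[ℝ] ℝ) := by
    filter_upwards [isOpen_cenImg.mem_nhds (cen_mem_cenImg (h x.2) x.2)] with y hy
    exact loc_ofLoc h _ _ hy
  rw [h1.fderiv_eq, ContinuousLinearMap.fderiv]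
  rfl

/-- Every vector field is a combination of the coordinate vector fields. -/
theorem eq_sum_coordVF (h : V ≤ cenDom n x₀) (ξ : VF n V) :
    ξ = ∑ a, ξ.deriv (coordFn h a) • coordVF h (EuclideanSpace.single a 1) := by
  refine hatVF_ext h fun x => ?_
  rw [hatVF_sum]
  simp only [hatVF_smul, hatVF_coordVF, deriv_coordFn]
  ext b
  simp [Finset.sum_apply, Pi.single_apply]

end Chart

/-! ### Linear combinations of sections and gluing of functions -/

section CombLemmas
variable {n : ℕ} {𝕂 : Type} [RCLike 𝕂] {X : Type u} [TopologicalSpace X]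
  [ChartedSpace (EuclideanSpace ℝ (Fin n)) X] {G : SheafOfModules.{u} (smoothRing n 𝕂 X)}
  {U V W : Opens X} {r : ℕ}

@[simp] theorem resFn_apply (h : V ≤ U) (f : Fn n 𝕂 U) (x : V) :
    resFn h f x = f ⟨x, h x.2⟩ := rfl

theorem res_comb (hV : V ≤ U) (h : W ≤ V) (e : Fin r → Sec G U) (a : Fin r → Fn n 𝕂 V) :
    res G h (comb hV e a) = comb (h.trans hV) e (resVec h a) := by
  simp only [comb, map_sum, res_smul, res_res, resVec]

theorem comb_res (hV : V ≤ U) (h : W ≤ V) (e : Fin r → Sec G U) (a : Fin r → Fn n 𝕂 W) :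
    comb h (fun i => res G hV (e i)) a = comb (h.trans hV) e a := by
  simp only [comb, res_res]

theorem comb_le_rfl (e : Fin r → Sec G U) (a : Fin r → Fn n 𝕂 U) :
    comb le_rfl e a = ∑ i, a i • e i := by
  simp only [comb, res_self]

theorem comb_zero (hV : V ≤ U) (e : Fin r → Sec G U) :
    comb hV e (fun _ => (0 : Fn n 𝕂 V)) = 0 := by
  simp [comb]

theorem comb_sub (hV : V ≤ U) (e : Fin r → Sec G U) (a b : Fin r → Fn n 𝕂 V) :
    comb hV e (fun i => a i - b i) = comb hV e a - comb hV e b := by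
  simp only [comb, sub_smul, Finset.sum_sub_distrib]

theorem comb_add (hV : V ≤ U) (e : Fin r → Sec G U) (a b : Fin r → Fn n 𝕂 V) :
    comb hV e (fun i => a i + b i) = comb hV e a + comb hV e b := by
  simp only [comb, add_smul, Finset.sum_add_distrib]

theorem comb_smul (hV : V ≤ U) (e : Fin r → Sec G U) (f : Fn n 𝕂 V) (a : Fin r → Fn n 𝕂 V) :
    comb hV e (fun i => f * a i) = f • comb hV e a := by
  simp only [comb, mul_smul, Finset.smul_sum]

theorem comb_sum {ι : Type*} (s : Finset ι) (hV : V ≤ U) (e : Fin r → Sec G U)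
    (a : ι → Fin r → Fn n 𝕂 V) :
    comb hV e (fun i => ∑ l ∈ s, a l i) = ∑ l ∈ s, comb hV e (a l) := by
  simp only [comb, Finset.sum_smul]
  exact Finset.sum_comm

/-- A combination of combinations. -/
theorem comb_comb {q : ℕ} (hV : V ≤ U) (h : W ≤ V) (e : Fin r → Sec G U)
    (b : Fin q → Fin r → Fn n 𝕂 V) (a : Fin q → Fn n 𝕂 W) :
    comb h (fun j => comb hV e (b j)) a =
      comb (h.trans hV) e (fun i => ∑ j, a j * resFn h (b j i)) := by
  rw [comb_sum]
  simp only [comb_smul]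
  rw [comb]
  simp only [res_comb]
  rfl

/-- Smooth functions that agree on overlaps glue. -/
theorem exists_fn_glue (W : V → Opens X) (hW : ∀ x, W x ≤ V) (hx : ∀ x : V, (x : X) ∈ W x)
    (a : ∀ x, Fn n 𝕂 (W x))
    (ha : ∀ (x y : V) (z : X) (h₁ : z ∈ W x) (h₂ : z ∈ W y), a x ⟨z, h₁⟩ = a y ⟨z, h₂⟩) :
    ∃ f : Fn n 𝕂 V, ∀ x, resFn (hW x) f = a x := by
  let f : V → 𝕂 := fun y => a y ⟨y, hx y⟩
  have hf : ∀ (x : V) (z : W x), f ⟨z, hW x z.2⟩ = a x z := fun x z => ha _ _ _ _ _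
  refine ⟨⟨f, fun x => (contMDiffAt_extFn_iff f x).1 ?_⟩, fun x => ContMDiffMap.ext fun z => hf x z⟩
  refine ((a x).contMDiffAt_ext ⟨x, hx x⟩).congr_of_eventuallyEq ?_
  filter_upwards [(W x).isOpen.mem_nhds (hx x)] with z hz
  exact (extFn_of_mem f ⟨z, hW x hz⟩).trans ((hf x ⟨z, hz⟩).trans (extFn_of_mem (a x) ⟨z, hz⟩).symm)

theorem fn_eq_of_locally {f g : Fn n 𝕂 V}
    (h : ∀ x ∈ V, ∃ (W : Opens X) (hW : W ≤ V), x ∈ W ∧ resFn hW f = resFn hW g) : f = g := by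
  refine ContMDiffMap.ext fun x => ?_
  obtain ⟨W, hW, hx, he⟩ := h x x.2
  exact congrArg (fun k : Fn n 𝕂 W => k ⟨x, hx⟩) he

theorem sec_eq_of_locally {s t : Sec G V}
    (h : ∀ x ∈ V, ∃ (W : Opens X) (hW : W ≤ V), x ∈ W ∧ res G hW s = res G hW t) : s = t := by
  choose W hW hx he using fun x : V => h x x.2
  refine sec_ext G W hW (fun x hxV => ?_) he
  exact Opens.mem_iSup.2 ⟨⟨x, hxV⟩, hx ⟨x, hxV⟩⟩

/-- Finitely many local properties hold on a common neighbourhood. -/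
theorem exists_common_nhd {ι : Type*} [Finite ι] {x : X} (hx : x ∈ V)
    (P : ι → ∀ W : Opens X, W ≤ V → Prop)
    (mono : ∀ i W W' (hW : W ≤ V) (h : W' ≤ W), P i W hW → P i W' (h.trans hW))
    (h : ∀ i, ∃ (W : Opens X) (hW : W ≤ V), x ∈ W ∧ P i W hW) :
    ∃ (W : Opens X) (hW : W ≤ V), x ∈ W ∧ ∀ i, P i W hW := by
  choose W hW hxW hP using h
  let W₀ : Opens X := ⟨⋂ i, (W i : Set X), isOpen_iInter_of_finite fun i => (W i).isOpen⟩
  have hle : ∀ i, W₀ ⊓ V ≤ W i := fun i => inf_le_left.trans (Set.iInter_subset _ i)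
  exact ⟨W₀ ⊓ V, inf_le_right, ⟨Set.mem_iInter.2 hxW, hx⟩, fun i =>
    mono i (W i) _ (hW i) (hle i) (hP i)⟩

/-- A function that does not vanish at a point is invertible near that point. -/
theorem exists_inverse_near (f : Fn n 𝕂 V) {x : X} (hx : x ∈ V) (h0 : f ⟨x, hx⟩ ≠ 0) :
    ∃ (W : Opens X) (hW : W ≤ V) (u : Fn n 𝕂 W), x ∈ W ∧ u * resFn hW f = 1 := by
  let W : Opens X := ⟨Subtype.val '' {y : V | f y ≠ 0}, V.isOpen.isOpenMap_subtype_val _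
    (isOpen_ne_fun f.contMDiff.continuous continuous_const)⟩
  have hW : W ≤ V := by rintro _ ⟨y, _, rfl⟩; exact y.2
  have hne : ∀ y : W, resFn hW f y ≠ 0 := by
    rintro ⟨_, y, hy, rfl⟩; exact hy
  refine ⟨W, hW, ⟨fun y => (resFn hW f y)⁻¹, fun y => ?_⟩, ⟨⟨x, hx⟩, h0, rfl⟩,
    ContMDiffMap.ext fun y => inv_mul_cancel₀ (hne y)⟩
  have h1 : ContDiffAt ℝ ∞ (fun z : 𝕂 => z⁻¹) (resFn hW f y) := contDiffAt_inv ℝ (hne y)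
  exact h1.contMDiffAt.comp y ((resFn hW f).contMDiff y)

end CombLemmas

section NablaComb
variable {n : ℕ} {𝕂 : Type} [RCLike 𝕂] {X : Type u} [TopologicalSpace X]
  [ChartedSpace (EuclideanSpace ℝ (Fin n)) X] [IsManifold (𝓡 n) ∞ X]
  {G : SheafOfModules.{u} (smoothRing n 𝕂 X)} (D : Connection G) {U V W : Opens X} {r : ℕ}

namespace Connection

theorem nabla_zero (ξ : VF n U) : D.nabla ξ (0 : Sec G U) = 0 := (D.nablaLM U ξ).map_zero

theorem nabla_sum {ι : Type*} (s : Finset ι) (ξ : VF n U) (g : ι → Sec G U) :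
    D.nabla ξ (∑ i ∈ s, g i) = ∑ i ∈ s, D.nabla ξ (g i) := map_sum (D.nablaLM U ξ) g s

theorem nabla_comb (hV : V ≤ U) (ξ : VF n V) (e : Fin r → Sec G U) (a : Fin r → Fn n 𝕂 V) :
    D.nabla ξ (comb hV e a) = comb hV e (fun i => ξ.deriv (a i)) +
      comb le_rfl (fun i => D.nabla ξ (res G hV (e i))) a := by
  rw [comb_le_rfl, comb, nabla_sum, comb, ← Finset.sum_add_distrib]
  exact Finset.sum_congr rfl fun i _ => by rw [nabla_smul, add_comm]

end Connection
end NablaComb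

/-! ### Finite presentations, and local freeness in the presence of a connection -/

section Presentation
variable {n : ℕ} {𝕂 : Type} [RCLike 𝕂] {X : Type u} [TopologicalSpace X]
  [ChartedSpace (EuclideanSpace ℝ (Fin n)) X] {G : SheafOfModules.{u} (smoothRing n 𝕂 X)}
  {U V W : Opens X} {r q : ℕ}

/-- The sections `e_i` generate `G` over `U`, as a sheaf. -/
def Generates (e : Fin r → Sec G U) : Prop :=
  ∀ (V : Opens X) (hV : V ≤ U) (g : Sec G V), ∀ x ∈ V,
    ∃ (W : Opens X) (hW : W ≤ V) (a : Fin r → Fn n 𝕂 W), x ∈ W ∧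
      comb (hW.trans hV) e a = res G hW g

/-- The sections `e_i` generate `G` over `U`, and the rows of the matrix `A` generate the sheaf of
relations between them. -/
structure IsPresentation (e : Fin r → Sec G U) (A : Fin q → Fin r → Fn n 𝕂 U) : Prop where
  gen : Generates e
  relation : ∀ j, comb le_rfl e (A j) = 0
  rel : ∀ (V : Opens X) (hV : V ≤ U) (a : Fin r → Fn n 𝕂 V), comb hV e a = 0 → ∀ x ∈ V,
    ∃ (W : Opens X) (hW : W ≤ V) (b : Fin q → Fn n 𝕂 W), x ∈ W ∧
      ∀ i, resFn hW (a i) = ∑ j, b j * resFn (hW.trans hV) (A j i)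

theorem FreeResolution.isPresentation (R : FreeResolution G U) :
    IsPresentation R.aug (fun j i => R.map 0 i j) where
  gen := R.aug_surjective
  relation j := by
    refine (R.exact_aug U le_rfl _).2 fun x hx => ⟨U, le_rfl, Pi.single j 1, hx, ?_⟩
    funext i
    simp only [actOn, resVec]
    rw [Finset.sum_eq_single j]
    · rw [Pi.single_eq_same, mul_one]
    · intro l _ hl
      rw [Pi.single_eq_of_ne hl, mul_zero]
    · simp
  rel V hV a ha x hx := by
    obtain ⟨W, hW, b, hxW, hb⟩ := (R.exact_aug V hV a).1 ha x hx
    refine ⟨W, hW, b, hxW, fun i => ?_⟩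
    have := congrFun hb i
    simp only [actOn, resVec] at this
    rw [← this]
    exact Finset.sum_congr rfl fun j _ => mul_comm _ _

theorem Generates.restrict {e : Fin r → Sec G U} (he : Generates e) (h : W ≤ U) :
    Generates (fun i => res G h (e i)) := by
  intro V hV g x hx
  obtain ⟨W', hW', a, hx', ha⟩ := he V (hV.trans h) g x hx
  exact ⟨W', hW', a, hx', by rw [comb_res, ha]⟩

theorem IsPresentation.restrict {e : Fin r → Sec G U} {A : Fin q → Fin r → Fn n 𝕂 U}
    (P : IsPresentation e A) (h : W ≤ U) :
    IsPresentation (fun i => res G h (e i)) (fun j i => resFn h (A j i)) where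
  gen := P.gen.restrict h
  relation j := by
    have := congrArg (res G h) (P.relation j)
    rw [res_comb, map_zero] at this
    rw [comb_res]
    exact this
  rel V hV a ha x hx := by
    rw [comb_res] at ha
    exact P.rel V (hV.trans h) a ha x hx

/-- Generators without relations form a frame. -/
theorem IsPresentation.isFrame {e : Fin r → Sec G U} {A : Fin q → Fin r → Fn n 𝕂 U}
    (P : IsPresentation e A) (hA : ∀ j i, A j i = 0) : IsFrame e := by
  have inj : ∀ (V : Opens X) (hV : V ≤ U) (a : Fin r → Fn n 𝕂 V), comb hV e a = 0 →
      ∀ i, a i = 0 := by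
    intro V hV a ha i
    refine fn_eq_of_locally fun x hx => ?_
    obtain ⟨W, hW, b, hxW, hb⟩ := P.rel V hV a ha x hx
    refine ⟨W, hW, hxW, ?_⟩
    rw [hb i, map_zero]
    exact Finset.sum_eq_zero fun j _ => by rw [hA, map_zero, mul_zero]
  have inj' : ∀ (V : Opens X) (hV : V ≤ U) (a b : Fin r → Fn n 𝕂 V),
      comb hV e a = comb hV e b → a = b := by
    intro V hV a b hab
    funext i
    exact sub_eq_zero.1 (inj V hV (fun i => a i - b i) (by rw [comb_sub, hab, sub_self]) i)
  intro V hV g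
  -- the local coefficients are unique, so they glue
  choose W hW a hx ha using fun x : V => P.gen V hV g x x.2
  have glue : ∀ i, ∃ f : Fn n 𝕂 V, ∀ x, resFn (hW x) f = a x i := by
    intro i
    refine exists_fn_glue W hW hx (fun x => a x i) fun x y z h₁ h₂ => ?_
    have h1 : (W x ⊓ W y) ≤ W x := inf_le_left
    have h2 : (W x ⊓ W y) ≤ W y := inf_le_right
    have := inj' _ ((h1.trans (hW x)).trans hV) (resVec h1 (a x)) (resVec h2 (a y)) (by
      rw [← res_comb ((hW x).trans hV) h1, ← res_comb ((hW y).trans hV) h2, ha, ha, res_res,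
        res_res])
    exact congrArg (fun k : Fn n 𝕂 (W x ⊓ W y : Opens X) => k ⟨z, h₁, h₂⟩) (congrFun this i)
  choose f hf using glue
  have hfg : comb hV e f = g := by
    refine sec_eq_of_locally fun x hx' => ⟨W ⟨x, hx'⟩, hW _, hx ⟨x, hx'⟩, ?_⟩
    rw [res_comb, ← ha]
    congr 1
    funext i
    exact hf i _
  exact ⟨f, hfg, fun b hb => inj' V hV b f (hb.trans hfg.symm)⟩

/-- Elimination of the generator `i₀` by a relation in which its coefficient is a unit. -/
theorem IsPresentation.eliminate {e : Fin (r + 1) → Sec G U} {A : Fin q → Fin (r + 1) → Fn n 𝕂 U}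
    (P : IsPresentation e A) (j₀ : Fin q) (i₀ : Fin (r + 1)) (u : Fn n 𝕂 U)
    (hu : u * A j₀ i₀ = 1) :
    IsPresentation (fun i => e (i₀.succAbove i))
      (fun j i => A j (i₀.succAbove i) - A j i₀ * u * A j₀ (i₀.succAbove i)) := by
  -- subtracting `a i₀ * u` times the relation `A j₀` removes the generator `e i₀`
  have key : ∀ (V : Opens X) (hV : V ≤ U) (a : Fin (r + 1) → Fn n 𝕂 V),
      comb hV (fun i => e (i₀.succAbove i))
        (fun i => a (i₀.succAbove i) - a i₀ * resFn hV u * resFn hV (A j₀ (i₀.succAbove i))) =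
      comb hV e a := by
    intro V hV a
    have h1 : comb hV e (fun i => a i - a i₀ * resFn hV u * resFn hV (A j₀ i)) = comb hV e a := by
      have h2 := congrArg (res G hV) (P.relation j₀)
      rw [res_comb, map_zero] at h2
      rw [comb_sub, comb_smul]
      change _ - _ • comb hV e (resVec hV (A j₀)) = _
      rw [h2, smul_zero, sub_zero]
    rw [← h1]
    have hu' : resFn hV u * resFn hV (A j₀ i₀) = 1 := by rw [← map_mul, hu, map_one]
    conv_rhs => rw [comb, Fin.sum_univ_succAbove _ i₀]
    rw [mul_assoc, hu', mul_one, sub_self, zero_smul, zero_add]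
    rfl
  refine ⟨fun V hV g x hx => ?_, fun j => ?_, fun V hV a ha x hx => ?_⟩
  · obtain ⟨W, hW, a, hxW, ha⟩ := P.gen V hV g x hx
    exact ⟨W, hW, _, hxW, (key W (hW.trans hV) a).trans ha⟩
  · exact (key U le_rfl (A j)).trans (P.relation j)
  · -- a relation between the other generators is one in which `e i₀` has coefficient zero; that
    -- equation makes the correction terms cancel
    obtain ⟨W, hW, b, hxW, hb⟩ := P.rel V hV (i₀.insertNth 0 a) (by
      rw [comb, Fin.sum_univ_succAbove _ i₀]
      simp only [Fin.insertNth_apply_same, Fin.insertNth_apply_succAbove, zero_smul, zero_add]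
      exact ha) x hx
    refine ⟨W, hW, b, hxW, fun i => ?_⟩
    have h0 := hb i₀
    have h1 := hb (i₀.succAbove i)
    simp only [Fin.insertNth_apply_same, Fin.insertNth_apply_succAbove, map_zero] at h0 h1
    rw [h1]
    simp only [map_sub, map_mul, mul_sub, Finset.sum_sub_distrib]
    have : ∑ j, b j * (resFn (hW.trans hV) (A j i₀) * resFn (hW.trans hV) u *
        resFn (hW.trans hV) (A j₀ (i₀.succAbove i))) =
        (∑ j, b j * resFn (hW.trans hV) (A j i₀)) * (resFn (hW.trans hV) u *
          resFn (hW.trans hV) (A j₀ (i₀.succAbove i))) := by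
      rw [Finset.sum_mul]
      exact Finset.sum_congr rfl fun j _ => by ring
    rw [this, ← h0, zero_mul, sub_zero]

end Presentation

theorem eq_sum_single {n : ℕ} (v : EuclideanSpace ℝ (Fin n)) :
    v = ∑ a, v a • EuclideanSpace.single a (1 : ℝ) := by
  ext b
  simp [Finset.sum_apply, Pi.single_apply]

/-- A matrix of functions that vanishes at the origin and satisfies a homogeneous linear
differential equation along each coordinate direction vanishes near the origin. -/
theorem eventually_eq_zero_of_fderiv_eq {n q r : ℕ} {𝕂 : Type} [RCLike 𝕂]
    (A : Fin q → Fin r → EuclideanSpace ℝ (Fin n) → 𝕂)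
    (b : Fin n → Fin q → Fin q → EuclideanSpace ℝ (Fin n) → 𝕂)
    (c : Fin n → Fin r → Fin r → EuclideanSpace ℝ (Fin n) → 𝕂)
    (hA : ∀ j i, ∀ᶠ y in nhds 0, DifferentiableAt ℝ (A j i) y)
    (hb : ∀ a j l, ContinuousAt (b a j l) 0) (hc : ∀ a l i, ContinuousAt (c a l i) 0)
    (h0 : ∀ j i, A j i 0 = 0)
    (h : ∀ a j i, ∀ᶠ y in nhds 0, fderiv ℝ (A j i) y (EuclideanSpace.single a 1) =
      (∑ l, b a j l y * A l i y) - ∑ l, A j l y * c a l i y) :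
    ∀ᶠ y in nhds 0, ∀ j i, A j i y = 0 := by
  -- a common bound of the coefficients near the origin
  let M : ℝ := 1 + (∑ a, ∑ j, ∑ l, ‖b a j l 0‖) + ∑ a, ∑ l, ∑ i, ‖c a l i 0‖
  have hbM : ∀ a j l, ‖b a j l 0‖ < M := by
    intro a j l
    have h1 : ‖b a j l 0‖ ≤ ∑ a, ∑ j, ∑ l, ‖b a j l 0‖ :=
      ((Finset.single_le_sum (f := fun l => ‖b a j l 0‖) (fun _ _ => norm_nonneg _)
        (Finset.mem_univ l)).trans (Finset.single_le_sum (f := fun j => ∑ l, ‖b a j l 0‖)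
        (fun _ _ => by positivity) (Finset.mem_univ j))).trans
        (Finset.single_le_sum (f := fun a => ∑ j, ∑ l, ‖b a j l 0‖)
        (fun _ _ => by positivity) (Finset.mem_univ a))
    have h2 : 0 ≤ ∑ a, ∑ l, ∑ i, ‖c a l i 0‖ := by positivity
    simp only [M]; linarith
  have hcM : ∀ a l i, ‖c a l i 0‖ < M := by
    intro a j l
    have h1 : ‖c a j l 0‖ ≤ ∑ a, ∑ j, ∑ l, ‖c a j l 0‖ :=
      ((Finset.single_le_sum (f := fun l => ‖c a j l 0‖) (fun _ _ => norm_nonneg _)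
        (Finset.mem_univ l)).trans (Finset.single_le_sum (f := fun j => ∑ l, ‖c a j l 0‖)
        (fun _ _ => by positivity) (Finset.mem_univ j))).trans
        (Finset.single_le_sum (f := fun a => ∑ j, ∑ l, ‖c a j l 0‖)
        (fun _ _ => by positivity) (Finset.mem_univ a))
    have h2 : 0 ≤ ∑ a, ∑ j, ∑ l, ‖b a j l 0‖ := by positivity
    simp only [M]; linarith
  have ev : ∀ᶠ y in nhds (0 : EuclideanSpace ℝ (Fin n)),
      (∀ j i, DifferentiableAt ℝ (A j i) y) ∧ (∀ a j l, ‖b a j l y‖ < M) ∧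
      (∀ a l i, ‖c a l i y‖ < M) ∧ ∀ a j i, fderiv ℝ (A j i) y (EuclideanSpace.single a 1) =
      (∑ l, b a j l y * A l i y) - ∑ l, A j l y * c a l i y := by
    simp only [Filter.eventually_and, Filter.eventually_all]
    exact ⟨hA, fun a j l => (hb a j l).norm.eventually_lt_const (hbM a j l),
      fun a j l => (hc a j l).norm.eventually_lt_const (hcM a j l), h⟩
  obtain ⟨ρ, hρ, hev⟩ := Metric.eventually_nhds_iff_ball.1 ev
  have hd : ∀ y ∈ Metric.ball (0 : EuclideanSpace ℝ (Fin n)) ρ,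
      HasFDerivAt (fun y j i => A j i y)
        (ContinuousLinearMap.pi fun j => ContinuousLinearMap.pi fun i => fderiv ℝ (A j i) y) y :=
    fun y hy => hasFDerivAt_pi.2 fun j => hasFDerivAt_pi.2 fun i =>
      ((hev y hy).1 j i).hasFDerivAt
  have key := eq_zero_of_norm_fderiv_le (a := fun y j i => A j i y) (ρ := ρ)
    (K := n * (q + r) * M) (fun y hy => (hd y hy).differentiableAt)
    (funext fun j => funext fun i => h0 j i) (fun y hy v => by
      rw [(hd y hy).fderiv]
      obtain ⟨-, hb', hc', h'⟩ := hev y hy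
      have hMnn : 0 ≤ M := by
        simp only [M]; positivity
      have hn : ∀ j i, ‖A j i y‖ ≤ ‖fun j i => A j i y‖ := fun j i =>
        (norm_le_pi_norm (fun i => A j i y) i).trans (norm_le_pi_norm (fun j i => A j i y) j)
      refine (pi_norm_le_iff_of_nonneg (by positivity)).2 fun j =>
        (pi_norm_le_iff_of_nonneg (by positivity)).2 fun i => ?_
      change ‖fderiv ℝ (A j i) y v‖ ≤ _
      conv_lhs => rw [eq_sum_single v, map_sum]
      have hterm : ∀ a, ‖fderiv ℝ (A j i) y (v a • EuclideanSpace.single a (1 : ℝ))‖ ≤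
          ‖v‖ * ((q + r) * M * ‖fun j i => A j i y‖) := by
        intro a
        rw [map_smul, norm_smul, h']
        refine mul_le_mul (PiLp.norm_apply_le v a) ?_ (norm_nonneg _) (norm_nonneg _)
        refine (norm_sub_le _ _).trans ?_
        have h1 : ‖∑ l, b a j l y * A l i y‖ ≤ q * (M * ‖fun j i => A j i y‖) := by
          refine (norm_sum_le_of_le _ (f := fun l => b a j l y * A l i y)
            (n := fun _ => M * ‖fun j i => A j i y‖) fun l _ => ?_).trans (by simp)
          rw [norm_mul]
          exact mul_le_mul (hb' a j l).le (hn l i) (norm_nonneg _) hMnn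
        have h2 : ‖∑ l, A j l y * c a l i y‖ ≤ r * (M * ‖fun j i => A j i y‖) := by
          refine (norm_sum_le_of_le _ (f := fun l => A j l y * c a l i y)
            (n := fun _ => M * ‖fun j i => A j i y‖) fun l _ => ?_).trans (by simp)
          rw [norm_mul, mul_comm]
          exact mul_le_mul (hc' a l i).le (hn j l) (norm_nonneg _) hMnn
        linarith
      refine (norm_sum_le_of_le _ fun a _ => hterm a).trans (le_of_eq ?_)
      simp only [Finset.sum_const, Finset.card_univ, Fintype.card_fin, nsmul_eq_mul]
      ring)
  filter_upwards [Metric.ball_mem_nhds _ hρ] with y hy j i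
  exact congrFun (congrFun (key y hy) j) i

section Vanishing
variable {n : ℕ} {𝕂 : Type} [RCLike 𝕂] {X : Type u} [TopologicalSpace X]
  [ChartedSpace (EuclideanSpace ℝ (Fin n)) X] [IsManifold (𝓡 n) ∞ X]
  {G : SheafOfModules.{u} (smoothRing n 𝕂 X)} {U V W : Opens X} {r q : ℕ}
  {x₀ : X}

theorem zero_mem_cenImg (hV : x₀ ∈ V) : (0 : EuclideanSpace ℝ (Fin n)) ∈ cenImg x₀ V := by
  have := cen_mem_cenImg (n := n) (mem_cenDom_self (x₀ := x₀)) hV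
  rwa [cen_self] at this

theorem cenImg_mem_nhds (hV : x₀ ∈ V) :
    cenImg x₀ V ∈ nhds (0 : EuclideanSpace ℝ (Fin n)) :=
  isOpen_cenImg.mem_nhds (zero_mem_cenImg hV)

theorem loc_zero (hx : x₀ ∈ V) (f : V → 𝕂) :
    loc x₀ f (0 : EuclideanSpace ℝ (Fin n)) = f ⟨x₀, hx⟩ := by
  have := loc_cen (n := n) f ⟨x₀, hx⟩ mem_cenDom_self
  rwa [cen_self] at this

/-- A property of the points of a chart that holds near the origin holds on an open
neighbourhood of its centre. -/
theorem exists_opens_of_eventually (hx : x₀ ∈ V) {p : EuclideanSpace ℝ (Fin n) → Prop}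
    (hp : ∀ᶠ y in nhds 0, p y) :
    ∃ (W : Opens X) (_ : W ≤ V) (_ : W ≤ cenDom n x₀), x₀ ∈ W ∧ ∀ x ∈ W, p (cen x₀ x) := by
  have hc : ContinuousAt (cen (n := n) x₀) x₀ := (contMDiffAt_cen mem_cenDom_self).continuousAt
  have h1 : ∀ᶠ x in nhds x₀, p (cen x₀ x) := hc.eventually (by rwa [cen_self])
  obtain ⟨S, hS, hSo, hxS⟩ := mem_nhds_iff.1 h1
  exact ⟨⟨S, hSo⟩ ⊓ (V ⊓ cenDom n x₀), inf_le_right.trans inf_le_left,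
    inf_le_right.trans inf_le_right, ⟨hxS, hx, mem_cenDom_self⟩, fun x hx => hS hx.1⟩

theorem fderiv_loc_eq (h : V ≤ cenDom n x₀) (f : Fn n 𝕂 V) (v : EuclideanSpace ℝ (Fin n))
    {y : EuclideanSpace ℝ (Fin n)} (hy : y ∈ cenImg x₀ V) :
    fderiv ℝ (loc x₀ f) y v = loc x₀ ((coordVF h v).deriv f) y := by
  rw [loc_of_mem _ hy, deriv_eq_fderiv_loc h, hatVF_coordVF]
  change _ = fderiv ℝ (loc x₀ f) (cen x₀ (cenInv x₀ y)) v
  rw [cen_cenInv hy]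

theorem resFn_eq_zero_of_loc (hW : W ≤ V) (hd : W ≤ cenDom n x₀) (f : Fn n 𝕂 V)
    (hf : ∀ x ∈ W, loc x₀ f (cen (n := n) x₀ x) = 0) : resFn hW f = 0 := by
  refine ContMDiffMap.ext fun x => ?_
  rw [resFn_apply, ← loc_cen (n := n) f ⟨x, hW x.2⟩ (hd x.2)]
  exact hf x x.2

/-- The covariant derivatives of generators along the coordinate vector fields are combinations of
the generators. -/
theorem Generates.exists_nabla_eq_comb (D : Connection G) {e : Fin r → Sec G U}
    (he : Generates e) (hx₀ : x₀ ∈ U) :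
    ∃ (W : Opens X) (hW : W ≤ U) (hd : W ≤ cenDom n x₀)
      (c : Fin n → Fin r → Fin r → Fn n 𝕂 W), x₀ ∈ W ∧ ∀ a i, comb hW e (c a i) =
        D.nabla (coordVF hd (EuclideanSpace.single a 1)) (res G hW (e i)) := by
  have hxV : x₀ ∈ U ⊓ cenDom n x₀ := ⟨hx₀, mem_cenDom_self⟩
  obtain ⟨W₁, hW₁, hx₁, hc⟩ := exists_common_nhd (V := U ⊓ cenDom n x₀) hxV
    (fun (p : Fin n × Fin r) W hW => ∃ c : Fin r → Fn n 𝕂 W,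
      comb (hW.trans inf_le_left) e c =
        D.nabla (coordVF (hW.trans inf_le_right) (EuclideanSpace.single p.1 1))
          (res G (hW.trans inf_le_left) (e p.2)))
    (fun p W W' hW h ⟨c, hc⟩ => ⟨resVec h c, by
      rw [← res_comb (hW.trans inf_le_left) h, hc, D.res_nabla, res_res, resVF_coordVF]⟩)
    (fun p => by
      obtain ⟨W, hW, a, hxW, ha⟩ := he (U ⊓ cenDom n x₀) inf_le_left
        (D.nabla (coordVF inf_le_right (EuclideanSpace.single p.1 1))
          (res G inf_le_left (e p.2))) x₀ hxV
      exact ⟨W, hW, hxW, a, by rw [ha, D.res_nabla, res_res, resVF_coordVF]⟩)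
  choose c hc using fun (a : Fin n) (i : Fin r) => hc (a, i)
  exact ⟨W₁, hW₁.trans inf_le_left, hW₁.trans inf_le_right, c, hx₁, hc⟩

/-- The covariant derivative of a relation along a coordinate vector field is a relation. -/
theorem comb_deriv_add_eq_zero (D : Connection G) {e : Fin r → Sec G U} {a : Fin r → Fn n 𝕂 U}
    (ha : comb le_rfl e a = 0) (hW : W ≤ U) (ξ : VF n W) (c : Fin r → Fin r → Fn n 𝕂 W)
    (hc : ∀ i, comb hW e (c i) = D.nabla ξ (res G hW (e i))) :
    comb hW e (fun i => ξ.deriv (resFn hW (a i)) + ∑ l, resFn hW (a l) * c l i) = 0 := by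
  have h1 := congrArg (res G hW) ha
  rw [res_comb, map_zero] at h1
  have h2 := D.nabla_comb hW ξ e (resVec hW a)
  have h3 : (fun i => D.nabla ξ (res G hW (e i))) = fun l => comb hW e (c l) :=
    funext fun l => (hc l).symm
  rw [h3, comb_comb hW le_rfl, ← comb_add] at h2
  exact h2.symm.trans ((congrArg (D.nabla _) h1).trans (D.nabla_zero _))

/-- The relations of a presentation satisfy, near each point, a homogeneous linear differential
equation: covariant differentiation turns relations into relations. -/
theorem IsPresentation.exists_deriv_eq (D : Connection G) {e : Fin r → Sec G U}
    {A : Fin q → Fin r → Fn n 𝕂 U} (P : IsPresentation e A) (hx₀ : x₀ ∈ U) :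
    ∃ (W : Opens X) (hW : W ≤ U) (hd : W ≤ cenDom n x₀)
      (b : Fin n → Fin q → Fin q → Fn n 𝕂 W) (c : Fin n → Fin r → Fin r → Fn n 𝕂 W), x₀ ∈ W ∧
      ∀ a j i, (coordVF hd (EuclideanSpace.single a 1)).deriv (resFn hW (A j i)) =
        (∑ l, b a j l * resFn hW (A l i)) - ∑ l, resFn hW (A j l) * c a l i := by
  obtain ⟨W₁, hU₁, hd₁, c, hx₁, hc⟩ := P.gen.exists_nabla_eq_comb D hx₀
  obtain ⟨W₂, hW₂, hx₂, hb⟩ := exists_common_nhd (V := W₁) hx₁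
    (fun (p : Fin n × Fin q) W hW => ∃ b : Fin q → Fn n 𝕂 W, ∀ i,
      resFn hW ((coordVF hd₁ (EuclideanSpace.single p.1 1)).deriv (resFn hU₁ (A p.2 i)) +
        ∑ l, resFn hU₁ (A p.2 l) * c p.1 l i) = ∑ l, b l * resFn (hW.trans hU₁) (A l i))
    (fun p W W' hW h ⟨b, hb⟩ => ⟨resVec h b, fun i => by
      have := congrArg (resFn h) (hb i)
      rw [map_sum] at this
      simp only [map_mul] at this
      exact this⟩)
    (fun p => by
      obtain ⟨W, hW, b, hxW, hb⟩ := P.rel W₁ hU₁ _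
        (comb_deriv_add_eq_zero D (P.relation p.2) hU₁ _ (c p.1) (hc p.1)) x₀ hx₁
      exact ⟨W, hW, hxW, b, hb⟩)
  choose b hb using fun (a : Fin n) (j : Fin q) => hb (a, j)
  refine ⟨W₂, hW₂.trans hU₁, hW₂.trans hd₁, b, fun a l i => resFn hW₂ (c a l i), hx₂,
    fun a j i => ?_⟩
  have := hb a j i
  rw [map_add, resFn_deriv, resVF_coordVF, map_sum] at this
  simp only [map_mul] at this
  exact eq_sub_of_add_eq this

/-- If all relations of a presentation vanish at a point, they vanish near that point. -/
theorem IsPresentation.exists_res_eq_zero (D : Connection G) {e : Fin r → Sec G U}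
    {A : Fin q → Fin r → Fn n 𝕂 U} (P : IsPresentation e A) (hx₀ : x₀ ∈ U)
    (h0 : ∀ j i, A j i ⟨x₀, hx₀⟩ = 0) :
    ∃ (W : Opens X) (hW : W ≤ U), x₀ ∈ W ∧ ∀ j i, resFn hW (A j i) = 0 := by
  obtain ⟨V, hU, hd, b, c, hx, hA⟩ := P.exists_deriv_eq D hx₀
  have hcont : ∀ f : Fn n 𝕂 V, ContinuousAt (loc (n := n) x₀ f) 0 := fun f =>
    (differentiableAt_loc f (zero_mem_cenImg hx)).continuousAt
  have hz := eventually_eq_zero_of_fderiv_eq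
    (fun j i => loc (n := n) x₀ (resFn hU (A j i))) (fun a j l => loc x₀ (b a j l))
    (fun a l i => loc x₀ (c a l i))
    (fun j i => by
      filter_upwards [cenImg_mem_nhds hx] with y hy using differentiableAt_loc _ hy)
    (fun a j l => hcont _) (fun a l i => hcont _)
    (fun j i => (loc_zero hx _).trans (h0 j i))
    (fun a j i => by
      filter_upwards [cenImg_mem_nhds hx] with y hy
      rw [fderiv_loc_eq hd _ _ hy]
      simp only [loc_of_mem _ hy]
      have := congrArg (ContMDiffMap.evalRingHom (⟨cenInv x₀ y, hy.2⟩ : V)) (hA a j i)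
      rw [map_sub, map_sum, map_sum] at this
      simp only [map_mul] at this
      exact this)
  obtain ⟨W, hW, hWd, hxW, hA'⟩ := exists_opens_of_eventually hx hz
  refine ⟨W, hW.trans hU, hxW, fun j i => ?_⟩
  exact resFn_eq_zero_of_loc hW hWd _ fun x hx => hA' x hx j i

/-- In the presence of a connection, a finitely presented sheaf of modules is locally free: if a
coefficient of a relation is nonzero at the point, a generator can be eliminated; if none is, the
relations vanish near the point. -/
theorem IsPresentation.exists_frame {e : Fin r → Sec G U} {A : Fin q → Fin r → Fn n 𝕂 U}
    (D : Connection G) (P : IsPresentation e A) (hx₀ : x₀ ∈ U) :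
    ∃ (W : Opens X) (r' : ℕ) (e' : Fin r' → Sec G W), x₀ ∈ W ∧ IsFrame e' := by
  induction r generalizing U with
  | zero => exact ⟨U, 0, e, hx₀, P.isFrame fun j i => i.elim0⟩
  | succ r ih =>
    by_cases h0 : ∀ j i, A j i ⟨x₀, hx₀⟩ = 0
    · obtain ⟨W, hW, hxW, hA⟩ := P.exists_res_eq_zero D hx₀ h0
      exact ⟨W, r + 1, _, hxW, (P.restrict hW).isFrame hA⟩
    · push Not at h0
      obtain ⟨j₀, i₀, hne⟩ := h0
      obtain ⟨W, hW, u, hxW, hu⟩ := exists_inverse_near (A j₀ i₀) hx₀ hne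
      exact ih ((P.restrict hW).eliminate j₀ i₀ u hu) hxW

theorem Connection.isLocallyFree (D : Connection G) (hG : HasLocalFreeResolutions G) :
    IsLocallyFree G := by
  intro x
  obtain ⟨U, hx, ⟨R⟩⟩ := hG x
  exact R.isPresentation.exists_frame D hx

end Vanishing

/-! ### Parallel frames of a flat connection -/

section Cutoff
variable {E F : Type} [NormedAddCommGroup E] [NormedSpace ℝ E] [FiniteDimensional ℝ E]
  [NormedAddCommGroup F] [NormedSpace ℝ F]

/-- A smooth function on a neighbourhood of the origin agrees near the origin with a smooth function
on the whole space. -/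
theorem exists_contDiff_eq_near {f : E → F} {O : Set E} (hO : O ∈ nhds 0)
    (hf : ContDiffOn ℝ ∞ f O) :
    ∃ g : E → F, ContDiff ℝ ∞ g ∧ ∃ ρ > 0, Metric.ball 0 ρ ⊆ O ∧ ∀ y ∈ Metric.ball 0 ρ, g y = f y := by
  obtain ⟨ρ, hρ, hρO⟩ := Metric.mem_nhds_iff.1 hO
  let χ : ContDiffBump (0 : E) := ⟨ρ / 3, ρ / 2, by positivity, by linarith⟩
  have hsupp : tsupport χ ⊆ Metric.ball 0 ρ := by
    rw [χ.tsupport_eq]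
    exact Metric.closedBall_subset_ball (by simp [χ]; linarith)
  refine ⟨fun y => χ y • f y, ?_, ρ / 3, by positivity,
    (Metric.ball_subset_ball (by linarith)).trans hρO, fun y hy => ?_⟩
  · rw [contDiff_iff_contDiffAt]
    intro y
    by_cases hy : y ∈ tsupport χ
    · have h1 : ContDiffAt ℝ ∞ f y := (hf.mono hρO).contDiffAt
        (Metric.isOpen_ball.mem_nhds (hsupp hy))
      exact χ.contDiff.contDiffAt.smul h1
    · have h1 : (fun y => χ y • f y) =ᶠ[nhds y] fun _ => 0 := by
        filter_upwards [(isClosed_tsupport χ).isOpen_compl.mem_nhds hy] with z hz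
        rw [image_eq_zero_of_notMem_tsupport hz, zero_smul]
      exact contDiffAt_const.congr_of_eventuallyEq h1
  · have : χ y = 1 := χ.one_of_mem_closedBall (Metric.ball_subset_closedBall hy)
    simp [this]

end Cutoff

section Frobenius

theorem fderiv_linearMap_comp {E W V : Type} [NormedAddCommGroup E] [NormedSpace ℝ E]
    [NormedAddCommGroup W] [NormedSpace ℝ W] [FiniteDimensional ℝ W] [NormedAddCommGroup V]
    [NormedSpace ℝ V] (L : W →ₗ[ℝ] V) {g : E → W} {y : E} (hg : DifferentiableAt ℝ g y) (v : E) :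
    fderiv ℝ (fun y => L (g y)) y v = L (fderiv ℝ g y v) :=
  congrArg (fun K => K v)
    ((LinearMap.toContinuousLinearMap L).hasFDerivAt.comp y hg.hasFDerivAt).fderiv

theorem contDiff_linearMap_comp {E W V : Type} [NormedAddCommGroup E] [NormedSpace ℝ E]
    [NormedAddCommGroup W] [NormedSpace ℝ W] [FiniteDimensional ℝ W] [NormedAddCommGroup V]
    [NormedSpace ℝ V] (L : W →ₗ[ℝ] V) {g : E → W} (hg : ContDiff ℝ ∞ g) :
    ContDiff ℝ ∞ (fun y => L (g y)) :=
  (LinearMap.toContinuousLinearMap L).contDiff.comp hg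

/-- A matrix over `𝕂`, as a real endomorphism of `𝕂^r`. -/
def matCLM (r : ℕ) (𝕂 : Type) [RCLike 𝕂] :
    (Fin r → Fin r → 𝕂) →ₗ[ℝ] ((Fin r → 𝕂) →L[ℝ] (Fin r → 𝕂)) :=
  LinearMap.toContinuousLinearMap.toLinearMap ∘ₗ
    LinearMap.mk₂ ℝ (fun (M : Fin r → Fin r → 𝕂) (w : Fin r → 𝕂) m => ∑ l, M m l * w l)
      (fun M M' w => funext fun m => by simp [add_mul, Finset.sum_add_distrib])
      (fun c M w => funext fun m => by simp [Finset.smul_sum])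
      (fun M w w' => funext fun m => by simp [mul_add, Finset.sum_add_distrib])
      (fun c M w => funext fun m => by simp [Finset.smul_sum])

theorem matCLM_apply {r : ℕ} {𝕂 : Type} [RCLike 𝕂] (M : Fin r → Fin r → 𝕂) (w : Fin r → 𝕂)
    (m : Fin r) : matCLM r 𝕂 M w m = ∑ l, M m l * w l := rfl

theorem matCLM_mul_apply {r : ℕ} {𝕂 : Type} [RCLike 𝕂] (M N : Fin r → Fin r → 𝕂) (w : Fin r → 𝕂)
    (m : Fin r) : (matCLM r 𝕂 M * matCLM r 𝕂 N) w m = ∑ l, M m l * ∑ k, N l k * w k := rfl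

/-- The parallel transport of a Banach algebra valued connection form that is given by its
components. -/
theorem exists_parallel_of_flat_coord {n : ℕ} {A : Type} [NormedRing A] [NormedAlgebra ℝ A]
    [CompleteSpace A] (g : Fin n → EuclideanSpace ℝ (Fin n) → A) (hga : ∀ a, ContDiff ℝ ∞ (g a))
    {ρ : ℝ} (hρ : 0 < ρ)
    (hkey : ∀ y ∈ Metric.ball (0 : EuclideanSpace ℝ (Fin n)) ρ, ∀ a b,
      fderiv ℝ (g a) y (EuclideanSpace.single b 1) + g b y * g a y =
      fderiv ℝ (g b) y (EuclideanSpace.single a 1) + g a y * g b y) :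
    ∃ (N : Set (EuclideanSpace ℝ (Fin n))) (S : EuclideanSpace ℝ (Fin n) → A), IsOpen N ∧ 0 ∈ N ∧
      ContDiffOn ℝ ∞ S N ∧ S 0 = 1 ∧
      ∀ y ∈ N, ∀ a, fderiv ℝ S y (EuclideanSpace.single a 1) = -(g a y * S y) := by
  have hgd : ∀ a y, DifferentiableAt ℝ (g a) y := fun a y =>
    (hga a).contDiffAt.differentiableAt (by simp)
  -- the connection form with components `g a`; its curvature is bilinear, so `hkey` suffices
  let Γ : EuclideanSpace ℝ (Fin n) → EuclideanSpace ℝ (Fin n) →L[ℝ] A :=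
    fun y => ∑ a, ContinuousLinearMap.smulRightL ℝ _ _ (EuclideanSpace.proj a) (g a y)
  have hΓ : ContDiff ℝ ∞ Γ := ContDiff.sum fun a _ =>
    (ContinuousLinearMap.smulRightL ℝ (EuclideanSpace ℝ (Fin n)) A
      (EuclideanSpace.proj a)).contDiff.comp (hga a)
  have hΓv : ∀ y v, Γ y v = ∑ a, v a • g a y := fun y v => by simp [Γ]
  have hΓd : ∀ y v w, fderiv ℝ Γ y v w = ∑ a, w a • fderiv ℝ (g a) y v := by
    intro y v w
    have h1 : HasFDerivAt (fun y => Γ y w) ((fderiv ℝ Γ y).flip w) y := by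
      have := (hΓ.contDiffAt.differentiableAt (x := y) (by simp)).hasFDerivAt.clm_apply
        (hasFDerivAt_const w y)
      simpa using this
    have h2 : HasFDerivAt (fun y => Γ y w) (∑ a, w a • fderiv ℝ (g a) y) y := by
      simp only [hΓv]
      exact HasFDerivAt.fun_sum fun a _ => (hgd a y).hasFDerivAt.const_smul (w a)
    have := congrArg (fun L => L v) (h1.unique h2)
    simpa using this
  obtain ⟨N, S, hN, h0N, hS, hS1, hSd⟩ := exists_parallel_of_flat hΓ hρ (fun y hy v w => by
    rw [hΓd, hΓd, hΓv, hΓv]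
    have e1 : ∀ v w : EuclideanSpace ℝ (Fin n),
        ∑ a, w a • fderiv ℝ (g a) y v = ∑ a, ∑ b, (w a * v b) •
          fderiv ℝ (g a) y (EuclideanSpace.single b 1) := by
      intro v w
      refine Finset.sum_congr rfl fun a _ => ?_
      conv_lhs => rw [eq_sum_single v, map_sum, Finset.smul_sum]
      exact Finset.sum_congr rfl fun b _ => by rw [map_smul, smul_smul]
    have e2 : ∀ v w : EuclideanSpace ℝ (Fin n), (∑ a, v a • g a y) * (∑ a, w a • g a y) =
        ∑ a, ∑ b, (v a * w b) • (g a y * g b y) := by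
      intro v w
      rw [Finset.sum_mul_sum]
      exact Finset.sum_congr rfl fun a _ => Finset.sum_congr rfl fun b _ => by
        rw [smul_mul_smul_comm]
    have c1 : ∑ a, v a • fderiv ℝ (g a) y w = ∑ a, ∑ b, (w a * v b) •
          fderiv ℝ (g b) y (EuclideanSpace.single a 1) := by
      rw [e1 w v, Finset.sum_comm]
      exact Finset.sum_congr rfl fun a _ => Finset.sum_congr rfl fun b _ => by rw [mul_comm]
    have c2 : (∑ a, v a • g a y) * (∑ a, w a • g a y) =
        ∑ a, ∑ b, (w a * v b) • (g b y * g a y) := by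
      rw [e2 v w, Finset.sum_comm]
      exact Finset.sum_congr rfl fun a _ => Finset.sum_congr rfl fun b _ => by rw [mul_comm]
    rw [e1 v w, c1, c2, e2 w v, ← Finset.sum_sub_distrib, ← Finset.sum_sub_distrib,
      ← Finset.sum_add_distrib]
    refine Finset.sum_eq_zero fun a _ => ?_
    rw [← Finset.sum_sub_distrib, ← Finset.sum_sub_distrib, ← Finset.sum_add_distrib]
    refine Finset.sum_eq_zero fun b _ => ?_
    rw [← smul_sub, ← smul_sub, ← smul_add, sub_add_sub_comm, hkey y hy a b, sub_self, smul_zero])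
  refine ⟨N, S, hN, h0N, hS, hS1, fun y hy a => ?_⟩
  rw [hSd y hy, hΓv, Finset.sum_eq_single a]
  · simp
  · intro b _ hb
    rw [PiLp.single_apply, if_neg hb, zero_smul]
  · simp

/-- The solution of the linear system `∂ₐ S + S cₐ = 0` with `S(0) = 1`, under the integrability
condition. -/
theorem exists_parallel_matrix {n r : ℕ} {𝕂 : Type} [RCLike 𝕂]
    (c : Fin n → Fin r → Fin r → EuclideanSpace ℝ (Fin n) → 𝕂)
    {O : Set (EuclideanSpace ℝ (Fin n))} (hO : O ∈ nhds 0)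
    (hc : ∀ a i l, ContDiffOn ℝ ∞ (c a i l) O)
    (hflat : ∀ y ∈ O, ∀ a b i m,
      fderiv ℝ (c a i m) y (EuclideanSpace.single b 1) + ∑ l, c a i l y * c b l m y =
      fderiv ℝ (c b i m) y (EuclideanSpace.single a 1) + ∑ l, c b i l y * c a l m y) :
    ∃ (N : Set (EuclideanSpace ℝ (Fin n))) (S : Fin r → Fin r → EuclideanSpace ℝ (Fin n) → 𝕂),
      IsOpen N ∧ 0 ∈ N ∧ (∀ i j, ContDiffOn ℝ ∞ (S i j) N) ∧
      (∀ i j, S i j 0 = if i = j then 1 else 0) ∧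
      ∀ y ∈ N, ∀ a j i, fderiv ℝ (S j i) y (EuclideanSpace.single a 1) +
        ∑ l, S j l y * c a l i y = 0 := by
  -- the coefficients are extended from a ball to the whole space, and transposed: the rows of `S`
  -- solve a system in which matrices act from the left
  obtain ⟨g, hg, ρ, hρ, hρO, hgc⟩ := exists_contDiff_eq_near
    (f := fun y a (m l : Fin r) => c a l m y) hO
    (contDiffOn_pi.2 fun a => contDiffOn_pi.2 fun m => contDiffOn_pi.2 fun l => hc a l m)
  have hga : ∀ a, ContDiff ℝ ∞ (fun y => g y a) := fun a => contDiff_pi.1 hg a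
  have hgd : ∀ a y, DifferentiableAt ℝ (fun y => g y a) y := fun a y =>
    (hga a).contDiffAt.differentiableAt (by simp)
  have hMd : ∀ a y v, fderiv ℝ (fun y => matCLM r 𝕂 (g y a)) y v =
      matCLM r 𝕂 (fderiv ℝ (fun y => g y a) y v) := by
    exact fun a y v => fderiv_linearMap_comp (W := Fin r → Fin r → 𝕂)
      (V := (Fin r → 𝕂) →L[ℝ] (Fin r → 𝕂)) (matCLM r 𝕂) (hgd a y) v
  have hent : ∀ y ∈ Metric.ball (0 : EuclideanSpace ℝ (Fin n)) ρ, ∀ a m l, ∀ v,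
      fderiv ℝ (fun y => g y a) y v m l = fderiv ℝ (c a l m) y v := by
    intro y hy a m l v
    have h1 := hasFDerivAt_pi'.1 (hasFDerivAt_pi'.1 (hgd a y).hasFDerivAt m) l
    have h2 : (fun y => g y a m l) =ᶠ[nhds y] c a l m := by
      filter_upwards [Metric.isOpen_ball.mem_nhds hy] with z hz
      rw [hgc z hz]
    rw [← h2.fderiv_eq, h1.fderiv]
    rfl
  obtain ⟨N, S, hN, h0N, hS, hS1, hSd⟩ := exists_parallel_of_flat_coord
    (fun a y => matCLM r 𝕂 (g y a)) (fun a => contDiff_linearMap_comp (W := Fin r → Fin r → 𝕂)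
      (V := (Fin r → 𝕂) →L[ℝ] (Fin r → 𝕂)) (matCLM r 𝕂) (hga a)) hρ (fun y hy a b => by
      rw [hMd, hMd]
      ext w m
      simp only [_root_.add_apply, matCLM_mul_apply, Pi.add_apply, matCLM_apply, hent y hy,
        hgc y hy, Finset.mul_sum]
      rw [Finset.sum_comm (f := fun x i => c b x m y * (c a i x y * w i)),
        Finset.sum_comm (f := fun x i => c a x m y * (c b i x y * w i)),
        ← Finset.sum_add_distrib, ← Finset.sum_add_distrib]
      refine Finset.sum_congr rfl fun l _ => ?_
      have h := congrArg (· * w l) (hflat y (hρO hy) a b l m)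
      simp only [add_mul, Finset.sum_mul] at h
      refine Eq.trans ?_ (h.trans ?_) <;>
      · congr 1
        exact Finset.sum_congr rfl fun k _ => by ring)
  have hN' : IsOpen (N ∩ Metric.ball 0 ρ) := hN.inter Metric.isOpen_ball
  have hSj : ∀ j, ContDiffOn ℝ ∞ (fun y => S y (Pi.single j 1)) (N ∩ Metric.ball 0 ρ) := fun j =>
    ContDiffOn.clm_apply (E := EuclideanSpace ℝ (Fin n)) (F := Fin r → 𝕂) (G := Fin r → 𝕂)
      (hS.mono Set.inter_subset_left) contDiffOn_const
  refine ⟨N ∩ Metric.ball 0 ρ, fun j i y => S y (Pi.single j 1) i, hN',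
    ⟨h0N, Metric.mem_ball_self hρ⟩, fun j i => contDiffOn_pi.1 (hSj j) i, fun i j => ?_,
    fun y hy a j i => ?_⟩
  · change S 0 (Pi.single i 1) j = _
    rw [hS1]
    change (Pi.single i (1 : 𝕂) : Fin r → 𝕂) j = _
    rw [Pi.single_apply]
    simp only [eq_comm]
  · have hd : DifferentiableAt ℝ S y :=
      (hS.contDiffAt (hN.mem_nhds hy.1)).differentiableAt (by simp)
    have h0 := HasFDerivAt.clm_apply (E := EuclideanSpace ℝ (Fin n)) (G := Fin r → 𝕂)
      (H := Fin r → 𝕂) hd.hasFDerivAt (hasFDerivAt_const (Pi.single j (1 : 𝕂)) y)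
    have h1 : fderiv ℝ (fun y => S y (Pi.single j 1) i) y (EuclideanSpace.single a 1) =
        fderiv ℝ S y (EuclideanSpace.single a 1) (Pi.single j 1) i := by
      rw [(hasFDerivAt_pi'.1 h0 i).fderiv]
      simp
    change fderiv ℝ (fun y => S y (Pi.single j 1) i) y (EuclideanSpace.single a 1) + _ = 0
    rw [h1, hSd y hy.1]
    change -(matCLM r 𝕂 (g y a) (S y (Pi.single j 1)) i) + _ = _
    rw [neg_add_eq_zero, matCLM_apply, hgc y hy.2]
    exact Finset.sum_congr rfl fun k _ => mul_comm _ _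

end Frobenius

section CoordForms
variable {n : ℕ} {𝕂 : Type} [RCLike 𝕂] {X : Type u} [TopologicalSpace X]
  [ChartedSpace (EuclideanSpace ℝ (Fin n)) X] [IsManifold (𝓡 n) ∞ X]
  {G : SheafOfModules.{u} (smoothRing n 𝕂 X)} {U V W : Opens X} {k r : ℕ} {x₀ : X}

/-- The coordinate vector fields form a basis of the module of vector fields. -/
def coordBasis (h : V ≤ cenDom n x₀) : Module.Basis (Fin n) (Fn n ℝ V) (VF n V) :=
  Module.Basis.ofEquivFun
    { toFun := fun ξ a => ξ.deriv (coordFn h a)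
      invFun := fun f => ∑ a, f a • coordVF h (EuclideanSpace.single a 1)
      map_add' := fun ξ η => funext fun a => ContMDiffMap.ext fun x => by
        change (ξ + η).deriv (coordFn h a) x = ξ.deriv (coordFn h a) x + η.deriv (coordFn h a) x
        simp only [deriv_coordFn, hatVF_add, PiLp.add_apply]
      map_smul' := fun f ξ => funext fun a => ContMDiffMap.ext fun x => by
        change (f • ξ).deriv (coordFn h a) x = f x * ξ.deriv (coordFn h a) x
        simp only [deriv_coordFn, hatVF_smul, PiLp.smul_apply, smul_eq_mul]
      left_inv := fun ξ => (eq_sum_coordVF h ξ).symm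
      right_inv := fun f => funext fun a => ContMDiffMap.ext fun x => by
        rw [deriv_coordFn, hatVF_sum]
        simp only [hatVF_smul, hatVF_coordVF]
        simp [Pi.single_apply] }

theorem coordBasis_apply (h : V ≤ cenDom n x₀) (a : Fin n) :
    coordBasis h a = coordVF h (EuclideanSpace.single a 1) := by
  rw [coordBasis, Module.Basis.coe_ofEquivFun]
  change ∑ b, (Pi.single a (1 : Fn n ℝ V) : Fin n → Fn n ℝ V) b • coordVF h _ = _
  rw [Finset.sum_eq_single a]
  · rw [Pi.single_eq_same, one_smul]
  · intro b _ hb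
    rw [Pi.single_eq_of_ne hb, zero_smul]
  · simp

/-- Forms on a chart domain agree if they agree on the coordinate vector fields. -/
theorem Form.ext_coord (h : U ≤ cenDom n x₀) {θ η : Form G k U}
    (hθ : ∀ I : Fin k → Fin n,
      θ.eval le_rfl (fun m => coordVF h (EuclideanSpace.single (I m) 1)) =
        η.eval le_rfl (fun m => coordVF h (EuclideanSpace.single (I m) 1))) : θ = η := by
  refine Form.ext fun V hV ξ => ?_
  have h1 : ∀ I : Fin k → Fin n, θ.eval hV (fun m => coordBasis (hV.trans h) (I m)) =
      η.eval hV (fun m => coordBasis (hV.trans h) (I m)) := by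
    intro I
    simp only [coordBasis_apply]
    have h2 := congrArg (res G hV) (hθ I)
    rw [Form.res_eval, Form.res_eval] at h2
    exact h2
  have h2 := Module.Basis.ext_multilinear (fun _ : Fin k => coordBasis (hV.trans h))
    (f := (θ.eval hV).toMultilinearMap) (g := (η.eval hV).toMultilinearMap) h1
  exact congrArg (fun β => β ξ) h2

namespace Connection
variable (D : Connection G)

theorem evalOne_coord_eq (h : U ≤ cenDom n x₀) {θ η : Form G 1 U}
    (hθ : ∀ a, evalOne θ (coordVF h (EuclideanSpace.single a 1)) =
      evalOne η (coordVF h (EuclideanSpace.single a 1))) : θ = η :=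
  Form.ext_coord h fun I => by
    have h1 : (fun m : Fin 1 => coordVF h (EuclideanSpace.single (I m) (1 : ℝ))) =
      fun _ => coordVF h (EuclideanSpace.single (I 0) 1) := by
      funext m; rw [Subsingleton.elim m 0]
    rw [h1]
    exact hθ (I 0)

/-- A section is parallel if its derivatives along the coordinate vector fields vanish. -/
theorem diff_eq_zero_iff (h : U ≤ cenDom n x₀) (g : Sec G U) :
    D.diff U g = 0 ↔ ∀ a, D.nabla (coordVF h (EuclideanSpace.single a 1)) g = 0 := by
  refine ⟨fun hg a => ?_, fun hg => evalOne_coord_eq h fun a => hg a⟩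
  rw [nabla, hg]
  rfl

/-- The Koszul formula on coordinate vector fields, whose brackets vanish. -/
theorem dForm_eval_coord (h : U ≤ cenDom n x₀) (θ : Form G k U)
    (v : Fin (k + 1) → EuclideanSpace ℝ (Fin n)) :
    (D.dForm k U θ).eval le_rfl (fun m => coordVF h (v m)) =
      ∑ i : Fin (k + 1), (-1 : ℤ) ^ (i : ℕ) • D.nabla (coordVF h (v i))
        (θ.eval le_rfl (fun m => coordVF h (i.removeNth v m))) := by
  change koszulSum _ _ (θ.eval le_rfl) _ = _
  rw [koszulSum]
  have hb : bracketSum (bracketLM U) (θ.eval le_rfl) (fun m => coordVF h (v m)) = 0 := by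
    cases k with
    | zero => rfl
    | succ k =>
      refine Finset.sum_eq_zero fun i _ => Finset.sum_eq_zero fun j _ => ?_
      have h0 : bracketLM U (coordVF h (v i.castSucc)) (coordVF h (v j.succ)) = 0 :=
        bracket_coordVF h _ _
      rw [h0, AlternatingMap.map_coord_zero _ (0 : Fin (k + 1)) rfl, smul_zero]
  rw [hb, sub_zero]
  rfl

theorem IsFlat.dForm_diff {D : Connection G} (hD : D.IsFlat) (U : Opens X) (g : Sec G U) :
    D.dForm 1 U (D.diff U g) = 0 :=
  congrArg (fun α : toAb G ⟶ formSheaf G 2 => (α.hom.app (op U)).hom g) hD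

/-- For a flat connection, covariant derivatives along coordinate vector fields commute. -/
theorem IsFlat.nabla_comm {D : Connection G} (hD : D.IsFlat) (h : U ≤ cenDom n x₀)
    (v w : EuclideanSpace ℝ (Fin n)) (g : Sec G U) :
    D.nabla (coordVF h v) (D.nabla (coordVF h w) g) =
      D.nabla (coordVF h w) (D.nabla (coordVF h v) g) := by
  have h1 := D.dForm_eval_coord h (D.diff U g) ![v, w]
  rw [hD.dForm_diff, Fin.sum_univ_two] at h1
  have e1 : (D.diff U g).eval le_rfl (fun m => coordVF h (Fin.removeNth 0 ![v, w] m)) =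
      D.nabla (coordVF h w) g := by
    rw [nabla, evalOne]
    congr 1
    funext m
    rw [Subsingleton.elim m 0]
    rfl
  have e2 : (D.diff U g).eval le_rfl (fun m => coordVF h (Fin.removeNth 1 ![v, w] m)) =
      D.nabla (coordVF h v) g := by
    rw [nabla, evalOne]
    congr 1
    funext m
    rw [Subsingleton.elim m 0]
    rfl
  rw [e1, e2] at h1
  have h2 : (0 : Form G 2 U).eval le_rfl (fun m => coordVF h (![v, w] m)) = 0 := rfl
  rw [h2] at h1
  simp only [Fin.val_zero, pow_zero, one_smul, Fin.val_one, pow_one, neg_smul, Matrix.cons_val_zero,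
    Matrix.cons_val_one] at h1
  exact (sub_eq_zero.1 ((sub_eq_add_neg _ _).trans h1.symm))

end Connection

theorem IsFrame.generates {e : Fin r → Sec G U} (he : IsFrame e) : Generates e := by
  intro V hV g x hx
  obtain ⟨a, ha, -⟩ := he V hV g
  exact ⟨V, le_rfl, a, hx, ha.trans (res_self G le_rfl g).symm⟩

theorem IsFrame.eq_of_comb_eq {e : Fin r → Sec G U} (he : IsFrame e) (hV : V ≤ U)
    {a b : Fin r → Fn n 𝕂 V} (h : comb hV e a = comb hV e b) : a = b :=
  (he V hV (comb hV e b)).unique h rfl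

/-- A frame remains a frame under a change of basis. -/
theorem IsFrame.change {e : Fin r → Sec G U} (he : IsFrame e) (hW : W ≤ U)
    (S T : Fin r → Fin r → Fn n 𝕂 W)
    (h1 : ∀ i j, ∑ l, T i l * S l j = if i = j then 1 else 0)
    (h2 : ∀ i j, ∑ l, S i l * T l j = if i = j then 1 else 0) :
    IsFrame (fun j => comb hW e (S j)) := by
  have aux : ∀ (P Q : Fin r → Fin r → Fn n 𝕂 W),
      (∀ i j, ∑ l, P i l * Q l j = if i = j then 1 else 0) →
      ∀ (V : Opens X) (hV : V ≤ W) (a : Fin r → Fn n 𝕂 V) (j : Fin r),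
        ∑ l, (∑ i, a i * resFn hV (P i l)) * resFn hV (Q l j) = a j := by
    intro P Q hPQ V hV a j
    simp only [Finset.sum_mul]
    rw [Finset.sum_comm]
    simp only [mul_assoc, ← Finset.mul_sum]
    have h3 : ∀ i, ∑ l, resFn hV (P i l) * resFn hV (Q l j) = if i = j then 1 else 0 := by
      intro i
      have := congrArg (resFn hV) (hPQ i j)
      rw [map_sum] at this
      simp only [map_mul] at this
      rw [this]
      split_ifs <;> simp
    simp [h3]
  intro V hV g
  obtain ⟨a, ha, hu⟩ := he V (hV.trans hW) g
  refine ⟨fun l => ∑ i, a i * resFn hV (T i l), ?_, fun b hb => ?_⟩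
  · change comb hV (fun j => comb hW e (S j)) _ = g
    rw [comb_comb hW hV, ← ha]
    congr 1
    funext j
    exact aux T S h1 V hV a j
  · change comb hV (fun j => comb hW e (S j)) b = g at hb
    rw [comb_comb hW hV] at hb
    have := hu _ hb
    funext l
    rw [← this]
    exact (aux S T h2 V hV b l).symm

/-- A family of combinations of a frame is a frame near a point where the matrix of coefficients is
the identity. -/
theorem IsFrame.exists_change {e : Fin r → Sec G U} (he : IsFrame e) (hW : W ≤ U) (hx : x₀ ∈ W)
    (S : Fin r → Fin r → Fn n 𝕂 W) (hS : ∀ i j, S i j ⟨x₀, hx⟩ = if i = j then 1 else 0) :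
    ∃ (W' : Opens X) (hW' : W' ≤ W), x₀ ∈ W' ∧
      IsFrame (fun j => comb (hW'.trans hW) e (resVec hW' (S j))) := by
  let M : Matrix (Fin r) (Fin r) (Fn n 𝕂 W) := Matrix.of S
  have hdet : M.det ⟨x₀, hx⟩ ≠ 0 := by
    have h1 : M.det ⟨x₀, hx⟩ = 1 := by
      have h2 := (ContMDiffMap.evalRingHom (⟨x₀, hx⟩ : W) :
        Fn n 𝕂 W →+* 𝕂).map_det M
      have h3 : (ContMDiffMap.evalRingHom (⟨x₀, hx⟩ : W) : Fn n 𝕂 W →+* 𝕂).mapMatrix M = 1 := by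
        ext i j
        rw [Matrix.one_apply]
        exact hS i j
      rw [h3, Matrix.det_one] at h2
      exact h2
    rw [h1]
    exact one_ne_zero
  obtain ⟨W', hW', u, hx', hu⟩ := exists_inverse_near M.det hx hdet
  let M' : Matrix (Fin r) (Fin r) (Fn n 𝕂 W') := (resFn hW').mapMatrix M
  have hM' : IsUnit M'.det := by
    refine IsUnit.of_mul_eq_one u ?_
    rw [mul_comm, ← hu, RingHom.map_det]
  refine ⟨W', hW', hx', he.change (hW'.trans hW) (fun i j => M' i j) (fun i j => M'⁻¹ i j)
    (fun i j => ?_) fun i j => ?_⟩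
  · rw [← Matrix.mul_apply, Matrix.nonsing_inv_mul _ hM', Matrix.one_apply]
  · rw [← Matrix.mul_apply, Matrix.mul_nonsing_inv _ hM', Matrix.one_apply]

/-- The integrability condition on the connection matrices of a flat connection. -/
theorem IsFrame.deriv_add_eq {D : Connection G} (hD : D.IsFlat) {e : Fin r → Sec G U}
    (he : IsFrame e) (hW : W ≤ U) (hd : W ≤ cenDom n x₀) (c : Fin n → Fin r → Fin r → Fn n 𝕂 W)
    (hc : ∀ a i, comb hW e (c a i) =
      D.nabla (coordVF hd (EuclideanSpace.single a 1)) (res G hW (e i))) (a b : Fin n) (i m : Fin r) :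
    (coordVF hd (EuclideanSpace.single b 1)).deriv (c a i m) + ∑ l, c a i l * c b l m =
      (coordVF hd (EuclideanSpace.single a 1)).deriv (c b i m) + ∑ l, c b i l * c a l m := by
  have key : ∀ a b, D.nabla (coordVF hd (EuclideanSpace.single b 1))
      (D.nabla (coordVF hd (EuclideanSpace.single a 1)) (res G hW (e i))) = comb hW e (fun m =>
        (coordVF hd (EuclideanSpace.single b 1)).deriv (c a i m) + ∑ l, c a i l * c b l m) := by
    intro a b
    have h3 : (fun i => D.nabla (coordVF hd (EuclideanSpace.single b 1)) (res G hW (e i))) =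
      fun l => comb hW e (c b l) := funext fun l => (hc b l).symm
    rw [← hc, D.nabla_comb, h3, comb_comb hW le_rfl, ← comb_add]
    rfl
  have h1 := (key a b).symm.trans ((hD.nabla_comm hd _ _ _).trans (key b a))
  exact congrFun (he.eq_of_comb_eq hW h1) m

/-- A flat connection on a locally free sheaf has a frame of parallel sections near each point. -/
theorem IsFrame.exists_parallel {D : Connection G} (hD : D.IsFlat) {e : Fin r → Sec G U}
    (he : IsFrame e) (hx : x₀ ∈ U) :
    ∃ (W : Opens X) (_ : W ≤ U) (_ : W ≤ cenDom n x₀) (s : Fin r → Sec G W), x₀ ∈ W ∧ IsFrame s ∧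
      ∀ j, D.diff W (s j) = 0 := by
  obtain ⟨W₁, hW₁, hd₁, c, hx₁, hc⟩ := he.generates.exists_nabla_eq_comb D hx
  have hcc := he.deriv_add_eq hD hW₁ hd₁ c hc
  -- the matrix `S` of the change of frame, in the chart
  obtain ⟨N, S, hN, h0N, hS, hS0, hSd⟩ := exists_parallel_matrix
    (fun a i l => loc (n := n) x₀ (c a i l)) (cenImg_mem_nhds hx₁)
    (fun a i l => contDiffOn_loc _) (fun y hy a b i m => by
      rw [fderiv_loc_eq hd₁ _ _ hy, fderiv_loc_eq hd₁ _ _ hy]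
      simp only [loc_of_mem _ hy]
      have := congrArg (ContMDiffMap.evalRingHom (⟨cenInv x₀ y, hy.2⟩ : W₁)) (hcc a b i m)
      rw [map_add, map_add, map_sum, map_sum] at this
      simp only [map_mul] at this
      exact this)
  obtain ⟨W₂, hW₂, hd₂, hx₂, hN₂⟩ := exists_opens_of_eventually (n := n) hx₁ (hN.mem_nhds h0N)
  have hsub : cenImg (n := n) x₀ W₂ ⊆ N := fun y hy => by
    have := hN₂ _ hy.2
    rwa [cen_cenInv hy] at this
  let s : Fin r → Fin r → Fn n 𝕂 W₂ := fun j i => ofLoc hd₂ (S j i) ((hS j i).mono hsub)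
  obtain ⟨W₃, hW₃, hx₃, hF⟩ := he.exists_change (hW₂.trans hW₁) hx₂ s (fun i j => by
    rw [ofLoc_apply]
    exact (congrArg (S i j) cen_self).trans (hS0 i j))
  refine ⟨W₃, hW₃.trans (hW₂.trans hW₁), hW₃.trans hd₂, _, hx₃, hF, fun j => ?_⟩
  -- the new sections are parallel: this is the differential equation for `S`
  have h4 : D.diff W₂ (comb (hW₂.trans hW₁) e (s j)) = 0 := by
    refine (D.diff_eq_zero_iff hd₂ _).2 fun a => ?_
    have h3 : (fun i => D.nabla (coordVF hd₂ (EuclideanSpace.single a 1))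
        (res G (hW₂.trans hW₁) (e i))) =
      fun l => comb (hW₂.trans hW₁) e (resVec hW₂ (c a l)) := funext fun l => by
        rw [← res_comb hW₁ hW₂, hc, D.res_nabla, res_res, resVF_coordVF]
    rw [D.nabla_comb, h3, comb_comb (hW₂.trans hW₁) le_rfl, ← comb_add,
      ← comb_zero (n := n) (hW₂.trans hW₁) e]
    congr 1
    funext i
    refine ContMDiffMap.ext fun x => ?_
    have hy := cen_mem_cenImg (n := n) (hd₂ x.2) x.2
    have h5 := hSd _ (hsub hy) a j i
    have h6 : loc (n := n) x₀ (s j i) =ᶠ[nhds (cen x₀ (x : X))] S j i := by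
      filter_upwards [isOpen_cenImg.mem_nhds hy] with z hz using loc_ofLoc hd₂ _ _ hz
    have h7 : ∀ l, loc (n := n) x₀ (c a l i) (cen x₀ (x : X)) = c a l i ⟨x, hW₂ x.2⟩ := fun l =>
      loc_cen (c a l i) ⟨x, hW₂ x.2⟩ (hd₂ x.2)
    simp only [h7] at h5
    have h8 := deriv_eq_fderiv_loc hd₂ (coordVF hd₂ (EuclideanSpace.single a 1)) (s j i) x
    rw [hatVF_coordVF, h6.fderiv_eq] at h8
    rw [← h8] at h5
    have h9 := map_sum (ContMDiffMap.evalRingHom x : Fn n 𝕂 W₂ →+* 𝕂)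
      (fun l => s j l * resFn le_rfl (resVec hW₂ (c a l) i)) Finset.univ
    refine Eq.trans ?_ h5
    exact congrArg (_ + ·) h9
  have h5 := D.diff_res hW₃ (comb (hW₂.trans hW₁) e (s j))
  rw [h4, map_zero, res_comb] at h5
  exact h5

end CoordForms

section LocalSystem
variable {n : ℕ} {𝕂 : Type} [RCLike 𝕂] {X : Type u} [TopologicalSpace X]
  [ChartedSpace (EuclideanSpace ℝ (Fin n)) X] [IsManifold (𝓡 n) ∞ X]
  {G : SheafOfModules.{u} (smoothRing n 𝕂 X)} {U V W : Opens X} {k r : ℕ} {x₀ : X}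

theorem isLocallyConstant_iff_extFn (f : V → 𝕂) :
    IsLocallyConstant f ↔ ∀ x : V, ∀ᶠ z in nhds (x : X), extFn f z = f x := by
  rw [IsLocallyConstant.iff_eventually_eq]
  refine forall_congr' fun x => ?_
  rw [← V.isOpen.isOpenEmbedding_subtypeVal.map_nhds_eq x, Filter.eventually_map]
  simp only [extFn_of_mem]
  rfl

/-- A function is locally constant if its coordinate derivatives vanish. -/
theorem isLocallyConstant_iff_deriv (h : V ≤ cenDom n x₀) (f : Fn n 𝕂 V) :
    IsLocallyConstant f ↔
      ∀ a, (coordVF h (EuclideanSpace.single a 1)).deriv f = 0 := by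
  rw [isLocallyConstant_iff_extFn]
  constructor
  · intro hf a
    refine ContMDiffMap.ext fun x => ?_
    have h1 : extFn f =ᶠ[nhds (x : X)] fun _ => f x := hf x
    rw [VF.deriv_apply, mvfderiv, h1.mfderiv_eq, mfderiv_const]
    rfl
  · intro hf x
    have hy := cen_mem_cenImg (n := n) (h x.2) x.2
    obtain ⟨ρ, hρ, hsub⟩ := Metric.isOpen_iff.1 isOpen_cenImg _ hy
    have hz : ∀ y ∈ cenImg (n := n) x₀ V, fderiv ℝ (loc x₀ f) y = 0 := by
      intro y hy
      have hb : ∀ a, fderiv ℝ (loc x₀ f) y (EuclideanSpace.single a 1) = 0 := by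
        intro a
        rw [fderiv_loc_eq h f _ hy, hf a, loc_of_mem _ hy]
        rfl
      ext v
      rw [eq_sum_single v, map_sum]
      simp [hb]
    have hc : ∀ y ∈ Metric.ball (cen (n := n) x₀ (x : X)) ρ, loc x₀ f y = f x := by
      intro y hyb
      rw [← loc_cen (n := n) f x (h x.2)]
      exact Metric.isOpen_ball.is_const_of_fderiv_eq_zero (𝕜 := ℝ)
        (convex_ball _ _).isPreconnected
        (fun z hz => (differentiableAt_loc f (hsub hz)).differentiableWithinAt)
        (fun z hz' => hz z (hsub hz')) hyb (Metric.mem_ball_self hρ)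
    have hcont : ContinuousAt (cen (n := n) x₀) (x : X) := (contMDiffAt_cen (h x.2)).continuousAt
    filter_upwards [hcont.preimage_mem_nhds (Metric.ball_mem_nhds _ hρ),
      (cenDom n x₀).isOpen.mem_nhds (h x.2)] with z hz hzd
    rw [← hc _ hz, loc, cenInv_cen hzd]

/-- The covariant derivative in a parallel frame. -/
theorem Connection.nabla_comb_of_parallel (D : Connection G) {s : Fin r → Sec G U}
    (hs : ∀ j, D.diff U (s j) = 0) (hV : V ≤ U) (ξ : VF n V) (a : Fin r → Fn n 𝕂 V) :
    D.nabla ξ (comb hV s a) = comb hV s (fun i => ξ.deriv (a i)) := by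
  have h1 : (fun i => D.nabla ξ (res G hV (s i))) = fun _ => 0 := funext fun i => by
    rw [Connection.nabla, D.diff_res, hs, map_zero]
    rfl
  have h2 : comb le_rfl (fun _ : Fin r => (0 : Sec G V)) a = 0 := by
    simp [comb]
  rw [D.nabla_comb, h1, h2, add_zero]

theorem IsFrame.diff_comb_eq_zero_iff (D : Connection G) {s : Fin r → Sec G U} (he : IsFrame s)
    (hd : U ≤ cenDom n x₀) (hs : ∀ j, D.diff U (s j) = 0) (hV : V ≤ U) (a : Fin r → Fn n 𝕂 V) :
    D.diff V (comb hV s a) = 0 ↔ ∀ i, IsLocallyConstant (a i) := by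
  rw [D.diff_eq_zero_iff (hV.trans hd)]
  simp only [isLocallyConstant_iff_deriv (hV.trans hd), D.nabla_comb_of_parallel hs]
  rw [forall_comm]
  refine forall_congr' fun b => ⟨fun h i => ?_, fun h => ?_⟩
  · exact congrFun (he.eq_of_comb_eq hV (h.trans (comb_zero hV s).symm)) i
  · simp only [h, comb_zero]

/-- A flat connection on a sheaf with local free resolutions has parallel frames. -/
theorem Connection.IsFlat.exists_parallel_frame {D : Connection G} (hD : D.IsFlat)
    (hG : HasLocalFreeResolutions G) (x : X) :
    ∃ (W : Opens X) (_ : W ≤ cenDom n x) (r : ℕ) (s : Fin r → Sec G W), x ∈ W ∧ IsFrame s ∧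
      ∀ j, D.diff W (s j) = 0 := by
  obtain ⟨U, r, e, hx, he⟩ := D.isLocallyFree hG x
  obtain ⟨W, -, hd, s, hxW, hs, hp⟩ := he.exists_parallel hD hx
  exact ⟨W, hd, r, s, hxW, hs, hp⟩

theorem Connection.IsFlat.isLocalSystem {D : Connection G} (hD : D.IsFlat)
    (hG : HasLocalFreeResolutions G) : D.IsLocalSystem := by
  intro x
  obtain ⟨W, hd, r, s, hxW, hs, hp⟩ := hD.exists_parallel_frame hG x
  exact ⟨W, r, s, hxW, hs, fun V hV a => hs.diff_comb_eq_zero_iff D hd hp hV a⟩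

theorem Connection.IsFlat.parallelGenerates {D : Connection G} (hD : D.IsFlat)
    (hG : HasLocalFreeResolutions G) : D.ParallelGenerates := by
  intro U g x hx
  obtain ⟨W, hd, r, s, hxW, hs, hp⟩ := hD.exists_parallel_frame hG x
  obtain ⟨a, ha, -⟩ := hs (W ⊓ U) inf_le_left (res G inf_le_right g)
  refine ⟨W ⊓ U, inf_le_right, r, fun i => res G inf_le_left (s i), a, ⟨hxW, hx⟩, fun i => ?_, ?_⟩
  · rw [D.diff_res, hp, map_zero]
  · rw [comb_res]
    exact ha

end LocalSystem

/-! ### Forms in a parallel frame and a chart -/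

section LinearAlgebra
variable {n : ℕ} {F : Type}

/-- The expansion of a multilinear map in coordinates. -/
theorem multilinear_expand [AddCommGroup F] [Module ℝ F] {k : ℕ}
    (T : MultilinearMap ℝ (fun _ : Fin k => EuclideanSpace ℝ (Fin n)) F)
    (v : Fin k → EuclideanSpace ℝ (Fin n)) :
    T v = ∑ I : Fin k → Fin n, (∏ m, v m (I m)) •
      T (fun m => EuclideanSpace.single (I m) (1 : ℝ)) := by
  have h1 : v = fun m => ∑ a, v m a • EuclideanSpace.single a (1 : ℝ) :=
    funext fun m => eq_sum_single (v m)
  conv_lhs => rw [h1, MultilinearMap.map_sum]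
  exact Finset.sum_congr rfl fun I _ => T.map_smul_univ _ _

variable [NormedAddCommGroup F] [NormedSpace ℝ F]

/-- The alternating form with a given coefficient at the monomial with exponent `I`. -/
def monomialAlt {k : ℕ} (I : Fin k → Fin n) :
    F →ₗ[ℝ] EuclideanSpace ℝ (Fin n) [⋀^Fin k]→L[ℝ] F where
  toFun c := (k.factorial : ℝ)⁻¹ • ContinuousMultilinearMap.alternatization
    (((ContinuousMultilinearMap.mkPiAlgebra ℝ (Fin k) ℝ).compContinuousLinearMap
      (fun m => EuclideanSpace.proj (I m))).smulRight c)
  map_add' c c' := by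
    rw [← smul_add, ← map_add]
    congr 2
    ext v
    simp
  map_smul' a c := by
    rw [RingHom.id_apply, smul_comm]
    congr 1
    ext v
    simp only [ContinuousMultilinearMap.alternatization_apply_apply,
      ContinuousAlternatingMap.smul_apply, Finset.smul_sum]
    refine Finset.sum_congr rfl fun σ _ => ?_
    simp [smul_comm a]

theorem monomialAlt_apply {k : ℕ} (I : Fin k → Fin n) (c : F)
    (v : Fin k → EuclideanSpace ℝ (Fin n)) : monomialAlt I c v = (k.factorial : ℝ)⁻¹ •
      ∑ σ : Equiv.Perm (Fin k), Equiv.Perm.sign σ • (∏ m, v (σ m) (I m)) • c := by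
  change (k.factorial : ℝ)⁻¹ • ContinuousMultilinearMap.alternatization
    (((ContinuousMultilinearMap.mkPiAlgebra ℝ (Fin k) ℝ).compContinuousLinearMap
      (fun m => EuclideanSpace.proj (I m))).smulRight c) v = _
  rw [ContinuousMultilinearMap.alternatization_apply_apply]
  congr 1

/-- An alternating form is the sum of its monomials. -/
theorem sum_monomialAlt {k : ℕ} (T : EuclideanSpace ℝ (Fin n) [⋀^Fin k]→ₗ[ℝ] F)
    (v : Fin k → EuclideanSpace ℝ (Fin n)) :
    (∑ I : Fin k → Fin n, monomialAlt I (T fun m => EuclideanSpace.single (I m) 1)) v = T v := by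
  have h1 : ∀ σ : Equiv.Perm (Fin k), ∑ I : Fin k → Fin n, (∏ m, v (σ m) (I m)) •
      T (fun m => EuclideanSpace.single (I m) 1) = Equiv.Perm.sign σ • T v := by
    intro σ
    rw [← T.map_perm]
    exact (multilinear_expand T.toMultilinearMap (v ∘ σ)).symm
  rw [ContinuousAlternatingMap.sum_apply]
  simp only [monomialAlt_apply]
  rw [← Finset.smul_sum, Finset.sum_comm]
  simp only [← Finset.smul_sum, h1, smul_smul, Int.units_mul_self, one_smul]
  rw [Finset.sum_const, Finset.card_univ, Fintype.card_perm, Fintype.card_fin,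
    ← Nat.cast_smul_eq_nsmul ℝ, smul_smul, inv_mul_cancel₀ (by positivity), one_smul]

theorem contDiffOn_linearMap_comp {E W V : Type} [NormedAddCommGroup E] [NormedSpace ℝ E]
    [NormedAddCommGroup W] [NormedSpace ℝ W] [FiniteDimensional ℝ W] [NormedAddCommGroup V]
    [NormedSpace ℝ V] (L : W →ₗ[ℝ] V) {g : E → W} {O : Set E} (hg : ContDiffOn ℝ ∞ g O) :
    ContDiffOn ℝ ∞ (fun y => L (g y)) O :=
  (LinearMap.toContinuousLinearMap L).contDiff.comp_contDiffOn hg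

theorem contDiffOn_alternating_apply {E : Type} [NormedAddCommGroup E] [NormedSpace ℝ E] {k : ℕ}
    {α : E → E [⋀^Fin k]→L[ℝ] F} {O : Set E} (hα : ContDiffOn ℝ ∞ α O) (v : Fin k → E) :
    ContDiffOn ℝ ∞ (fun y => α y v) O :=
  (ContinuousAlternatingMap.apply ℝ E F v).contDiff.comp_contDiffOn hα

/-- A family of alternating forms with smooth coefficients is a smooth family. -/
theorem exists_contDiffOn_alternating [FiniteDimensional ℝ F] {k : ℕ}
    {O : Set (EuclideanSpace ℝ (Fin n))}
    (t : EuclideanSpace ℝ (Fin n) → (Fin k → EuclideanSpace ℝ (Fin n)) → F)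
    (hT : ∀ y ∈ O, ∃ T : EuclideanSpace ℝ (Fin n) [⋀^Fin k]→ₗ[ℝ] F, ∀ v, T v = t y v)
    (ht : ∀ v, ContDiffOn ℝ ∞ (fun y => t y v) O) :
    ∃ α : EuclideanSpace ℝ (Fin n) → EuclideanSpace ℝ (Fin n) [⋀^Fin k]→L[ℝ] F,
      ContDiffOn ℝ ∞ α O ∧ ∀ y ∈ O, ∀ v, α y v = t y v := by
  refine ⟨fun y => ∑ I : Fin k → Fin n,
    monomialAlt I (t y fun m => EuclideanSpace.single (I m) 1), ?_, fun y hy v => ?_⟩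
  · exact ContDiffOn.sum fun I _ =>
      contDiffOn_linearMap_comp (W := F) (V := EuclideanSpace ℝ (Fin n) [⋀^Fin k]→L[ℝ] F)
        (monomialAlt I) (ht _)
  · obtain ⟨T, hT⟩ := hT y hy
    rw [← hT v, ← sum_monomialAlt T v]
    simp only [hT]

end LinearAlgebra

section HatFn
variable {n : ℕ} {𝕂 : Type} [RCLike 𝕂] {X : Type u} [TopologicalSpace X]
  [ChartedSpace (EuclideanSpace ℝ (Fin n)) X] [IsManifold (𝓡 n) ∞ X]
  {G : SheafOfModules.{u} (smoothRing n 𝕂 X)} {U V W : Opens X} {k r : ℕ} {x₀ : X}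

/-- The component `i` of the value of the differential form `α` on vector fields. It is written as
a sum of products of smooth functions, so that it is smooth by construction; `hatFn_apply` gives its
values. -/
def hatFn (h : V ≤ cenDom n x₀)
    (α : EuclideanSpace ℝ (Fin n) → EuclideanSpace ℝ (Fin n) [⋀^Fin k]→L[ℝ] (Fin r → 𝕂))
    (hα : ContDiffOn ℝ ∞ α (cenImg x₀ V)) (ξ : Fin k → VF n V) (i : Fin r) : Fn n 𝕂 V :=
  ∑ I : Fin k → Fin n, ofRealFn 𝕂 V (∏ m, (ξ m).deriv (coordFn h (I m))) *
    ofLoc h (fun y => α y (fun m => EuclideanSpace.single (I m) 1) i)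
      (contDiffOn_pi.1 (contDiffOn_alternating_apply (F := Fin r → 𝕂) hα _) i)

theorem hatFn_apply (h : V ≤ cenDom n x₀)
    (α : EuclideanSpace ℝ (Fin n) → EuclideanSpace ℝ (Fin n) [⋀^Fin k]→L[ℝ] (Fin r → 𝕂))
    (hα : ContDiffOn ℝ ∞ α (cenImg x₀ V)) (ξ : Fin k → VF n V) (i : Fin r) (x : V) :
    hatFn h α hα ξ i x = α (cen x₀ (x : X)) (fun m => hatVF x₀ (ξ m) x) i := by
  have h1 := congrFun (multilinear_expand (α (cen x₀ (x : X))).toMultilinearMap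
    (fun m => hatVF x₀ (ξ m) x)) i
  rw [Finset.sum_apply] at h1
  refine Eq.trans ?_ h1.symm
  refine (map_sum (ContMDiffMap.evalRingHom x : Fn n 𝕂 V →+* 𝕂) _ _).trans ?_
  refine Finset.sum_congr rfl fun I _ => ?_
  rw [map_mul, Pi.smul_apply, RCLike.real_smul_eq_coe_mul]
  congr 1
  change (((∏ m, (ξ m).deriv (coordFn h (I m)) : Fn n ℝ V) x : ℝ) : 𝕂) = _
  congr 1
  refine (map_prod (ContMDiffMap.evalRingHom x : Fn n ℝ V →+* ℝ) _ _).trans ?_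
  exact Finset.prod_congr rfl fun m _ => deriv_coordFn h (ξ m) (I m) x

end HatFn

section Represents
variable {n : ℕ} {𝕂 : Type} [RCLike 𝕂] {X : Type u} [TopologicalSpace X]
  [ChartedSpace (EuclideanSpace ℝ (Fin n)) X] [IsManifold (𝓡 n) ∞ X]
  {G : SheafOfModules.{u} (smoothRing n 𝕂 X)} {U V W : Opens X} {k r : ℕ} {x₀ : X}

/-- The `G`-valued form `θ` is the vector of differential forms `α`, in the frame `s` of `G` and the
chart `cen x₀`. -/
def Represents (h : W ≤ cenDom n x₀) (s : Fin r → Sec G W) (θ : Form G k W)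
    (α : EuclideanSpace ℝ (Fin n) → EuclideanSpace ℝ (Fin n) [⋀^Fin k]→L[ℝ] (Fin r → 𝕂)) : Prop :=
  ∀ v : Fin k → EuclideanSpace ℝ (Fin n), ∃ f : Fin r → Fn n 𝕂 W,
    (∀ i (x : W), f i x = α (cen x₀ (x : X)) v i) ∧
      θ.eval le_rfl (fun m => coordVF h (v m)) = comb le_rfl s f

variable {h : W ≤ cenDom n x₀} {s : Fin r → Sec G W} {θ θ' : Form G k W}
  {α α' : EuclideanSpace ℝ (Fin n) → EuclideanSpace ℝ (Fin n) [⋀^Fin k]→L[ℝ] (Fin r → 𝕂)}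

theorem represents_zero : Represents h s (0 : Form G k W) (fun _ => 0) :=
  fun v => ⟨fun _ => 0, fun _ _ => rfl, (comb_zero le_rfl s).symm⟩

theorem Represents.restrict (hθ : Represents h s θ α) (hV : V ≤ W) :
    Represents (hV.trans h) (fun j => res G hV (s j)) (resForm G k hV θ) α := by
  intro v
  obtain ⟨f, hf, he⟩ := hθ v
  refine ⟨resVec hV f, fun i x => hf i ⟨x, hV x.2⟩, ?_⟩
  have h1 := congrArg (res G hV) he
  rw [Form.res_eval, res_comb] at h1
  rw [comb_res]
  exact h1

theorem Represents.eq (hθ : Represents h s θ α) (hθ' : Represents h s θ' α')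
    (hα : ∀ x ∈ W, α (cen x₀ x) = α' (cen x₀ x)) : θ = θ' := by
  refine Form.ext_coord h fun I => ?_
  obtain ⟨f, hf, he⟩ := hθ fun m => EuclideanSpace.single (I m) 1
  obtain ⟨f', hf', he'⟩ := hθ' fun m => EuclideanSpace.single (I m) 1
  rw [he, he']
  congr 1
  funext i
  refine ContMDiffMap.ext fun x => ?_
  rw [hf, hf', hα x x.2]

theorem Represents.apply_eq (hs : IsFrame s) (hθ : Represents h s θ α)
    (hθ' : Represents h s θ α') {x : X} (hx : x ∈ W) : α (cen x₀ x) = α' (cen x₀ x) := by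
  ext v i
  obtain ⟨f, hf, he⟩ := hθ v
  obtain ⟨f', hf', he'⟩ := hθ' v
  have h1 := hs.eq_of_comb_eq le_rfl (he.symm.trans he')
  rw [← hf i ⟨x, hx⟩, ← hf' i ⟨x, hx⟩, h1]

/-- In a parallel frame, the extension of the connection to forms is the exterior derivative. -/
theorem Represents.dForm (D : Connection G) (hp : ∀ j, D.diff W (s j) = 0)
    (hθ : Represents h s θ α) (hα : ContDiffOn ℝ ∞ α (cenImg x₀ W)) :
    Represents h s (D.dForm k W θ) (extDeriv α) := by
  intro v
  choose f hf he using hθ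
  refine ⟨fun j => ∑ i : Fin (k + 1), (-1 : ℤ) ^ (i : ℕ) •
    (coordVF h (v i)).deriv (f (i.removeNth v) j), fun j x => ?_, ?_⟩
  · have hy := cen_mem_cenImg (n := n) (h x.2) x.2
    have hd : DifferentiableAt ℝ α (cen x₀ (x : X)) :=
      (hα.contDiffAt (isOpen_cenImg.mem_nhds hy)).differentiableAt (by simp)
    have hterm : ∀ i : Fin (k + 1), (coordVF h (v i)).deriv (f (i.removeNth v) j) x =
        fderiv ℝ (fun y => α y (i.removeNth v)) (cen x₀ (x : X)) (v i) j := by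
      intro i
      rw [deriv_eq_fderiv_loc h, hatVF_coordVF]
      have h1 : loc (n := n) x₀ (f (i.removeNth v) j) =ᶠ[nhds (cen x₀ (x : X))]
          fun y => α y (i.removeNth v) j := by
        filter_upwards [isOpen_cenImg.mem_nhds hy] with z hz
        rw [loc_of_mem _ hz, hf]
        change α (cen x₀ (cenInv x₀ z)) _ _ = _
        rw [cen_cenInv hz]
      have h2 : DifferentiableAt ℝ (fun y => α y (i.removeNth v)) (cen x₀ (x : X)) :=
        ((contDiffOn_alternating_apply (F := Fin r → 𝕂) hα (i.removeNth v)).contDiffAt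
          (isOpen_cenImg.mem_nhds hy)).differentiableAt (by simp)
      rw [h1.fderiv_eq, (hasFDerivAt_pi'.1 h2.hasFDerivAt j).fderiv]
      rfl
    have h3 := congrFun (extDeriv_apply hd v) j
    refine Eq.trans ?_ h3.symm
    rw [Finset.sum_apply]
    refine (map_sum (ContMDiffMap.evalRingHom x : Fn n 𝕂 W →+* 𝕂) _ _).trans ?_
    refine Finset.sum_congr rfl fun i _ => ?_
    rw [map_zsmul, Pi.smul_apply, ← hterm i]
    rfl
  · rw [D.dForm_eval_coord h θ v, comb_sum]
    refine Finset.sum_congr rfl fun i _ => ?_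
    have h1 : θ.eval le_rfl (fun m => coordVF h (i.removeNth v m)) =
      comb le_rfl s (f (i.removeNth v)) := he (i.removeNth v)
    rw [h1, D.nabla_comb_of_parallel hp]
    simp only [comb, Finset.smul_sum, smul_assoc]

/-- The coefficients of a section in a frame, at a point. They are unique, so that the choice of
them is additive. -/
def IsFrame.evalCoeff (hs : IsFrame s) (x : W) : Sec G W →ₗ[ℝ] (Fin r → 𝕂) where
  toFun g i := (hs W le_rfl g).choose i x
  map_add' g g' := by
    have h1 := (hs W le_rfl g).choose_spec.1
    have h2 := (hs W le_rfl g').choose_spec.1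
    have h3 := (hs W le_rfl (g + g')).choose_spec.1
    have h4 := hs.eq_of_comb_eq le_rfl (h3.trans (((comb_add le_rfl s _ _).trans
      (congrArg₂ (· + ·) h1 h2)).symm))
    funext i
    rw [h4]
    rfl
  map_smul' c g := by
    have h1 := (hs W le_rfl g).choose_spec.1
    have h3 := (hs W le_rfl (c • g)).choose_spec.1
    have h4 := hs.eq_of_comb_eq le_rfl (h3.trans (((comb_smul le_rfl s
      (algebraMap ℝ (Fn n 𝕂 W) c) _).trans
      (congrArg (algebraMap ℝ (Fn n 𝕂 W) c • ·) h1)).symm))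
    funext i
    rw [h4]
    exact (RCLike.real_smul_eq_coe_mul c _).symm

theorem IsFrame.evalCoeff_comb (hs : IsFrame s) (a : Fin r → Fn n 𝕂 W) (x : W) (i : Fin r) :
    hs.evalCoeff x (comb le_rfl s a) i = a i x := by
  have h1 := (hs W le_rfl (comb le_rfl s a)).choose_spec.1
  have h2 := hs.eq_of_comb_eq le_rfl h1
  exact congrArg (fun a => a i x) h2

/-- The map that sends a vector to the constant vector field in a chart. -/
def coordVFLM (h : W ≤ cenDom n x₀) : EuclideanSpace ℝ (Fin n) →ₗ[ℝ] VF n W where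
  toFun := coordVF h
  map_add' v w := hatVF_ext h fun x => by
    rw [hatVF_add, hatVF_coordVF, hatVF_coordVF, hatVF_coordVF]
  map_smul' c v := hatVF_ext h fun x => by
    rw [RingHom.id_apply, ← algebraMap_smul (Fn n ℝ W) c (coordVF h v), hatVF_smul, hatVF_coordVF,
      hatVF_coordVF]
    rfl

/-- Every form is represented by a smooth differential form. -/
theorem exists_represents (h : W ≤ cenDom n x₀) (hs : IsFrame s) (θ : Form G k W) :
    ∃ α : EuclideanSpace ℝ (Fin n) → EuclideanSpace ℝ (Fin n) [⋀^Fin k]→L[ℝ] (Fin r → 𝕂),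
      ContDiffOn ℝ ∞ α (cenImg x₀ W) ∧ Represents h s θ α := by
  choose f hf _ using fun v : Fin k → EuclideanSpace ℝ (Fin n) =>
    hs W le_rfl (θ.eval le_rfl (fun m => coordVF h (v m)))
  obtain ⟨α, hα, hαf⟩ := exists_contDiffOn_alternating (F := Fin r → 𝕂) (O := cenImg x₀ W)
    (fun y v i => loc x₀ (f v i) y) (fun y hy => by
      refine ⟨(hs.evalCoeff ⟨cenInv x₀ y, hy.2⟩).compAlternatingMap
        ((altToReal (θ.eval le_rfl)).compLinearMap (coordVFLM h)), fun v => funext fun i => ?_⟩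
      change hs.evalCoeff _ (θ.eval le_rfl (fun m => coordVF h (v m))) i = _
      rw [← hf v, hs.evalCoeff_comb, loc_of_mem _ hy])
    (fun v => contDiffOn_pi.2 fun i => contDiffOn_loc _)
  refine ⟨α, hα, fun v => ⟨f v, fun i x => ?_, (hf v).symm⟩⟩
  rw [hαf _ (cen_mem_cenImg (h x.2) x.2)]
  exact (loc_cen (f v i) x (h x.2)).symm

/-- Every smooth differential form represents a form. -/
theorem exists_represents_of_contDiffOn (h : W ≤ cenDom n x₀) (s : Fin r → Sec G W)
    (hα : ContDiffOn ℝ ∞ α (cenImg x₀ W)) : ∃ θ : Form G k W, Represents h s θ α := by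
  have hu : ∀ {V : Opens X} (ξ : Fin k → VF n V) (a : Fin k) (ζ : VF n V) (x : V),
      (fun m => hatVF x₀ (Function.update ξ a ζ m) x) =
        Function.update (fun m => hatVF x₀ (ξ m) x) a (hatVF x₀ ζ x) := by
    intro V ξ a ζ x
    funext m
    exact Function.apply_update (fun _ ζ => hatVF x₀ ζ x) ξ a ζ m
  refine ⟨Form.mk (fun V hV =>
    { toFun := fun ξ => comb hV s (hatFn (hV.trans h) α (hα.mono (cenImg_mono hV)) ξ)
      map_update_add' := fun {dec} ξ a ζ ζ' => by
        obtain rfl : dec = instDecidableEqFin k := Subsingleton.elim _ _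
        rw [← comb_add]
        congr 1
        funext i
        refine ContMDiffMap.ext fun x => ?_
        change hatFn _ _ _ _ i x = hatFn (hV.trans h) α (hα.mono (cenImg_mono hV)) _ i x +
          hatFn (hV.trans h) α (hα.mono (cenImg_mono hV)) _ i x
        rw [hatFn_apply, hatFn_apply, hatFn_apply, hu, hu, hu, hatVF_add,
          ContinuousAlternatingMap.map_update_add]
        rfl
      map_update_smul' := fun {dec} ξ a f ζ => by
        obtain rfl : dec = instDecidableEqFin k := Subsingleton.elim _ _
        rw [realFn_smul, ← comb_smul]
        congr 1
        funext i
        refine ContMDiffMap.ext fun x => ?_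
        refine Eq.trans ?_ (congrArg (fun z : 𝕂 => (f x : 𝕂) * z) (hatFn_apply _ _ _ _ i x)).symm
        rw [hatFn_apply, hu, hu, hatVF_smul, ContinuousAlternatingMap.map_update_smul]
        exact RCLike.real_smul_eq_coe_mul _ _
      map_eq_zero_of_eq' := fun ξ a b hab hne => by
        refine Eq.trans ?_ (comb_zero hV s)
        congr 1
        funext i
        refine ContMDiffMap.ext fun x => ?_
        rw [hatFn_apply, ContinuousAlternatingMap.map_eq_zero_of_eq _ _ (i := a) (j := b) _ hne]
        · rfl
        · simp only [hab] })
    (fun V V' hV hV' hVV' ξ => ?_), fun v => ⟨hatFn h α hα (fun m => coordVF h (v m)),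
      fun i x => ?_, rfl⟩⟩
  · change res G hVV' (comb hV s _) = comb hV' s _
    rw [res_comb]
    congr 1
    funext i
    refine ContMDiffMap.ext fun x => ?_
    change hatFn (hV.trans h) α (hα.mono (cenImg_mono hV)) ξ i ⟨x, hVV' x.2⟩ =
      hatFn (hV'.trans h) α (hα.mono (cenImg_mono hV')) (fun m => resVF hVV' (ξ m)) i x
    rw [hatFn_apply, hatFn_apply]
    rfl
  · rw [hatFn_apply]
    simp only [hatVF_coordVF]

end Represents

/-! ### The twisted de Rham complex is locally exact -/

theorem contDiffOn_clm_comp {E P Q : Type} [NormedAddCommGroup E] [NormedSpace ℝ E]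
    [NormedAddCommGroup P] [NormedSpace ℝ P] [NormedAddCommGroup Q] [NormedSpace ℝ Q]
    (L : P →L[ℝ] Q) {g : E → P} {O : Set E} (hg : ContDiffOn ℝ ∞ g O) :
    ContDiffOn ℝ ∞ (fun y => L (g y)) O := L.contDiff.comp_contDiffOn hg

theorem contDiffOn_extDeriv {E F : Type} [NormedAddCommGroup E] [NormedSpace ℝ E]
    [NormedAddCommGroup F] [NormedSpace ℝ F] {k : ℕ} {α : E → E [⋀^Fin k]→L[ℝ] F} {O : Set E}
    (hO : IsOpen O) (hα : ContDiffOn ℝ ∞ α O) : ContDiffOn ℝ ∞ (extDeriv α) O := by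
  have h2 : ContDiffOn ℝ ∞ (fderiv ℝ α) O := hα.fderiv_of_isOpen hO (by simp)
  exact contDiffOn_clm_comp (P := E →L[ℝ] E [⋀^Fin k]→L[ℝ] F)
    (Q := E [⋀^Fin (k + 1)]→L[ℝ] F)
    (ContinuousAlternatingMap.alternatizeUncurryFinCLM ℝ E F) h2

section LocalExactness
variable {n : ℕ} {𝕂 : Type} [RCLike 𝕂] {X : Type u} [TopologicalSpace X]
  [ChartedSpace (EuclideanSpace ℝ (Fin n)) X] [IsManifold (𝓡 n) ∞ X]
  {G : SheafOfModules.{u} (smoothRing n 𝕂 X)} {U V W : Opens X} {k r : ℕ} {x₀ : X}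

theorem form_eq_of_locally {θ η : Form G k U}
    (h : ∀ x ∈ U, ∃ (W : Opens X) (hW : W ≤ U), x ∈ W ∧ resForm G k hW θ = resForm G k hW η) :
    θ = η := by
  refine Form.ext fun V hV ξ => sec_eq_of_locally fun x hx => ?_
  obtain ⟨W, hW, hxW, he⟩ := h x (hV hx)
  refine ⟨W ⊓ V, inf_le_right, ⟨hxW, hx⟩, ?_⟩
  rw [Form.res_eval, Form.res_eval]
  exact congrArg (fun ζ : Form G k W => ζ.eval (inf_le_left : W ⊓ V ≤ W)
    (fun i => resVF inf_le_right (ξ i))) he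

theorem IsFrame.restrict {s : Fin r → Sec G W} (hs : IsFrame s) (hV : V ≤ W) :
    IsFrame (fun j => res G hV (s j)) := by
  intro V' hV' g
  simp only [comb_res]
  exact hs V' (hV'.trans hV) g

namespace Connection

theorem diff_restrict_eq_zero (D : Connection G) {s : Fin r → Sec G W}
    (hp : ∀ j, D.diff W (s j) = 0) (hV : V ≤ W) (j : Fin r) : D.diff V (res G hV (s j)) = 0 := by
  rw [D.diff_res, hp, map_zero]

theorem dForm_zeroForm (D : Connection G) (U : Opens X) (g : Sec G U) :
    D.dForm 0 U (zeroForm G U g) = D.diff U g := by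
  refine Form.ext fun V hV ξ => ?_
  change koszulSum _ _ _ ξ = _
  rw [koszulSum, Fin.sum_univ_one]
  change (-1 : ℤ) ^ 0 • D.nabla (ξ 0) (res G hV g) - 0 = _
  rw [pow_zero, one_smul, sub_zero, nabla, D.diff_res, evalOne]
  change (D.diff U g).eval hV _ = _
  congr 1
  funext m
  rw [Subsingleton.elim m 0]

variable {D : Connection G}

/-- The extension of a flat connection to forms is a differential. -/
theorem IsFlat.dForm_dForm (hD : D.IsFlat) (hG : HasLocalFreeResolutions G) (θ : Form G k U) :
    D.dForm (k + 1) U (D.dForm k U θ) = 0 := by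
  refine form_eq_of_locally fun x hx => ?_
  obtain ⟨W, hd, r, s, hxW, hs, hp⟩ := hD.exists_parallel_frame hG x
  have hV : W ⊓ U ≤ W := inf_le_left
  obtain ⟨α, hα, hθ⟩ := exists_represents (hV.trans hd) (hs.restrict hV)
    (resForm G k (inf_le_right : W ⊓ U ≤ U) θ)
  refine ⟨W ⊓ U, inf_le_right, ⟨hxW, hx⟩, ?_⟩
  have h1 := hθ.dForm D (D.diff_restrict_eq_zero hp hV) hα
  have hα' : ContDiffOn ℝ ∞ (extDeriv α) (cenImg x (W ⊓ U)) :=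
    contDiffOn_extDeriv (F := Fin r → 𝕂) isOpen_cenImg hα
  have h2 := h1.dForm D (D.diff_restrict_eq_zero hp hV) hα'
  refine h2.eq represents_zero fun z hz => ?_
  refine extDeriv_extDeriv_apply (hα.contDiffAt
    (isOpen_cenImg.mem_nhds (cen_mem_cenImg (hd (hV hz)) hz))) ?_
  rw [minSmoothness_of_isRCLikeNormedField]
  exact WithTop.coe_le_coe.2 (le_top : (2 : ℕ∞) ≤ ⊤)

/-- A closed form is locally exact. -/
theorem IsFlat.exists_dForm_eq (hD : D.IsFlat) (hG : HasLocalFreeResolutions G)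
    (θ : Form G (k + 1) U) (hθ : D.dForm (k + 1) U θ = 0) {x : X} (hx : x ∈ U) :
    ∃ (W : Opens X) (hW : W ≤ U) (η : Form G k W), x ∈ W ∧
      D.dForm k W η = resForm G (k + 1) hW θ := by
  obtain ⟨W, hd, r, s, hxW, hs, hp⟩ := hD.exists_parallel_frame hG x
  have hV : W ⊓ U ≤ W := inf_le_left
  have hxV : x ∈ W ⊓ U := ⟨hxW, hx⟩
  obtain ⟨α, hα, hθα⟩ := exists_represents (hV.trans hd) (hs.restrict hV)
    (resForm G (k + 1) (inf_le_right : W ⊓ U ≤ U) θ)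
  have hclosed : ∀ z ∈ W ⊓ U, extDeriv α (cen (n := n) x z) = 0 := fun z hz => by
    have h1 := hθα.dForm D (D.diff_restrict_eq_zero hp hV) hα
    have h2 : D.dForm (k + 1) (W ⊓ U) (resForm G (k + 1) (inf_le_right : W ⊓ U ≤ U) θ) = 0 := by
      rw [D.dForm_res, hθ, map_zero]
    rw [h2] at h1
    exact h1.apply_eq (hs.restrict hV) represents_zero hz
  -- `α` is extended from a ball to the whole space, where the Poincaré lemma applies
  obtain ⟨β, hβ, ρ, hρ, hρV, hβα⟩ := exists_contDiff_eq_near (cenImg_mem_nhds hxV) hα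
  obtain ⟨η, hη, hηβ⟩ := exists_extDeriv_eq hβ (ρ := ρ) (fun y hy => by
    have h1 : β =ᶠ[nhds y] α := by
      filter_upwards [Metric.isOpen_ball.mem_nhds hy] with z hz using hβα z hz
    rw [h1.extDeriv_eq]
    have h2 := hclosed (cenInv x y) (hρV hy).2
    rwa [cen_cenInv (hρV hy)] at h2)
  obtain ⟨W', hW', hd', hxW', hball⟩ := exists_opens_of_eventually (n := n) hxV
    (Metric.ball_mem_nhds (0 : EuclideanSpace ℝ (Fin n)) hρ)
  have hW'W : W' ≤ W := hW'.trans hV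
  obtain ⟨ζ, hζ⟩ := exists_represents_of_contDiffOn (hW'W.trans hd)
    (fun j => res G hW'W (s j)) (α := η) hη.contDiffOn
  refine ⟨W', hW'.trans inf_le_right, ζ, hxW', ?_⟩
  have h1 := hζ.dForm D (D.diff_restrict_eq_zero hp hW'W) hη.contDiffOn
  have h2 := hθα.restrict hW'
  simp only [res_res] at h2
  refine h1.eq h2 fun z hz => ?_
  rw [hηβ _ (hball z hz), hβα _ (hball z hz)]

end Connection
end LocalExactness

/-! ### Sheaves of abelian groups in terms of sections -/

section AbSections
variable {X : Type u} [TopologicalSpace X] (F : AbSheaf X) {F' : AbSheaf X} {U V W : Opens X}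

/-- The sections over `U` of a sheaf of abelian groups. -/
def ASec (U : Opens X) : Type u := F.obj.obj (op U)

instance (U : Opens X) : AddCommGroup (ASec F U) :=
  inferInstanceAs (AddCommGroup (F.obj.obj (op U)))

/-- Restriction of sections. -/
def ares (h : V ≤ U) : ASec F U →+ ASec F V := (F.obj.map (homOfLE h).op).hom

/-- A morphism of sheaves, on sections. -/
def amap {F : AbSheaf X} (φ : F ⟶ F') (U : Opens X) : ASec F U →+ ASec F' U :=
  (φ.hom.app (op U)).hom

theorem ares_ares (h : V ≤ U) (h' : W ≤ V) (s : ASec F U) :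
    ares F h' (ares F h s) = ares F (h'.trans h) s :=
  (ConcreteCategory.congr_hom (F.obj.map_comp (homOfLE h).op (homOfLE h').op) s).symm

variable {F} in
theorem ares_amap (φ : F ⟶ F') (h : V ≤ U) (s : ASec F U) :
    ares F' h (amap φ U s) = amap φ V (ares F h s) :=
  (ConcreteCategory.congr_hom (φ.hom.naturality (homOfLE h).op) s).symm

variable {F} in
theorem amap_comp {F'' : AbSheaf X} (φ : F ⟶ F') (ψ : F' ⟶ F'') (s : ASec F U) :
    amap (φ ≫ ψ) U s = amap ψ U (amap φ U s) := rfl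

variable {F} in
theorem asec_ext {ι : Type u} {s t : ASec F V} (W : ι → Opens X) (hW : ∀ i, W i ≤ V)
    (hc : V ≤ iSup W) (h : ∀ i, ares F (hW i) s = ares F (hW i) t) : s = t :=
  TopCat.Sheaf.eq_of_locally_eq' (X := TopCat.of X) F W V (fun i => homOfLE (hW i)) hc s t h

theorem asec_glue {ι : Type u} (W : ι → Opens X) (hW : ∀ i, W i ≤ V) (hc : V ≤ iSup W)
    (s : ∀ i, ASec F (W i))
    (hs : ∀ i j, ares F (inf_le_left : W i ⊓ W j ≤ W i) (s i) =
      ares F (inf_le_right : W i ⊓ W j ≤ W j) (s j)) :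
    ∃ t : ASec F V, ∀ i, ares F (hW i) t = s i :=
  let s' : ∀ i, ToType (F.obj.obj (op (W i))) := s
  have hs' : TopCat.Presheaf.IsCompatible F.obj W s' := hs
  (TopCat.Sheaf.existsUnique_gluing' (X := TopCat.of X) F W V
    (fun i => homOfLE (hW i)) hc s' hs').exists

variable {F}

theorem epi_iff_locally_surjective (φ : F ⟶ F') :
    Epi φ ↔ ∀ (U : Opens X) (t : ASec F' U), ∀ x ∈ U, ∃ (V : Opens X) (h : V ≤ U) (s : ASec F V),
      x ∈ V ∧ amap φ V s = ares F' h t := by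
  refine (TopCat.Sheaf.isLocallySurjective_iff_epi (X := TopCat.of X) φ).symm.trans ?_
  refine (TopCat.Presheaf.isLocallySurjective_iff (X := TopCat.of X) φ.hom).trans ?_
  refine forall_congr' fun U => forall_congr' fun t => forall_congr' fun x =>
    forall_congr' fun hx => ⟨?_, ?_⟩
  · rintro ⟨V, h, ⟨s, hs⟩, hxV⟩
    exact ⟨V, h, s, hxV, hs⟩
  · rintro ⟨V, h, s, hxV, hs⟩
    exact ⟨V, h, ⟨s, hs⟩, hxV⟩

theorem amap_injective (φ : F ⟶ F') [Mono φ] (U : Opens X) : Function.Injective (amap φ U) := by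
  have h1 : Mono φ.hom := inferInstanceAs (Mono ((sheafToPresheaf _ _).map φ))
  have h2 : Mono (φ.hom.app (op U)) := inferInstance
  exact (AddCommGrpCat.mono_iff_injective _).1 h2

/-- Left exactness of the functor of sections. -/
theorem exists_amap_eq {S : ShortComplex (AbSheaf X)} (hS : S.Exact) (hf : Mono S.f)
    (t : ASec S.X₂ U) (ht : amap S.g U t = 0) : ∃ s, amap S.f U s = t :=
  TopCat.Sheaf.sections_exact_of_left_exact (X := TopCat.of X) hS hf t ht

theorem exists_amap_kernel_eq (φ : F ⟶ F') (t : ASec F U) (ht : amap φ U t = 0) :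
    ∃ s, amap (Limits.kernel.ι φ) U s = t :=
  exists_amap_eq (S := ShortComplex.mk (Limits.kernel.ι φ) φ (Limits.kernel.condition φ))
    (ShortComplex.exact_kernel φ) inferInstance t ht

/-- A complex of sheaves is exact if cycles are, near each point, boundaries. -/
theorem exact_of_locally {S : ShortComplex (AbSheaf X)}
    (h : ∀ (U : Opens X) (t : ASec S.X₂ U), amap S.g U t = 0 → ∀ x ∈ U,
      ∃ (V : Opens X) (hV : V ≤ U) (s : ASec S.X₁ V), x ∈ V ∧ amap S.f V s = ares _ hV t) :
    S.Exact := by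
  rw [ShortComplex.exact_iff_epi_kernel_lift, epi_iff_locally_surjective]
  intro U t x hx
  have h0 : amap S.g U (amap (Limits.kernel.ι S.g) U t) = 0 := by
    rw [← amap_comp, Limits.kernel.condition]
    rfl
  obtain ⟨V, hV, s, hxV, hs⟩ := h U _ h0 x hx
  refine ⟨V, hV, s, hxV, amap_injective (Limits.kernel.ι S.g) V ?_⟩
  rw [← amap_comp, Limits.kernel.lift_ι, hs, ares_amap]

end AbSections

/-! ### The de Rham complex as a resolution -/

section Resolution
variable {n : ℕ} {𝕂 : Type} [RCLike 𝕂] {X : Type u} [TopologicalSpace X]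
  [ChartedSpace (EuclideanSpace ℝ (Fin n)) X] [IsManifold (𝓡 n) ∞ X]
  {G : SheafOfModules.{u} (smoothRing n 𝕂 X)}

/-- An isomorphism in the middle does not affect the exactness of a kernel. -/
theorem exact_kernel_ι_comp_iso {C : Type*} [Category C] [Abelian C] {A B Z : C} (e : A ≅ B)
    (φ : A ⟶ Z) (ψ : B ⟶ Z) (h : e.hom ≫ ψ = φ)
    (w : (Limits.kernel.ι φ ≫ e.hom) ≫ ψ = 0) : (ShortComplex.mk _ _ w).Exact :=
  (ShortComplex.exact_iff_of_iso
    (ShortComplex.isoMk (S₁ := ShortComplex.mk _ _ (Limits.kernel.condition φ))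
      (S₂ := ShortComplex.mk _ _ w) (Iso.refl _) e (Iso.refl _)
      (by simp) (by simp [h]))).1 (ShortComplex.exact_kernel φ)

namespace Connection

theorem zeroFormIso_hom_d (D : Connection G) : (zeroFormIso G).hom ≫ D.d 0 = D.D := by
  ext U g
  exact D.dForm_zeroForm U.unop g

theorem IsFlat.d_d {D : Connection G} (hD : D.IsFlat) (hG : HasLocalFreeResolutions G) (k : ℕ) :
    D.d k ≫ D.d (k + 1) = 0 := by
  ext U θ
  exact hD.dForm_dForm hG θ

theorem IsFlat.exact_d {D : Connection G} (hD : D.IsFlat) (hG : HasLocalFreeResolutions G)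
    (k : ℕ) : (ShortComplex.mk (D.d k) (D.d (k + 1)) (hD.d_d hG k)).Exact := by
  refine exact_of_locally fun U θ hθ x hx => ?_
  obtain ⟨W, hW, η, hxW, h⟩ := hD.exists_dForm_eq hG θ hθ hx
  exact ⟨W, hW, η, hxW, h⟩

/-- The inclusion of the parallel sections into the sheaf of 0-forms. -/
def parallelι (D : Connection G) : D.parallel ⟶ formSheaf G 0 :=
  Limits.kernel.ι D.D ≫ (zeroFormIso G).hom

instance (D : Connection G) : Mono D.parallelι :=
  inferInstanceAs (Mono (Limits.kernel.ι D.D ≫ (zeroFormIso G).hom))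

theorem parallelι_d (D : Connection G) : D.parallelι ≫ D.d 0 = 0 :=
  (Category.assoc _ _ _).trans ((congrArg (fun φ => Limits.kernel.ι D.D ≫ φ)
    D.zeroFormIso_hom_d).trans (Limits.kernel.condition D.D))

theorem exact_parallelι (D : Connection G) : (ShortComplex.mk _ _ D.parallelι_d).Exact :=
  exact_kernel_ι_comp_iso (zeroFormIso G) D.D (D.d 0) D.zeroFormIso_hom_d D.parallelι_d

theorem IsFlat.isResolution {D : Connection G} (hD : D.IsFlat) (hG : HasLocalFreeResolutions G) :
    D.IsResolution :=
  ⟨⟨D.parallelι_d, inferInstanceAs (Mono D.parallelι), D.exact_parallelι⟩,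
    fun k => ⟨hD.d_d hG k, hD.exact_d hG k⟩⟩

end Connection
end Resolution

/-! ### Injective, flasque and soft sheaves -/

section Soft
variable {X : Type u} [TopologicalSpace X]

/-- The adjunction between the free sheaf of abelian groups on a presheaf of sets, and the
underlying presheaf of sets. -/
def freeSheafAdj (X : Type u) [TopologicalSpace X] :=
  (AddCommGrpCat.adj.{u}.whiskerRight (Opens (TopCat.of X))ᵒᵖ).comp
    (sheafificationAdjunction (Opens.grothendieckTopology (TopCat.of X)) AddCommGrpCat.{u})

/-- Injective sheaves are flasque: a section over `V` is a morphism from the free sheaf on `V`,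
which is a subsheaf of the free sheaf on `U` for `V ≤ U`. -/
theorem exists_ares_eq_of_injective (I : AbSheaf X) [Injective I] {U V : Opens X} (h : V ≤ U)
    (s : ASec I V) : ∃ t : ASec I U, ares I h t = s := by
  let i : (show Opens (TopCat.of X) from V) ⟶ U := homOfLE h
  let L := ((Functor.whiskeringRight (Opens (TopCat.of X))ᵒᵖ _ _).obj AddCommGrpCat.free.{u}) ⋙
    presheafToSheaf (Opens.grothendieckTopology (TopCat.of X)) AddCommGrpCat.{u}
  have hm : Mono (L.map (yoneda.map i)) := by
    have : Mono (((Functor.whiskeringRight (Opens (TopCat.of X))ᵒᵖ _ _).obj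
        AddCommGrpCat.free.{u}).map (yoneda.map i)) := by
      rw [NatTrans.mono_iff_mono_app]
      intro W
      have h1 : Mono ((yoneda.map i).app W) := inferInstance
      exact inferInstanceAs (Mono (AddCommGrpCat.free.map ((yoneda.map i).app W)))
    exact inferInstanceAs (Mono ((presheafToSheaf _ _).map _))
  let s' : ((sheafToPresheaf _ _ ⋙ (Functor.whiskeringRight _ _ _).obj
    (forget AddCommGrpCat.{u})).obj I).obj (op V) := s
  let φ := ((freeSheafAdj X).homEquiv _ I).symm (yonedaEquiv.symm s')
  let ψ := Injective.factorThru φ (L.map (yoneda.map i))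
  refine ⟨yonedaEquiv ((freeSheafAdj X).homEquiv _ I ψ), ?_⟩
  refine Eq.trans (b := yonedaEquiv (yoneda.map i ≫ (freeSheafAdj X).homEquiv _ I ψ))
    (yonedaEquiv_naturality ((freeSheafAdj X).homEquiv _ I ψ) i) ?_
  have h2 : yoneda.map i ≫ (freeSheafAdj X).homEquiv _ I ψ = yonedaEquiv.symm s' := by
    rw [← Adjunction.homEquiv_naturality_left]
    exact (congrArg _ (Injective.comp_factorThru φ (L.map (yoneda.map i)))).trans
      (Equiv.apply_symm_apply _ _)
  rw [h2]
  exact Equiv.apply_symm_apply _ _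

/-- All restriction maps of the sheaf are surjective: `TopCat.Sheaf.IsFlasque` in terms of
sections. -/
def IsFlabby (F : AbSheaf X) : Prop :=
  ∀ ⦃U V : Opens X⦄ (h : V ≤ U), Function.Surjective (ares F h)

theorem IsFlabby.of_injective (I : AbSheaf X) [Injective I] : IsFlabby I :=
  fun _ _ h s => exists_ares_eq_of_injective I h s

theorem IsFlabby.isFlasque {F : AbSheaf X} (hF : IsFlabby F) :
    TopCat.Sheaf.IsFlasque (X := TopCat.of X) F :=
  ⟨fun {U V} i => (AddCommGrpCat.epi_iff_surjective _).2 (hF (leOfHom i.unop))⟩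

/-- A quotient of a flasque sheaf is flasque if its sections lift. -/
theorem IsFlabby.of_surjective {F F' : AbSheaf X} (hF : IsFlabby F) (φ : F ⟶ F')
    (hφ : ∀ U, Function.Surjective (amap φ U)) : IsFlabby F' := by
  intro U V h t
  obtain ⟨s, rfl⟩ := hφ V t
  obtain ⟨s, rfl⟩ := hF h s
  exact ⟨amap φ U s, ares_amap φ h s⟩

/-- The embedding of a sheaf into an injective one, with its cokernel. -/
def injSeq (F : AbSheaf X) : ShortComplex (AbSheaf X) :=
  ShortComplex.mk (Injective.ι F) (Limits.cokernel.π (Injective.ι F)) (Limits.cokernel.condition _)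

theorem injSeq_shortExact (F : AbSheaf X) : (injSeq F).ShortExact where
  exact := ShortComplex.exact_cokernel _
  mono_f := inferInstanceAs (Mono (Injective.ι F))
  epi_g := inferInstanceAs (Epi (Limits.cokernel.π (Injective.ι F)))

/-- Cohomology in degree zero. -/
def hZero (F : AbSheaf X) : Sheaf.H.{u} F 0 ≃+ ASec F ⊤ :=
  Sheaf.H.equiv₀ F Limits.isTerminalTop

theorem hZero_map {F F' : AbSheaf X} (φ : F ⟶ F') (x : Sheaf.H.{u} F 0) :
    hZero F' (Sheaf.H.map φ 0 x) = amap φ ⊤ (hZero F x) :=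
  (Sheaf.H.equiv₀_naturality Limits.isTerminalTop φ x).symm

open Abelian in
/-- Dimension shifting along the embedding into an injective sheaf. -/
theorem subsingleton_H_of_injSeq (F : AbSheaf X)
    (h0 : Function.Surjective (amap (injSeq F).g ⊤)) {i : ℕ}
    (hi : ∀ j, j + 1 = i → Subsingleton (Sheaf.H.{u} (injSeq F).X₃ (j + 1))) :
    Subsingleton (Sheaf.H.{u} F (i + 1)) := by
  have hI : Injective (injSeq F).X₂ := inferInstanceAs (Injective (Injective.under F))
  have hS := injSeq_shortExact F
  refine subsingleton_of_forall_eq 0 fun x => ?_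
  obtain ⟨y, rfl⟩ := Ext.covariant_sequence_exact₁ _ hS x (Ext.eq_zero_of_injective _)
    (n₀ := i) rfl
  cases i with
  | succ j =>
    have := hi j rfl
    rw [Subsingleton.elim y 0, Ext.zero_comp]
    rfl
  | zero =>
    obtain ⟨s, hs⟩ := h0 (hZero _ y)
    obtain ⟨z, rfl⟩ := (hZero _).surjective s
    obtain rfl : Sheaf.H.map (injSeq F).g 0 z = y :=
      (hZero _).injective ((hZero_map _ z).trans hs)
    rw [Sheaf.H.map_apply, Ext.comp_assoc_of_second_deg_zero, hS.comp_extClass, Ext.comp_zero]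
    rfl

/-- Flasque sheaves are acyclic: the cokernel of the embedding into an injective sheaf is flasque
again. -/
theorem IsFlabby.subsingleton_H {F : AbSheaf X} (hF : IsFlabby F) (i : ℕ) :
    Subsingleton (Sheaf.H.{u} F (i + 1)) := by
  induction i using Nat.strong_induction_on generalizing F with | _ i ih =>
  have h0 : ∀ U, Function.Surjective (amap (injSeq F).g U) := fun U => by
    have : TopCat.Sheaf.IsFlasque (X := TopCat.of X) (injSeq F).X₁ := hF.isFlasque
    exact (AddCommGrpCat.epi_iff_surjective _).1
      (TopCat.Sheaf.IsFlasque.epi_of_shortExact (X := TopCat.of X) (U := U) (injSeq_shortExact F))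
  have hI : Injective (injSeq F).X₂ := inferInstanceAs (Injective (Injective.under F))
  exact subsingleton_H_of_injSeq F (h0 ⊤) fun j hj =>
    ih j (by omega) ((IsFlabby.of_injective (injSeq F).X₂).of_surjective _ h0)

/-- A section over a neighbourhood of a closed set agrees, on a smaller neighbourhood, with a
global section. -/
def IsSoft (F : AbSheaf X) : Prop :=
  ∀ (K : Set X) (U : Opens X) (s : ASec F U), IsClosed K → K ⊆ U →
    ∃ (V : Opens X) (h : V ≤ U) (t : ASec F ⊤), K ⊆ V ∧ ares F le_top t = ares F h s

end Soft

/-! ### Acyclicity of soft sheaves -/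

section SoftAcyclic
variable {X : Type u} [TopologicalSpace X]

theorem asec_ext_two (F : AbSheaf X) {A B : Opens X} {s t : ASec F (A ⊔ B)}
    (hA : ares F le_sup_left s = ares F le_sup_left t)
    (hB : ares F le_sup_right s = ares F le_sup_right t) : s = t := by
  let W : ULift.{u} Bool → Opens X := fun b => cond b.down A B
  have hW : ∀ b, W b ≤ A ⊔ B := by
    rintro ⟨_ | _⟩
    exacts [le_sup_right, le_sup_left]
  refine asec_ext W hW (sup_le (le_iSup W ⟨true⟩) (le_iSup W ⟨false⟩)) ?_
  rintro ⟨_ | _⟩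
  exacts [hB, hA]

theorem asec_glue_two (F : AbSheaf X) {A B : Opens X} (s : ASec F A) (r : ASec F B)
    (h : ares F (inf_le_left : A ⊓ B ≤ A) s = ares F (inf_le_right : A ⊓ B ≤ B) r) :
    ∃ t : ASec F (A ⊔ B), ares F le_sup_left t = s ∧ ares F le_sup_right t = r := by
  let W : ULift.{u} Bool → Opens X := fun b => cond b.down A B
  have hW : ∀ b, W b ≤ A ⊔ B := by
    rintro ⟨_ | _⟩
    exacts [le_sup_right, le_sup_left]
  have hc : A ⊔ B ≤ iSup W := sup_le (le_iSup W ⟨true⟩) (le_iSup W ⟨false⟩)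
  let σ : ∀ b, ASec F (W b) := fun b => match b with
    | ⟨true⟩ => s
    | ⟨false⟩ => r
  obtain ⟨t, ht⟩ := asec_glue F W hW hc σ (by
    rintro ⟨_ | _⟩ ⟨_ | _⟩
    · rfl
    · have h1 := congrArg (ares F (le_of_eq (inf_comm _ _) : B ⊓ A ≤ A ⊓ B)) h.symm
      rw [ares_ares, ares_ares] at h1
      exact h1
    · exact h
    · rfl)
  exact ⟨t, ht ⟨true⟩, ht ⟨false⟩⟩

variable {S : ShortComplex (AbSheaf X)} {U : Opens X}

/-- Two lifts of a section, near closed sets `K` and `C`, can be patched if the kernel is soft: the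
new lift is defined near `K ∪ C` and agrees near `K` with the first one. -/
theorem IsSoft.exists_patch [NormalSpace X] (hS : S.ShortExact) (hF : IsSoft S.X₁)
    (t : ASec S.X₃ U) {O V : Opens X} (hO : O ≤ U) (hV : V ≤ U) (s : ASec S.X₂ O)
    (r : ASec S.X₂ V) (hs : amap S.g O s = ares _ hO t) (hr : amap S.g V r = ares _ hV t)
    {K C : Set X} (hK : IsClosed K) (hC : IsClosed C) (hKO : K ⊆ O) (hCV : C ⊆ V) :
    ∃ (O' : Opens X) (hO' : O' ≤ U) (s' : ASec S.X₂ O'), amap S.g O' s' = ares _ hO' t ∧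
      K ∪ C ⊆ O' ∧ ∃ (A : Opens X) (hA : A ≤ O) (hA' : A ≤ O'), K ⊆ A ∧
        ares _ hA s = ares _ hA' s' := by
  -- the difference of the lifts comes from a section of the kernel
  obtain ⟨a, ha⟩ := exists_amap_eq (U := O ⊓ V) hS.exact hS.mono_f
    (ares _ inf_le_left s - ares _ inf_le_right r) (by
      rw [map_sub, ← ares_amap, ← ares_amap, hs, hr, ares_ares, ares_ares, sub_self])
  obtain ⟨N, hN, b, hKN, hb⟩ := hF (K ∩ C) (O ⊓ V) a (hK.inter hC)
    (fun x hx => ⟨hKO hx.1, hCV hx.2⟩)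
  -- shrink the domains of the lifts until they meet inside `N`, where the global section `b` of the
  -- kernel is their difference
  have hd : Disjoint (K \ N) (C \ N) :=
    Set.disjoint_left.2 fun x hx hx' => hx.2 (hKN ⟨hx.1, hx'.1⟩)
  obtain ⟨A₁, B₁, hA₁, hB₁, hKA, hCB, hAB⟩ := normal_separation
    (hK.sdiff N.isOpen) (hC.sdiff N.isOpen) hd
  let A : Opens X := O ⊓ (⟨A₁, hA₁⟩ ⊔ N)
  let B : Opens X := V ⊓ (⟨B₁, hB₁⟩ ⊔ N)
  have hAN : A ⊓ B ≤ N := by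
    rintro x ⟨⟨-, h1 | h1⟩, ⟨-, h2 | h2⟩⟩
    · exact absurd h2 (Set.disjoint_left.1 hAB h1)
    all_goals first | exact h1 | exact h2
  have hKA' : K ⊆ A := fun x hx => ⟨hKO hx, by
    by_cases h : x ∈ N
    exacts [Or.inr h, Or.inl (hKA ⟨hx, h⟩)]⟩
  have hCB' : C ⊆ B := fun x hx => ⟨hCV hx, by
    by_cases h : x ∈ N
    exacts [Or.inr h, Or.inl (hCB ⟨hx, h⟩)]⟩
  have hAO : A ≤ O := inf_le_left
  have hBV : B ≤ V := inf_le_left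
  have hfg : ∀ (W : Opens X) (c : ASec S.X₁ W), amap S.g W (amap S.f W c) = 0 := fun W c => by
    rw [← amap_comp, S.zero]
    rfl
  obtain ⟨s', h1, h2⟩ := asec_glue_two S.X₂ (ares _ hAO s)
    (ares _ hBV r + amap S.f B (ares _ le_top b)) (by
      have h3 := congrArg (ares _ (hAN.trans hN)) ha
      have h4 : ares S.X₁ (le_top : A ⊓ B ≤ ⊤) b = ares _ (hAN.trans hN) a := by
        rw [← ares_ares S.X₁ le_top hAN, hb, ares_ares]
      rw [map_sub, ares_ares, ares_ares, ares_amap, ← h4] at h3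
      rw [map_add, ares_ares, ares_ares, ares_amap, ares_ares, h3]
      abel)
  refine ⟨A ⊔ B, sup_le (hAO.trans hO) (hBV.trans hV), s', ?_, ?_, A, hAO, le_sup_left, hKA',
    h1.symm⟩
  · refine asec_ext_two S.X₃ ?_ ?_
    · rw [ares_amap, h1, ← ares_amap, hs, ares_ares, ares_ares]
    · rw [ares_amap, h2, map_add, hfg, add_zero, ← ares_amap, hr, ares_ares, ares_ares]
  · exact Set.union_subset (fun x hx => Or.inl (hKA' hx)) (fun x hx => Or.inr (hCB' hx))

/-- An open set is covered by the interiors of countably many closed sets, each of them small of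
a given sort. -/
theorem exists_seq_closed_cover [RegularSpace X] [SecondCountableTopology X] (U : Opens X)
    (P : Opens X → Prop) (hP : P ⊥) (h : ∀ x ∈ U, ∃ V, x ∈ V ∧ P V) :
    ∃ (C : ℕ → Set X) (V : ℕ → Opens X), (∀ n, IsClosed (C n)) ∧ (∀ n, C n ⊆ V n) ∧
      (∀ n, P (V n)) ∧ ∀ x ∈ U, ∃ n, x ∈ interior (C n) := by
  choose V hxV hPV using fun x : U => h x x.2
  choose C hC hCc hCV using fun x : U =>
    exists_mem_nhds_isClosed_subset ((V x).isOpen.mem_nhds (hxV x))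
  obtain ⟨T, hT, hcov⟩ := TopologicalSpace.countable_cover_nhds fun x : U =>
    isOpen_interior (s := C x) |>.preimage continuous_subtype_val |>.mem_nhds
      (mem_interior_iff_mem_nhds.2 (hC x))
  rcases T.eq_empty_or_nonempty with rfl | hne
  · refine ⟨fun _ => ∅, fun _ => ⊥, fun _ => isClosed_empty, fun _ => Set.empty_subset _,
      fun _ => hP, fun x hx => ?_⟩
    have : (⟨x, hx⟩ : U) ∈ (Set.univ : Set U) := trivial
    rw [← hcov] at this
    simp at this
  · obtain ⟨f, rfl⟩ := hT.exists_eq_range hne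
    refine ⟨fun n => C (f n), fun n => V (f n), fun n => hCc _, fun n => hCV _,
      fun n => hPV _, fun x hx => ?_⟩
    have : (⟨x, hx⟩ : U) ∈ (Set.univ : Set U) := trivial
    rw [← hcov] at this
    simpa using this

/-- If the kernel is soft, sections of the quotient lift. -/
theorem IsSoft.surjective [T2Space X] [RegularSpace X] [SecondCountableTopology X]
    (hS : S.ShortExact) (hF : IsSoft S.X₁) (U : Opens X) :
    Function.Surjective (amap S.g U) := by
  intro t
  obtain ⟨C, V, hC, hCV, hV, hcov⟩ := exists_seq_closed_cover U
    (fun V => ∃ (hV : V ≤ U) (r : ASec S.X₂ V), amap S.g V r = ares _ hV t)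
    ⟨bot_le, 0, asec_ext (fun i : PEmpty => i.elim) (fun i => i.elim) bot_le fun i => i.elim⟩
    (fun x hx => by
      obtain ⟨V, hV, s, hxV, hs⟩ := (epi_iff_locally_surjective S.g).1 hS.epi_g U t x hx
      exact ⟨V, hxV, hV, s, hs⟩)
  choose hVU r hr using hV
  let K : ℕ → Set X := fun n => ⋃ i ∈ Set.Iic n, C i
  have hK : ∀ n, IsClosed (K n) := fun n => (Set.finite_Iic n).isClosed_biUnion fun i _ => hC i
  have hCK : ∀ {i n}, i ≤ n → C i ⊆ K n := fun {i n} h => Set.subset_biUnion_of_mem (u := C) h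
  -- lifts near the finite unions, each of them unchanged by the later ones
  let L : ℕ → Type u := fun n => {p : Σ O : Opens X, ASec S.X₂ O //
    ∃ h : p.1 ≤ U, amap S.g p.1 p.2 = ares _ h t ∧ K n ⊆ p.1}
  have step : ∀ n (p : L n), ∃ q : L (n + 1), ∃ (A : Opens X) (hA : A ≤ p.1.1) (hA' : A ≤ q.1.1),
      K n ⊆ A ∧ ares _ hA p.1.2 = ares _ hA' q.1.2 := by
    rintro n ⟨⟨O, s⟩, hO, hs, hKO⟩
    obtain ⟨O', hO', s', hs', hKC, hA⟩ := hF.exists_patch hS t hO (hVU (n + 1)) s (r (n + 1)) hs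
      (hr _) (hK n) (hC (n + 1)) hKO (hCV _)
    refine ⟨⟨⟨O', s'⟩, hO', hs', fun x hx => hKC ?_⟩, hA⟩
    obtain ⟨i, hi, hxi⟩ := Set.mem_iUnion₂.1 hx
    rcases Nat.lt_or_ge n i with h | h
    · obtain rfl : i = n + 1 := le_antisymm hi h
      exact Or.inr hxi
    · exact Or.inl (hCK h hxi)
  choose nxt hnxt using step
  let q : ∀ n, L n := Nat.rec ⟨⟨V 0, r 0⟩, hVU 0, hr 0, fun x hx => by
    obtain ⟨i, hi, hxi⟩ := Set.mem_iUnion₂.1 hx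
    obtain rfl : i = 0 := Nat.le_zero.1 hi
    exact hCV 0 hxi⟩ nxt
  let W : ℕ → Opens X := fun n => ⟨interior (C n), isOpen_interior⟩
  have hWO : ∀ {i n}, i ≤ n → W i ≤ (q n).1.1 := fun {i n} h x hx =>
    (q n).2.choose_spec.2 (hCK h (interior_subset hx))
  have hstab : ∀ i m, ares _ (hWO (Nat.le_add_right i m)) (q (i + m)).1.2 =
      ares _ (hWO le_rfl) (q i).1.2 := by
    intro i m
    induction m with
    | zero => rfl
    | succ m ih =>
      rw [← ih]
      obtain ⟨A, hA, hA', hKA, h⟩ := hnxt (i + m) (q (i + m))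
      have hWA : W i ≤ A := fun x hx => hKA (hCK (Nat.le_add_right i m) (interior_subset hx))
      have := congrArg (ares _ hWA) h.symm
      rw [ares_ares, ares_ares] at this
      exact this
  have hstab' : ∀ {i n} (h : i ≤ n), ares _ (hWO h) (q n).1.2 = ares _ (hWO le_rfl) (q i).1.2 := by
    intro i n h
    obtain ⟨m, rfl⟩ := Nat.exists_eq_add_of_le h
    exact hstab i m
  have hWU : ∀ n, W n ≤ U := fun n => (hWO le_rfl).trans (q n).2.choose
  have hUW : U ≤ iSup fun n : ULift.{u} ℕ => W n.down := fun x hx => by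
    obtain ⟨n, hn⟩ := hcov x hx
    exact Opens.mem_iSup.2 ⟨⟨n⟩, hn⟩
  have hcomp : ∀ {i j}, i ≤ j → ∀ {Z : Opens X} (hi : Z ≤ W i) (hj : Z ≤ W j),
      ares _ hi (ares _ (hWO le_rfl) (q i).1.2) = ares _ hj (ares _ (hWO le_rfl) (q j).1.2) := by
    intro i j h Z hi hj
    rw [← hstab' h, ares_ares, ares_ares]
  obtain ⟨s, hs⟩ := asec_glue S.X₂ (fun n : ULift.{u} ℕ => W n.down) (fun n => hWU n.down) hUW
    (fun n => ares _ (hWO le_rfl) (q n.down).1.2) (fun i j => by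
      rcases le_total i.down j.down with h | h
      · exact hcomp h _ _
      · exact (hcomp h _ _).symm)
  refine ⟨s, asec_ext (fun n : ULift.{u} ℕ => W n.down) (fun n => hWU n.down) hUW fun n => ?_⟩
  rw [ares_amap, hs, ← ares_amap, (q n.down).2.choose_spec.1, ares_ares]

/-- Soft sheaves on a regular second countable space are acyclic: the cokernel of the embedding
into an injective sheaf is flasque. -/
theorem IsSoft.subsingleton_H [T2Space X] [RegularSpace X] [SecondCountableTopology X]
    {F : AbSheaf X} (hF : IsSoft F) (i : ℕ) : Subsingleton (Sheaf.H.{u} F (i + 1)) := by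
  have h0 := IsSoft.surjective (injSeq_shortExact F) hF
  have hI : Injective (injSeq F).X₂ := inferInstanceAs (Injective (Injective.under F))
  exact subsingleton_H_of_injSeq F (h0 ⊤) fun j _ =>
    ((IsFlabby.of_injective (injSeq F).X₂).of_surjective _ h0).subsingleton_H j

end SoftAcyclic

/-! ### The sheaves of forms are soft -/

section FormsSoft
variable {n : ℕ} {𝕂 : Type} [RCLike 𝕂] {X : Type u} [TopologicalSpace X]
  [ChartedSpace (EuclideanSpace ℝ (Fin n)) X] [IsManifold (𝓡 n) ∞ X]
  {G : SheafOfModules.{u} (smoothRing n 𝕂 X)} {k : ℕ} {U V : Opens X}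

/-- The product of a smooth function and a form. -/
def Form.smulFn (f : Fn n ℝ U) (θ : Form G k U) : Form G k U :=
  Form.mk (fun V h => resFn h f • θ.eval h) (fun V W hV hW h ξ => by
    rw [AlternatingMap.smul_apply, AlternatingMap.smul_apply, res_realFn_smul, Form.res_eval]
    rfl)

theorem Form.resForm_smulFn_zero (h : V ≤ U) (f : Fn n ℝ U) (θ : Form G k U)
    (hf : resFn h f = 0) : resForm G k h (θ.smulFn f) = 0 :=
  Form.ext fun W hW ξ => by
    change resFn hW (resFn h f) • θ.eval (hW.trans h) ξ = 0
    rw [hf, map_zero, zero_smul]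

theorem Form.resForm_smulFn_one (h : V ≤ U) (f : Fn n ℝ U) (θ : Form G k U)
    (hf : resFn h f = 1) : resForm G k h (θ.smulFn f) = resForm G k h θ :=
  Form.ext fun W hW ξ => by
    change resFn hW (resFn h f) • (θ.eval (hW.trans h)) ξ = θ.eval (hW.trans h) ξ
    rw [hf, map_one, one_smul]

/-- The sheaves of forms are soft, since forms can be multiplied by smooth cutoff functions. -/
theorem isSoft_formSheaf [T2Space X] [SecondCountableTopology X]
    (G : SheafOfModules.{u} (smoothRing n 𝕂 X)) (k : ℕ) : IsSoft (formSheaf G k) := by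
  have : LocallyCompactSpace X := ChartedSpace.locallyCompactSpace (EuclideanSpace ℝ (Fin n)) X
  intro K U θ hK hKU
  obtain ⟨χ, h0, h1, -⟩ := exists_contMDiffMap_zero_one_nhds_of_isClosed (𝓡 n) (n := ⊤)
    U.isOpen.isClosed_compl hK (Set.disjoint_left.2 fun x hx hx' => hx (hKU hx'))
  obtain ⟨Z, hZ, hUZ, hZ0⟩ := mem_nhdsSet_iff_exists.1 h0
  obtain ⟨N, hN, hKN, hN1⟩ := mem_nhdsSet_iff_exists.1 h1
  let Z' : Opens X := ⟨Z, hZ⟩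
  let V : Opens X := ⟨N, hN⟩ ⊓ U
  -- `χ θ` extends by zero, and is `θ` where `χ = 1`
  let χU : Fn n ℝ U := ⟨fun x => χ x, χ.contMDiff.comp contMDiff_subtype_val⟩
  have hcov : ⊤ ≤ U ⊔ Z' := fun x _ => by
    by_cases hx : x ∈ U
    exacts [Or.inl hx, Or.inr (hUZ hx)]
  have hVU : V ≤ U := inf_le_right
  obtain ⟨τ, hτ, -⟩ := asec_glue_two (formSheaf G k) (A := U) (B := Z')
    (Form.smulFn χU θ : Form G k U) 0 (by
      rw [map_zero]
      exact Form.resForm_smulFn_zero inf_le_left χU θ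
        (ContMDiffMap.ext fun x => hZ0 (inf_le_right (a := U) x.2)))
  refine ⟨V, hVU, ares _ hcov τ, fun x hx => ⟨hKN hx, hKU hx⟩, ?_⟩
  have h2 := congrArg (ares (formSheaf G k) hVU) hτ
  rw [ares_ares] at h2
  rw [ares_ares]
  exact h2.trans (Form.resForm_smulFn_one hVU χU θ
    (ContMDiffMap.ext fun x => hN1 (inf_le_left (b := U) x.2)))

theorem formsAcyclic [T2Space X] [SecondCountableTopology X]
    (G : SheafOfModules.{u} (smoothRing n 𝕂 X)) : FormsAcyclic G := fun k i => by
  have : LocallyCompactSpace X := ChartedSpace.locallyCompactSpace (EuclideanSpace ℝ (Fin n)) X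
  exact (isSoft_formSheaf G k).subsingleton_H i

end FormsSoft

/-! ### Dimension shifting along an acyclic resolution -/

section DimensionShift
open Limits Abelian
universe v w
variable {C : Type u} [Category.{v} C] [Abelian C]

/-- The short sequence `0 → Ker d_k → F_k → Ker d_(k+1) → 0` of a complex. -/
abbrev cycleSeq {F : ℕ → C} {d : ∀ k, F k ⟶ F (k + 1)} (hd : ∀ k, d k ≫ d (k + 1) = 0) (k : ℕ) :
    ShortComplex C :=
  ShortComplex.mk (kernel.ι (d k)) (kernel.lift (d (k + 1)) (d k) (hd k))
    (by rw [← cancel_mono (kernel.ι _), Category.assoc, kernel.lift_ι, kernel.condition, zero_comp])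

theorem cycleSeq_shortExact {F : ℕ → C} {d : ∀ k, F k ⟶ F (k + 1)}
    (hd : ∀ k, d k ≫ d (k + 1) = 0) (k : ℕ)
    (he : (ShortComplex.mk (d k) (d (k + 1)) (hd k)).Exact) : (cycleSeq hd k).ShortExact where
  exact := by
    -- the target `Ker d_(k+1)` may be replaced by `F_(k+1)`, into which it is a monomorphism
    let φ : cycleSeq hd k ⟶ ShortComplex.mk (kernel.ι (d k)) (d k) (kernel.condition _) :=
      { τ₁ := 𝟙 _
        τ₂ := 𝟙 _
        τ₃ := kernel.ι (d (k + 1))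
        comm₁₂ := by simp [cycleSeq]
        comm₂₃ := by simp [cycleSeq] }
    have h1 : Epi φ.τ₁ := inferInstanceAs (Epi (𝟙 _))
    have h2 : IsIso φ.τ₂ := inferInstanceAs (IsIso (𝟙 _))
    have h3 : Mono φ.τ₃ := inferInstanceAs (Mono (kernel.ι (d (k + 1))))
    exact (ShortComplex.exact_iff_of_epi_of_isIso_of_mono φ).2 (ShortComplex.exact_kernel (d k))
  mono_f := inferInstanceAs (Mono (kernel.ι (d k)))
  epi_g := (ShortComplex.exact_iff_epi_kernel_lift _).1 he

variable [HasExt.{w} C] {F : ℕ → C} {d : ∀ k, F k ⟶ F (k + 1)} {hd : ∀ k, d k ≫ d (k + 1) = 0}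
  (hs : ∀ k, (cycleSeq hd k).ShortExact) {P : C} (a : kernel (d 0) ⟶ P)

/-- The class in `Ext^k(Ker d_k, P)` of the beginning `0 → P → F_0 → ⋯ → F_(k-1) → Ker d_k → 0` of a
resolution: the composite of the classes of the short sequences into which it splits. -/
def resClass : ∀ k, Ext.{w} (kernel (d k)) P k
  | 0 => Ext.mk₀ a
  | k + 1 => (hs k).extClass.comp (resClass k) (add_comm 1 k)

variable {A : C}

theorem comp_resClass_succ {i k m : ℕ} (h : i + (k + 1) = m) (x : Ext.{w} A (kernel (d (k + 1))) i) :
    x.comp (resClass hs a (k + 1)) h =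
      (x.comp (Z := kernel (d k)) (hs k).extClass rfl).comp (resClass hs a k)
        ((add_right_comm i 1 k).trans h) :=
  (Ext.comp_assoc x (hs k).extClass (resClass hs a k) rfl (add_comm 1 k) (by omega)).symm

/-- Composition with the class of an acyclic resolution is bijective in positive degrees. -/
theorem bijective_comp_resClass [IsIso a]
    (hA : ∀ k i, Subsingleton (Ext.{w} A (F k) (i + 1))) (k : ℕ) :
    ∀ (i m : ℕ) (h : i + 1 + k = m), Function.Bijective
      fun x : Ext.{w} A (kernel (d k)) (i + 1) => x.comp (resClass hs a k) h := by
  induction k with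
  | zero =>
    rintro i m rfl
    refine Function.bijective_iff_has_inverse.2
      ⟨fun y => y.comp (Ext.mk₀ (inv a)) (add_zero _), fun x => ?_, fun y => ?_⟩
    · change (x.comp (Ext.mk₀ a) _).comp (Ext.mk₀ (inv a)) _ = x
      rw [Ext.comp_assoc_of_third_deg_zero, Ext.mk₀_comp_mk₀, IsIso.hom_inv_id, Ext.comp_mk₀_id]
    · change (y.comp (Ext.mk₀ (inv a)) _).comp (Ext.mk₀ a) _ = y
      rw [Ext.comp_assoc_of_third_deg_zero, Ext.mk₀_comp_mk₀, IsIso.inv_hom_id, Ext.comp_mk₀_id]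
  | succ k ih =>
    intro i m h
    have h1 : Function.Bijective fun x : Ext.{w} A (kernel (d (k + 1))) (i + 1) =>
        x.comp (Z := kernel (d k)) (hs k).extClass (rfl : i + 1 + 1 = _) := by
      constructor
      · refine (injective_iff_map_eq_zero ((hs k).extClass.postcomp A rfl)).2 fun x hx => ?_
        obtain ⟨y, rfl⟩ := Ext.covariant_sequence_exact₃ A (hs k) x rfl hx
        have := hA k i
        rw [Subsingleton.elim y 0, Ext.zero_comp]
      · intro y
        have := hA k (i + 1)
        exact Ext.covariant_sequence_exact₁ A (hs k) y (Subsingleton.elim (α := Ext A (F k) _) _ _) rfl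
    have h2 := (ih (i + 1) m (by omega)).comp h1
    exact (funext fun x => comp_resClass_succ hs a h x :
      (fun x : Ext.{w} A (kernel (d (k + 1))) (i + 1) => x.comp (resClass hs a (k + 1)) h) = _) ▸ h2

/-- Composition with the class of an acyclic resolution is surjective in degree zero. -/
theorem surjective_comp_resClass [IsIso a]
    (hA : ∀ k i, Subsingleton (Ext.{w} A (F k) (i + 1))) (k : ℕ) :
    Function.Surjective
      fun x : Ext.{w} A (kernel (d k)) 0 => x.comp (resClass hs a k) (zero_add k) := by
  intro y
  cases k with
  | zero =>
    refine ⟨y.comp (Ext.mk₀ (inv a)) (add_zero _), ?_⟩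
    change (y.comp (Ext.mk₀ (inv a)) _).comp (Ext.mk₀ a) _ = y
    rw [Ext.comp_assoc_of_third_deg_zero, Ext.mk₀_comp_mk₀, IsIso.inv_hom_id, Ext.comp_mk₀_id]
  | succ k =>
    obtain ⟨z, hz⟩ := (bijective_comp_resClass hs a hA k 0 (k + 1) (by omega)).2 y
    have := hA k 0
    obtain ⟨x, rfl⟩ := Ext.covariant_sequence_exact₁ A (hs k) z
      (Subsingleton.elim (α := Ext A (F k) _) _ _) (n₀ := 0) rfl
    exact ⟨x, (comp_resClass_succ hs a _ x).trans hz⟩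

theorem comp_resClass_zero_eq_zero_iff [IsIso a] (x : Ext.{w} A (kernel (d 0)) 0) :
    x.comp (resClass hs a 0) (zero_add 0) = 0 ↔ x = 0 := by
  constructor
  · intro h
    have h1 : (x.comp (Ext.mk₀ a) (add_zero 0)).comp (Ext.mk₀ (inv a)) (add_zero 0) = 0 := by
      have h2 : x.comp (Ext.mk₀ a) (add_zero 0) = 0 := h
      rw [h2, Ext.zero_comp]
    rwa [Ext.comp_assoc_of_third_deg_zero, Ext.mk₀_comp_mk₀, IsIso.hom_inv_id,
      Ext.comp_mk₀_id] at h1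
  · rintro rfl
    exact Ext.zero_comp A 0 (resClass hs a 0) _ _

/-- The kernel of the composition with the class of an acyclic resolution, in degree zero, consists
of the boundaries. -/
theorem comp_resClass_succ_eq_zero_iff [IsIso a]
    (hA : ∀ k i, Subsingleton (Ext.{w} A (F k) (i + 1))) (k : ℕ)
    (x : Ext.{w} A (kernel (d (k + 1))) 0) :
    x.comp (resClass hs a (k + 1)) (zero_add (k + 1)) = 0 ↔
      ∃ y : Ext.{w} A (F k) 0,
        y.comp (Ext.mk₀ (kernel.lift (d (k + 1)) (d k) (hd k))) (add_zero 0) = x := by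
  rw [comp_resClass_succ]
  constructor
  · intro h
    refine Ext.covariant_sequence_exact₃ A (hs k) x rfl
      ((bijective_comp_resClass hs a hA k 0 (k + 1) (by omega)).1 (h.trans ?_))
    exact (Ext.zero_comp (Y := kernel (d k)) A 1 (resClass hs a k) _ _).symm
  · rintro ⟨y, rfl⟩
    have h : (y.comp (Ext.mk₀ (cycleSeq hd k).g) (add_zero 0)).comp (hs k).extClass
        (rfl : 0 + 1 = 1) = 0 := by
      rw [Ext.comp_assoc_of_second_deg_zero, (hs k).comp_extClass, Ext.comp_zero]
    exact (congrArg (fun z : Ext A (kernel (d k)) 1 => z.comp (resClass hs a k) (add_comm 1 k))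
      h).trans (Ext.zero_comp A 1 (resClass hs a k) _ _)

/-- The class of a resolution is natural. -/
theorem resClass_comp {F' : ℕ → C} {d' : ∀ k, F' k ⟶ F' (k + 1)}
    {hd' : ∀ k, d' k ≫ d' (k + 1) = 0} (hs' : ∀ k, (cycleSeq hd' k).ShortExact) {P' : C}
    (a' : kernel (d' 0) ⟶ P') (φ : ∀ k, F k ⟶ F' k) (hφ : ∀ k, d k ≫ φ (k + 1) = φ k ≫ d' k)
    (π : P ⟶ P') (hπ : kernel.map (d 0) (d' 0) (φ 0) (φ 1) (hφ 0) ≫ a' = a ≫ π) (k : ℕ) :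
    (resClass hs a k).comp (Ext.mk₀ π) (add_zero k) =
      (Ext.mk₀ (kernel.map (d k) (d' k) (φ k) (φ (k + 1)) (hφ k))).comp (resClass hs' a' k)
        (zero_add k) := by
  induction k with
  | zero =>
    change (Ext.mk₀ a).comp (Ext.mk₀ π) _ = (Ext.mk₀ _).comp (Ext.mk₀ a') _
    rw [Ext.mk₀_comp_mk₀, Ext.mk₀_comp_mk₀, hπ]
  | succ k ih =>
    let ψ : cycleSeq hd k ⟶ cycleSeq hd' k :=
      { τ₁ := kernel.map (d k) (d' k) (φ k) (φ (k + 1)) (hφ k)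
        τ₂ := φ k
        τ₃ := kernel.map (d (k + 1)) (d' (k + 1)) (φ (k + 1)) (φ (k + 2)) (hφ (k + 1))
        comm₁₂ := by simp [cycleSeq]
        comm₂₃ := by
          rw [← cancel_mono (kernel.ι (d' (k + 1)))]
          simp [cycleSeq, hφ] }
    have hn := (hs k).extClass_naturality (hs' k) ψ
    change ((hs k).extClass.comp (resClass hs a k) _).comp (Ext.mk₀ π) _ =
      (Ext.mk₀ ψ.τ₃).comp ((hs' k).extClass.comp (resClass hs' a' k) _) _
    rw [Ext.comp_assoc_of_third_deg_zero, ih]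
    rw [← Ext.comp_assoc (Ext.mk₀ ψ.τ₃) (hs' k).extClass (resClass hs' a' k) (zero_add 1)
      (add_comm 1 k) (by omega), ← hn]
    exact (Ext.comp_assoc_of_second_deg_zero _ _ _ _).symm

end DimensionShift

/-! ### The de Rham–Weil isomorphism -/

section DeRhamWeil
open Limits

section Abstract
variable {X : Type u} [TopologicalSpace X]

/-- The sections of a kernel are the sections that are sent to zero. -/
def kernelSec {F F' : AbSheaf X} (φ : F ⟶ F') (U : Opens X) :
    ASec (kernel φ) U ≃+ (amap φ U).ker :=
  AddEquiv.ofBijective ((amap (kernel.ι φ) U).codRestrict (amap φ U).ker fun s =>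
      (congrArg (fun ψ : kernel φ ⟶ F' => amap ψ U s) (kernel.condition φ) :))
    ⟨fun s t h => amap_injective (kernel.ι φ) U (congrArg Subtype.val h), fun t => by
      obtain ⟨s, hs⟩ := exists_amap_kernel_eq φ t.1 t.2
      exact ⟨s, Subtype.ext hs⟩⟩

theorem amap_kernelSec_symm {F F' : AbSheaf X} (φ : F ⟶ F') {U : Opens X}
    (t : (amap φ U).ker) : amap (kernel.ι φ) U ((kernelSec φ U).symm t) = t.1 :=
  congrArg Subtype.val ((kernelSec φ U).apply_symm_apply t)

variable {F : ℕ → AbSheaf X} {d : ∀ k, F k ⟶ F (k + 1)} {hd : ∀ k, d k ≫ d (k + 1) = 0}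
  (hs : ∀ k, (cycleSeq hd k).ShortExact) {P : AbSheaf X} (a : kernel (d 0) ⟶ P)

/-- The map from the global cycles of a resolution of `P` to the cohomology of `P`. -/
def cyclesToH (k : ℕ) : (amap (d k) ⊤).ker →+ Sheaf.H.{u} P k :=
  ((resClass.{u + 1, u, u} hs a k).postcomp _ (zero_add k)).comp
    ((hZero (kernel (d k))).symm.toAddMonoidHom.comp (kernelSec (d k) ⊤).symm.toAddMonoidHom)

theorem cyclesToH_apply (k : ℕ) (t : (amap (d k) ⊤).ker) :
    cyclesToH hs a k t = ((hZero (kernel (d k))).symm ((kernelSec (d k) ⊤).symm t)).comp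
      (resClass.{u + 1, u, u} hs a k) (zero_add k) := rfl

variable (hF : ∀ k i, Subsingleton (Sheaf.H.{u} (F k) (i + 1)))

include hF in
theorem cyclesToH_surjective [IsIso a] (k : ℕ) : Function.Surjective (cyclesToH hs a k) :=
  (surjective_comp_resClass hs a hF k).comp
    ((hZero (kernel (d k))).symm.surjective.comp (kernelSec (d k) ⊤).symm.surjective)

theorem cyclesToH_zero_eq_zero_iff [IsIso a] (t : (amap (d 0) ⊤).ker) :
    cyclesToH hs a 0 t = 0 ↔ t.1 = 0 := by
  rw [cyclesToH_apply]
  refine (comp_resClass_zero_eq_zero_iff hs a _).trans ?_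
  refine ((hZero _).symm.map_eq_zero_iff.trans (kernelSec (d 0) ⊤).symm.map_eq_zero_iff).trans ?_
  exact Subtype.ext_iff

include hF in
theorem cyclesToH_succ_eq_zero_iff [IsIso a] (k : ℕ) (t : (amap (d (k + 1)) ⊤).ker) :
    cyclesToH hs a (k + 1) t = 0 ↔ ∃ s, amap (d k) ⊤ s = t.1 := by
  rw [cyclesToH_apply]
  refine (comp_resClass_succ_eq_zero_iff hs a hF k _).trans ?_
  have key : ∀ y : Sheaf.H.{u} (F k) 0,
      Sheaf.H.map (kernel.lift (d (k + 1)) (d k) (hd k)) 0 y =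
        (hZero (kernel (d (k + 1)))).symm ((kernelSec (d (k + 1)) ⊤).symm t) ↔
      amap (d k) ⊤ (hZero _ y) = t.1 := by
    intro y
    rw [← (hZero (kernel (d (k + 1)))).injective.eq_iff, hZero_map, AddEquiv.apply_symm_apply,
      ← (amap_injective (kernel.ι (d (k + 1))) ⊤).eq_iff, amap_kernelSec_symm, ← amap_comp,
      kernel.lift_ι]
  constructor
  · rintro ⟨y, hy⟩
    exact ⟨_, (key y).1 hy⟩
  · rintro ⟨s, hs⟩
    refine ⟨(hZero (F k)).symm s, (key _).2 ?_⟩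
    rw [AddEquiv.apply_symm_apply, hs]

theorem map_cyclesToH {F' : ℕ → AbSheaf X} {d' : ∀ k, F' k ⟶ F' (k + 1)}
    {hd' : ∀ k, d' k ≫ d' (k + 1) = 0} (hs' : ∀ k, (cycleSeq hd' k).ShortExact) {P' : AbSheaf X}
    (a' : kernel (d' 0) ⟶ P') (φ : ∀ k, F k ⟶ F' k) (hφ : ∀ k, d k ≫ φ (k + 1) = φ k ≫ d' k)
    (π : P ⟶ P') (hπ : kernel.map (d 0) (d' 0) (φ 0) (φ 1) (hφ 0) ≫ a' = a ≫ π) (k : ℕ)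
    (t : (amap (d k) ⊤).ker) (t' : (amap (d' k) ⊤).ker) (ht : t'.1 = amap (φ k) ⊤ t.1) :
    Sheaf.H.map π k (cyclesToH hs a k t) = cyclesToH hs' a' k t' := by
  rw [cyclesToH_apply, cyclesToH_apply, Sheaf.H.map_apply, Abelian.Ext.comp_assoc_of_third_deg_zero,
    resClass_comp hs a hs' a' φ hφ π hπ, ← Abelian.Ext.comp_assoc_of_second_deg_zero]
  congr 1
  refine (hZero _).injective ((hZero_map _ _).trans ?_)
  rw [AddEquiv.apply_symm_apply, AddEquiv.apply_symm_apply,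
    ← (amap_injective (kernel.ι (d' k)) ⊤).eq_iff, amap_kernelSec_symm, ← amap_comp,
    kernel.lift_ι, amap_comp, amap_kernelSec_symm, ht]

end Abstract

/-- Replacing the source of a morphism by an isomorphic one is compatible with the maps that a
commutative square induces on kernels. -/
theorem kernel_map_comp_kernel_map {C : Type*} [Category C] [Abelian C] {A B Z A' B' Z' : C}
    {e : A ≅ B} {e' : A' ≅ B'} {φ : A ⟶ Z} {ψ : B ⟶ Z} {φ' : A' ⟶ Z'} {ψ' : B' ⟶ Z'}
    (h : ψ ≫ 𝟙 Z = e.inv ≫ φ) (h' : ψ' ≫ 𝟙 Z' = e'.inv ≫ φ') {α : A ⟶ A'} {β : B ⟶ B'} {ζ : Z ⟶ Z'}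
    (hβ : e.hom ≫ β = α ≫ e'.hom) (h1 : ψ ≫ ζ = β ≫ ψ') (h2 : φ ≫ ζ = α ≫ φ') :
    kernel.map ψ ψ' β ζ h1 ≫ kernel.map ψ' φ' e'.inv (𝟙 Z') h' =
      kernel.map ψ φ e.inv (𝟙 Z) h ≫ kernel.map φ φ' α ζ h2 := by
  rw [← cancel_mono (kernel.ι φ')]
  have : β ≫ e'.inv = e.inv ≫ α := by rw [Iso.eq_inv_comp, ← Category.assoc, hβ]; simp
  simp [this]

variable {n : ℕ} {𝕂 : Type} [RCLike 𝕂] {X : Type u} [TopologicalSpace X]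
  [ChartedSpace (EuclideanSpace ℝ (Fin n)) X] [IsManifold (𝓡 n) ∞ X]
  {G G' : SheafOfModules.{u} (smoothRing n 𝕂 X)}

namespace Connection

theorem d_zero_comp_id (D : Connection G) :
    D.d 0 ≫ 𝟙 (formSheaf G 1) = (zeroFormIso G).inv ≫ D.D := by
  rw [Category.comp_id, Iso.eq_inv_comp, zeroFormIso_hom_d]

/-- Parallel sections are the closed 0-forms. -/
def kernelToParallel (D : Connection G) : kernel (D.d 0) ⟶ D.parallel :=
  kernel.map (D.d 0) D.D (zeroFormIso G).inv (𝟙 _) D.d_zero_comp_id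

instance (D : Connection G) : IsIso D.kernelToParallel :=
  (kernel.mapIso (D.d 0) D.D (zeroFormIso G).symm (Iso.refl _) D.d_zero_comp_id).isIso_hom

theorem IsFlat.cycleSeq_shortExact {D : Connection G} (hD : D.IsFlat)
    (hG : HasLocalFreeResolutions G) (k : ℕ) : (cycleSeq (hD.d_d hG) k).ShortExact :=
  SmoothConn.cycleSeq_shortExact (hD.d_d hG) k (hD.exact_d hG k)

variable [T2Space X] [SecondCountableTopology X]

/-- The map from closed forms to the cohomology of the sheaf of parallel sections. -/
def IsFlat.closedToH {D : Connection G} (hD : D.IsFlat) (hG : HasLocalFreeResolutions G) (k : ℕ) :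
    (D.dForm k ⊤).ker →+ Sheaf.H.{u} D.parallel k :=
  cyclesToH (hD.cycleSeq_shortExact hG) D.kernelToParallel k

theorem IsFlat.closedToH_surjective {D : Connection G} (hD : D.IsFlat)
    (hG : HasLocalFreeResolutions G) (k : ℕ) : Function.Surjective (hD.closedToH hG k) :=
  cyclesToH_surjective (hD.cycleSeq_shortExact hG) D.kernelToParallel (formsAcyclic G) k

theorem IsFlat.ker_closedToH {D : Connection G} (hD : D.IsFlat)
    (hG : HasLocalFreeResolutions G) (k : ℕ) :
    (hD.closedToH hG k).ker = (D.coboundaries k).addSubgroupOf (D.dForm k ⊤).ker := by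
  ext t
  rw [AddMonoidHom.mem_ker, AddSubgroup.mem_addSubgroupOf]
  cases k with
  | zero => exact cyclesToH_zero_eq_zero_iff (hD.cycleSeq_shortExact hG) D.kernelToParallel t
  | succ k =>
    exact cyclesToH_succ_eq_zero_iff (hD.cycleSeq_shortExact hG) D.kernelToParallel
      (formsAcyclic G) k t

/-- The de Rham–Weil isomorphism. -/
def IsFlat.cohomologyEquiv {D : Connection G} (hD : D.IsFlat) (hG : HasLocalFreeResolutions G)
    (k : ℕ) : D.Cohomology k ≃+ Sheaf.H.{u} D.parallel k :=
  (QuotientAddGroup.quotientAddEquivOfEq (hD.ker_closedToH hG k).symm).trans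
    (QuotientAddGroup.quotientKerEquivOfSurjective _ (hD.closedToH_surjective hG k))

variable {D : Connection G} {D' : Connection G'} {f : G ⟶ G'}

theorem IsHorizontal.d_formMap (hf : D.IsHorizontal D' f) (k : ℕ) :
    D.d k ≫ formMap f (k + 1) = formMap f k ≫ D'.d k := by
  ext U θ
  exact hf.mapForm_dForm k U.unop θ

theorem zeroFormIso_hom_formMap (f : G ⟶ G') :
    (zeroFormIso G).hom ≫ formMap f 0 = toAbMap f ≫ (zeroFormIso G').hom := by
  ext U g
  exact Form.ext (X := X) fun V hV ξ => (res_secMap f hV g).symm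

theorem IsHorizontal.kernel_map_comp_kernelToParallel (hf : D.IsHorizontal D' f) :
    kernel.map (D.d 0) (D'.d 0) (formMap f 0) (formMap f 1) (hf.d_formMap 0) ≫
      D'.kernelToParallel = D.kernelToParallel ≫ hf.parallelMap :=
  kernel_map_comp_kernel_map D.d_zero_comp_id D'.d_zero_comp_id (zeroFormIso_hom_formMap f)
    (hf.d_formMap 0) hf

/-- The de Rham–Weil isomorphism is natural. -/
theorem IsHorizontal.map_cohomologyEquiv (hf : D.IsHorizontal D' f) (hD : D.IsFlat)
    (hD' : D'.IsFlat) (hG : HasLocalFreeResolutions G) (hG' : HasLocalFreeResolutions G') (k : ℕ)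
    (c : D.Cohomology k) : Sheaf.H.map hf.parallelMap k (hD.cohomologyEquiv hG k c) =
      hD'.cohomologyEquiv hG' k (hf.cohomologyMap k c) := by
  obtain ⟨t, rfl⟩ := QuotientAddGroup.mk_surjective c
  exact map_cyclesToH (hD.cycleSeq_shortExact hG) D.kernelToParallel
    (hD'.cycleSeq_shortExact hG') D'.kernelToParallel (fun k => formMap f k) hf.d_formMap
    hf.parallelMap hf.kernel_map_comp_kernelToParallel k t ⟨_, hf.mapForm_mem_ker k t⟩ rfl

end Connection
end DeRhamWeil
end SmoothConn
end

theorem mainTheorem5 (n : ℕ) (𝕂 : Type) [RCLike 𝕂] (X : Type u) [TopologicalSpace X]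
    [T2Space X] [SecondCountableTopology X]
    [ChartedSpace (EuclideanSpace ℝ (Fin n)) X] [IsManifold (𝓡 n) ∞ X] :
    (∀ (G : SheafOfModules.{u} (smoothRing n 𝕂 X)) (D : Connection G), D.IsFlat →
      HasLocalFreeResolutions G →
        D.ParallelGenerates ∧ IsLocallyFree G ∧ D.IsLocalSystem ∧
        D.IsResolution ∧ FormsAcyclic G) ∧
    ∃ Φ : ∀ (G : SheafOfModules.{u} (smoothRing n 𝕂 X)) (D : Connection G), D.IsFlat →
        HasLocalFreeResolutions G → ∀ k : ℕ, Sheaf.H.{u} D.parallel k ≃+ D.Cohomology k,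
      ∀ (G G' : SheafOfModules.{u} (smoothRing n 𝕂 X)) (D : Connection G) (D' : Connection G')
        (hD : D.IsFlat) (hD' : D'.IsFlat) (hG : HasLocalFreeResolutions G)
        (hG' : HasLocalFreeResolutions G') (f : G ⟶ G') (hf : D.IsHorizontal D' f)
        (k : ℕ) (c : Sheaf.H.{u} D.parallel k),
        Φ G' D' hD' hG' k (Sheaf.H.map hf.parallelMap k c) =
          hf.cohomologyMap k (Φ G D hD hG k c) := by
  refine ⟨fun G D hD hG => ⟨Connection.IsFlat.parallelGenerates hD hG, D.isLocallyFree hG,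
    Connection.IsFlat.isLocalSystem hD hG, hD.isResolution hG, formsAcyclic G⟩,
    fun G D hD hG k => (hD.cohomologyEquiv hG k).symm, ?_⟩
  intro G G' D D' hD hD' hG hG' f hf k c
  rw [AddEquiv.symm_apply_eq, ← hf.map_cohomologyEquiv hD hD' hG hG', AddEquiv.apply_symm_apply]
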